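/- **Setting.** Let $A$ be a commutative $\mathbb{Q}$-algebra; all modules, tensor products and multilinear maps are over $A$. (Basic cases: $A$ a field of characteristic zero, or $A$ an Artin local $\mathbb{C}$-algebra with maximal ideal $\mathfrak m$ and modules of the form $A\otimes_{\mathbb{C}} V$ with $V$ a graded vector space.) For a $\mathbb{Z}$-graded module $\mathcal{H}_c$ let $C(\mathcal{H}_c)$ be the graded symmetric coalgebra, spanned by the graded commutative products $c_1\cdots c_n$ ($n\ge 0$), with the coproduct $c_1\cdots c_n\mapsto\sum_{p}\sum_{\sigma}\pm\, c_{\sigma(1)}\cdots c_{\sigma(p)}\otimes c_{\sigma(p+1)}\cdots c_{\sigma(n)}$ over $(p,n-p)$-unshuffles with Koszul signs. For a $\mathbb{Z}$-graded module $\mathcal{H}_o$ let $T^c(\mathcal{H}_o)=\bigoplus_{n\ge0}\mathcal{H}_o^{\otimes n}$ with the deconcatenation coproduct, and let $C(\mathcal{H}_c)\otimes T^c(\mathcal{H}_o)$ be the graded tensor product coalgebra. A linear map $G$ between two such coalgebras has the components $G_k(c_1,\dots,c_k)\in\mathcal{H}_c$ and $G_{k,l}(c_1,\dots,c_k;o_1,\dots,o_l)\in\mathcal{H}_o$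 obtained by evaluating $G$ at $c_1\cdots c_k\otimes 1$, respectively at $c_1\cdots c_k\otimes(o_1\otimes\cdots\otimes o_l)$, and projecting to $\mathcal{H}_c$, respectively $\mathcal{H}_o$. Coalgebra maps and coderivations between such coalgebras are always understood to be lifts of such a collection of components, i.e. their projection to $\mathcal{H}_c$ vanishes on $c_1\cdots c_k\otimes(o_1\otimes\cdots\otimes o_l)$ for $l\ge1$; coalgebra maps are counital and of degree $0$. A *weak OCHA* structure $\mathfrak{l}+\mathfrak{n}$ on $\mathcal{H}=\mathcal{H}_c\oplus\mathcal{H}_o$ is a degree one coderivation of $C(\mathcal{H}_c)\otimes T^c(\mathcal{H}_o)$ with $(\mathfrak{l}+\mathfrak{n})^2=0$; its components are denoted $l_k$ and $n_{p,q}$. It is an *OCHA* if $l_0=0$ and $n_{0,0}=0$. A *weak OCHA-morphism* $\mathfrak{f}:(\mathcal{H}',\mathfrak{l}',\mathfrak{n}')\to(\mathcal{H},\mathfrak{l},\mathfrak{n})$ is a coalgebra map $\mathfrak{f}:C(\mathcal{H}'_c)\otimes T^c(\mathcal{H}'_o)\to C(\mathcal{H}_c)\otimes T^c(\mathcal{H}_o)$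 with $\mathfrak{f}\circ(\mathfrak{l}'+\mathfrak{n}')=(\mathfrak{l}+\mathfrak{n})\circ\mathfrak{f}$; it is a *weak OCHA-isomorphism* if moreover $f_1+f_{0,1}:\mathcal{H}'_c\oplus\mathcal{H}'_o\to\mathcal{H}_c\oplus\mathcal{H}_o$ is bijective. **Lemma.** Let $(\mathcal{H},\mathfrak{l},\mathfrak{n})$ be an OCHA and $\mathcal{H}'=\mathcal{H}'_c\oplus\mathcal{H}'_o$ a pair of $\mathbb{Z}$-graded modules. 1. Let $\mathfrak{f}:C(\mathcal{H}'_c)\otimes T^c(\mathcal{H}'_o)\to C(\mathcal{H}_c)\otimes T^c(\mathcal{H}_o)$ be a coalgebra map such that $f_1+f_{0,1}:\mathcal{H}'\to\mathcal{H}$ is an isomorphism. Then $\mathfrak{f}$ has a two-sided inverse $\mathfrak{f}^{-1}$, which is again a coalgebra map; $\mathfrak{l}'+\mathfrak{n}'=\mathfrak{f}^{-1}\circ(\mathfrak{l}+\mathfrak{n})\circ\mathfrak{f}$ is a weak OCHA structure on $\mathcal{H}'$; and it is the unique weak OCHA structure on $\mathcal{H}'$ for which $\mathfrak{f}:(\mathcal{H}',\mathfrak{l}',\mathfrak{n}')\to(\mathcal{H},\mathfrak{l},\mathfrak{n})$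 is a weak OCHA-isomorphism. 2. Let $\mathfrak m\subseteq A$ be a nilpotent ideal, and let $\bar c\in\mathfrak m\,\mathcal{H}_c^0$ and $\bar o\in\mathfrak m\,\mathcal{H}_o^0$. There is a unique coalgebra map $\mathfrak{f}$ of $C(\mathcal{H}_c)\otimes T^c(\mathcal{H}_o)$ to itself with $f_0=\bar c$, $f_{0,0}=\bar o$, $f_1=\mathbf 1$, $f_{0,1}=\mathbf 1$ and all other components zero. There is a weak OCHA structure $\mathfrak{l}'+\mathfrak{n}'$ on $\mathcal{H}$ that makes $\mathfrak{f}:(\mathcal{H},\mathfrak{l}',\mathfrak{n}')\to(\mathcal{H},\mathfrak{l},\mathfrak{n})$ a weak OCHA-isomorphism (by 1 it is unique), and for all $p,q\ge0$ $$l'_p(c_1,\dots,c_p)=\sum_{k\ge0}\frac1{k!}\,l_{k+p}(\bar c^{\otimes k},c_1,\dots,c_p),$$ $$n'_{p,q}(c_1,\dots,c_p;o_1,\dots,o_q)=\sum_{k,m_0,\dots,m_q\ge0}\frac1{k!}\,n_{k+p,\,m_0+\cdots+m_q+q}(\bar c^{\otimes k},c_1,\dots,c_p;\bar o^{\otimes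 m_0},o_1,\bar o^{\otimes m_1},\dots,\bar o^{\otimes m_{q-1}},o_q,\bar o^{\otimes m_q}),$$ where only finitely many terms of each sum are non-zero. -/

import Mathlib

open scoped TensorProduct

namespace OpenClosed

noncomputable section

/-! ### Graded modules and Koszul signs

All modules are over a commutative `ℚ`-algebra `A`; a grading is a family `𝒱 : ℤ → Submodule A V`
with `V = ⨁ i, 𝒱 i`. -/

section Sign

variable {A : Type*} [CommRing A]

/-- The sign `(-1)^n` as a scalar. -/
def ksign (A : Type*) [CommRing A] (n : ℤ) : A := (((Int.negOnePow n : ℤˣ) : ℤ) : A)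

theorem ksign_even {n : ℤ} (hn : Even n) : ksign A n = 1 := by
  simp [ksign, Int.negOnePow_even n hn]

theorem ksign_odd {n : ℤ} (hn : Odd n) : ksign A n = -1 := by
  simp [ksign, Int.negOnePow_odd n hn]

/-- The sign involution `x ↦ (-1)^{|x|} x` of a graded module. -/
def sgn {V : Type*} [AddCommGroup V] [Module A V] (𝒱 : ℤ → Submodule A V)
    [DirectSum.Decomposition 𝒱] : V →ₗ[A] V :=
  (DirectSum.toModule A ℤ V fun i => ksign A i • (𝒱 i).subtype) ∘ₗ
    (DirectSum.decomposeLinearEquiv 𝒱).toLinearMap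

theorem sgn_of_mem {V : Type*} [AddCommGroup V] [Module A V] (𝒱 : ℤ → Submodule A V)
    [DirectSum.Decomposition 𝒱] {i : ℤ} {x : V} (hx : x ∈ 𝒱 i) :
    sgn 𝒱 x = ksign A i • x := by
  have h : DirectSum.decomposeLinearEquiv 𝒱 x = DirectSum.lof A ℤ (fun i => 𝒱 i) i ⟨x, hx⟩ :=
    DirectSum.decompose_of_mem 𝒱 hx
  simp only [sgn, LinearMap.comp_apply, LinearEquiv.coe_coe, h, DirectSum.toModule_lof]
  simp

/-- The scalar `1/2`. -/
def half (A : Type*) [CommRing A] [Algebra ℚ A] : A := algebraMap ℚ A (1 / 2)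

theorem half_add_half (A : Type*) [CommRing A] [Algebra ℚ A] : half A + half A = 1 := by
  unfold half
  rw [← map_add]
  norm_num

/-- The graded interchange `x ⊗ y ↦ (-1)^{|x||y|} y ⊗ x` of two modules with sign involutions `s`
and `t`. If `x` is even, resp. odd, the right hand side is `y ⊗ x`, resp. `t y ⊗ x`. -/
def braid [Algebra ℚ A] {M N : Type*} [AddCommGroup M] [Module A M] [AddCommGroup N] [Module A N]
    (s : M →ₗ[A] M) (t : N →ₗ[A] N) : M ⊗[A] N →ₗ[A] N ⊗[A] M :=
  half A • ((TensorProduct.comm A M N).toLinearMap ∘ₗ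
    (TensorProduct.map LinearMap.id LinearMap.id + TensorProduct.map s LinearMap.id
      + TensorProduct.map LinearMap.id t - TensorProduct.map s t))

end Sign

/-! ### The graded symmetric coalgebra `C(V)` -/

section Symmetric

variable {A : Type*} [CommRing A] {V : Type*} [AddCommGroup V] [Module A V]

/-- The relations `x y = (-1)^{|x||y|} y x`. -/
inductive SymRel (𝒱 : ℤ → Submodule A V) : TensorAlgebra A V → TensorAlgebra A V → Prop
  | swap {i j : ℤ} {x y : V} (hx : x ∈ 𝒱 i) (hy : y ∈ 𝒱 j) :
      SymRel 𝒱 (TensorAlgebra.ι A x * TensorAlgebra.ι A y)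
        (ksign A (i * j) • (TensorAlgebra.ι A y * TensorAlgebra.ι A x))

/-- The underlying module of `C(V)`, spanned by the graded commutative products `c₁ ⋯ cₙ`.
As `n!` is invertible, `c₁ ⋯ cₙ ↦ ∑_σ ± c_{σ(1)} ⊗ ⋯ ⊗ c_{σ(n)}` identifies it with the graded
symmetric tensors, and the coproduct below with deconcatenation of tensors. Linear maps out of its
`n`-th part are the graded symmetric `n`-linear maps. -/
def Sym (𝒱 : ℤ → Submodule A V) : Type _ := RingQuot (SymRel 𝒱)

instance (𝒱 : ℤ → Submodule A V) : Ring (Sym 𝒱) :=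
  inferInstanceAs (Ring (RingQuot (SymRel 𝒱)))

instance (𝒱 : ℤ → Submodule A V) : Algebra A (Sym 𝒱) :=
  inferInstanceAs (Algebra A (RingQuot (SymRel 𝒱)))

/-- The quotient map from the tensor algebra. -/
def symMk (𝒱 : ℤ → Submodule A V) : TensorAlgebra A V →ₐ[A] Sym 𝒱 :=
  RingQuot.mkAlgHom A (SymRel 𝒱)

/-- The inclusion `V → C(V)`. -/
def symι (𝒱 : ℤ → Submodule A V) : V →ₗ[A] Sym 𝒱 :=
  (symMk 𝒱).toLinearMap ∘ₗ TensorAlgebra.ι A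

theorem symι_mul (𝒱 : ℤ → Submodule A V) {i j : ℤ} {x y : V} (hx : x ∈ 𝒱 i) (hy : y ∈ 𝒱 j) :
    symι 𝒱 x * symι 𝒱 y = ksign A (i * j) • (symι 𝒱 y * symι 𝒱 x) := by
  have h : symMk 𝒱 _ = symMk 𝒱 _ := RingQuot.mkAlgHom_rel A (SymRel.swap hx hy)
  simpa [symι] using h

/-- Algebra maps out of `C(V)` (for the graded commutative product). -/
def symLift (𝒱 : ℤ → Submodule A V) {B : Type*} [Ring B] [Algebra A B] (f : V →ₗ[A] B)
    (hf : ∀ {i j : ℤ} {x y : V}, x ∈ 𝒱 i → y ∈ 𝒱 j →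
      f x * f y = ksign A (i * j) • (f y * f x)) : Sym 𝒱 →ₐ[A] B :=
  RingQuot.liftAlgHom A ⟨TensorAlgebra.lift A f, by
    rintro _ _ ⟨hx, hy⟩
    simpa using hf hx hy⟩

@[simp] theorem symLift_symι (𝒱 : ℤ → Submodule A V) {B : Type*} [Ring B] [Algebra A B]
    (f : V →ₗ[A] B)
    (hf : ∀ {i j : ℤ} {x y : V}, x ∈ 𝒱 i → y ∈ 𝒱 j →
      f x * f y = ksign A (i * j) • (f y * f x)) (x : V) :
    symLift 𝒱 f hf (symι 𝒱 x) = f x := by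
  have h : symLift 𝒱 f hf (symι 𝒱 x) = TensorAlgebra.lift A f (TensorAlgebra.ι A x) :=
    RingQuot.liftAlgHom_mkAlgHom_apply A (TensorAlgebra.lift A f) _ _
  rw [h, TensorAlgebra.lift_ι_apply]

/-- The counit of `C(V)`. -/
def symCounit (𝒱 : ℤ → Submodule A V) : Sym 𝒱 →ₐ[A] A :=
  symLift 𝒱 0 (by simp)

/-- The projection `C(V) → V` onto the linear part. -/
def symProj (𝒱 : ℤ → Submodule A V) : Sym 𝒱 →ₗ[A] V :=
  letI : Module Aᵐᵒᵖ V := Module.compHom _ ((RingHom.id A).fromOpposite mul_comm)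
  haveI : IsCentralScalar A V := ⟨fun _ _ => rfl⟩
  (TrivSqZeroExt.sndHom A V).comp
    (symLift 𝒱 (TrivSqZeroExt.inrHom A V) (by simp)).toLinearMap

variable (𝒱 : ℤ → Submodule A V) [DirectSum.Decomposition 𝒱]

theorem symι_sgn_mul {i j : ℤ} {x y : V} (hx : x ∈ 𝒱 i) (hy : y ∈ 𝒱 j) :
    (symι 𝒱 ∘ₗ sgn 𝒱) x * (symι 𝒱 ∘ₗ sgn 𝒱) y =
      ksign A (i * j) • ((symι 𝒱 ∘ₗ sgn 𝒱) y * (symι 𝒱 ∘ₗ sgn 𝒱) x) := by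
  simp only [LinearMap.comp_apply, sgn_of_mem 𝒱 hx, sgn_of_mem 𝒱 hy, map_smul, smul_mul_assoc,
    mul_smul_comm]
  rw [symι_mul 𝒱 hx hy]
  simp only [smul_smul]
  congr 1
  ring

/-- The sign involution of `C(V)`. -/
def symSgn : Sym 𝒱 →ₐ[A] Sym 𝒱 :=
  symLift 𝒱 (symι 𝒱 ∘ₗ sgn 𝒱) fun hx hy => symι_sgn_mul 𝒱 hx hy

theorem symSgn_symι_mul {i : ℤ} {x : V} (hx : x ∈ 𝒱 i) (y : Sym 𝒱) :
    symSgn 𝒱 (symι 𝒱 x * y) = ksign A i • (symι 𝒱 x * symSgn 𝒱 y) := by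
  have h : symSgn 𝒱 (symι 𝒱 x) = symι 𝒱 (sgn 𝒱 x) :=
    symLift_symι 𝒱 _ (fun hx hy => symι_sgn_mul 𝒱 hx hy) x
  rw [map_mul, h, sgn_of_mem 𝒱 hx, map_smul, smul_mul_assoc]

variable [Algebra ℚ A]

/-- Left multiplication by `v ⊗ 1 + 1 ⊗ v` on the graded tensor product `C(V) ⊗ C(V)`, that is
`y ⊗ z ↦ v y ⊗ z + (-1)^{|v||y|} y ⊗ v z`; here `(v + sgn v)/2` and `(v - sgn v)/2` are the even and
the odd part of `v`. -/
def symMulPrim : V →ₗ[A] Module.End A (Sym 𝒱 ⊗[A] Sym 𝒱) :=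
  LinearMap.rTensorHom (Sym 𝒱) ∘ₗ LinearMap.mul A (Sym 𝒱) ∘ₗ symι 𝒱
    + LinearMap.lTensorHom (Sym 𝒱) ∘ₗ LinearMap.mul A (Sym 𝒱) ∘ₗ symι 𝒱 ∘ₗ
        (half A • (LinearMap.id + sgn 𝒱))
    + (LinearMap.mulRight A ((symSgn 𝒱).toLinearMap.rTensor (Sym 𝒱))) ∘ₗ
        LinearMap.lTensorHom (Sym 𝒱) ∘ₗ LinearMap.mul A (Sym 𝒱) ∘ₗ symι 𝒱 ∘ₗ
        (half A • (LinearMap.id - sgn 𝒱))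

theorem symMulPrim_even {i : ℤ} {x : V} (hx : x ∈ 𝒱 i) (hi : Even i) (y z : Sym 𝒱) :
    symMulPrim 𝒱 x (y ⊗ₜ z) = (symι 𝒱 x * y) ⊗ₜ z + y ⊗ₜ (symι 𝒱 x * z) := by
  have hs : sgn 𝒱 x = x := by simp [sgn_of_mem 𝒱 hx, ksign_even hi]
  simp [symMulPrim, hs, ← add_smul, half_add_half]

theorem symMulPrim_odd {i : ℤ} {x : V} (hx : x ∈ 𝒱 i) (hi : Odd i) (y z : Sym 𝒱) :
    symMulPrim 𝒱 x (y ⊗ₜ z) = (symι 𝒱 x * y) ⊗ₜ z + symSgn 𝒱 y ⊗ₜ (symι 𝒱 x * z) := by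
  have hs : sgn 𝒱 x = -x := by simp [sgn_of_mem 𝒱 hx, ksign_odd hi]
  simp [symMulPrim, hs, ← add_smul, half_add_half]

theorem symMulPrim_comm {i j : ℤ} {x y : V} (hx : x ∈ 𝒱 i) (hy : y ∈ 𝒱 j) :
    symMulPrim 𝒱 x * symMulPrim 𝒱 y =
      ksign A (i * j) • (symMulPrim 𝒱 y * symMulPrim 𝒱 x) := by
  refine TensorProduct.ext' fun a b => ?_
  rw [LinearMap.smul_apply]
  have hxy := symι_mul 𝒱 hx hy
  have sx := symSgn_symι_mul 𝒱 hx
  have sy := symSgn_symι_mul 𝒱 hy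
  rcases Int.even_or_odd i with hi | hi <;> rcases Int.even_or_odd j with hj | hj
  · simp only [ksign_even (hi.mul_right j), ksign_even hi, ksign_even hj, one_smul] at hxy sx sy ⊢
    simp only [Module.End.mul_apply, symMulPrim_even 𝒱 hx hi, symMulPrim_even 𝒱 hy hj, map_add,
      ← mul_assoc, hxy]
    abel
  · simp only [ksign_even (hi.mul_right j), ksign_even hi, ksign_odd hj, one_smul,
      neg_smul] at hxy sx sy ⊢
    simp only [Module.End.mul_apply, symMulPrim_even 𝒱 hx hi, symMulPrim_odd 𝒱 hy hj, map_add,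
      ← mul_assoc, hxy, sx]
    abel
  · simp only [ksign_even (hj.mul_left i), ksign_odd hi, ksign_even hj, one_smul,
      neg_smul] at hxy sx sy ⊢
    simp only [Module.End.mul_apply, symMulPrim_odd 𝒱 hx hi, symMulPrim_even 𝒱 hy hj, map_add,
      ← mul_assoc, hxy, sy]
    abel
  · simp only [ksign_odd (hi.mul hj), ksign_odd hi, ksign_odd hj, one_smul,
      neg_smul] at hxy sx sy ⊢
    simp only [Module.End.mul_apply, symMulPrim_odd 𝒱 hx hi,
      symMulPrim_odd 𝒱 hy hj, map_add, ← mul_assoc, hxy, sx, sy, neg_mul, TensorProduct.neg_tmul,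
      TensorProduct.tmul_neg]
    abel

/-- The coproduct of `C(V)`, `c₁ ⋯ cₙ ↦ ∑ ± c_{σ(1)} ⋯ c_{σ(p)} ⊗ c_{σ(p+1)} ⋯ c_{σ(n)}` (sum over
all `(p, n - p)`-unshuffles `σ` with their Koszul signs): it is determined by `Δ 1 = 1 ⊗ 1` and
`Δ (v x) = (v ⊗ 1 + 1 ⊗ v) Δ x`. -/
def symComul : Sym 𝒱 →ₗ[A] Sym 𝒱 ⊗[A] Sym 𝒱 where
  toFun x := (symLift 𝒱 (B := Module.End A (Sym 𝒱 ⊗[A] Sym 𝒱)) (symMulPrim 𝒱)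
    (fun hx hy => symMulPrim_comm 𝒱 hx hy) x) (1 ⊗ₜ 1)
  map_add' x y := by simp
  map_smul' a x := by simp

end Symmetric

/-! ### The tensor coalgebra `T^c(W)` -/

section Tensor

variable {A : Type*} [CommRing A] {W : Type*} [AddCommGroup W] [Module A W]

/-- For `w : W` the operator `(t, x) ↦ ((w ⊗ 1) t + 1 ⊗ w x, w x)`. -/
def tensCons : W →ₗ[A]
    Module.End A ((TensorAlgebra A W ⊗[A] TensorAlgebra A W) × TensorAlgebra A W) where
  toFun w :=
    let L := LinearMap.mul A (TensorAlgebra A W) (TensorAlgebra.ι A w)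
    LinearMap.prod
      (L.rTensor (TensorAlgebra A W) ∘ₗ LinearMap.fst A _ _
        + TensorProduct.mk A (TensorAlgebra A W) (TensorAlgebra A W) 1 ∘ₗ L ∘ₗ LinearMap.snd A _ _)
      (L ∘ₗ LinearMap.snd A _ _)
  map_add' v w := by
    refine LinearMap.ext fun x => Prod.ext ?_ ?_
    · simp [TensorProduct.tmul_add, LinearMap.rTensor_add]
      abel
    · simp
  map_smul' a w := by
    refine LinearMap.ext fun x => Prod.ext ?_ ?_
    · simp [LinearMap.rTensor_smul]
    · simp

/-- Deconcatenation `o₁ ⊗ ⋯ ⊗ oₙ ↦ ∑ₚ (o₁ ⊗ ⋯ ⊗ oₚ) ⊗ (oₚ₊₁ ⊗ ⋯ ⊗ oₙ)`: it is determined by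
`Δ 1 = 1 ⊗ 1` and `Δ (w x) = (w ⊗ 1) Δ x + 1 ⊗ w x`. -/
def tensComul : TensorAlgebra A W →ₗ[A] TensorAlgebra A W ⊗[A] TensorAlgebra A W where
  toFun x := (TensorAlgebra.lift A (tensCons (A := A) (W := W)) x (1 ⊗ₜ 1, 1)).1
  map_add' x y := by simp
  map_smul' a x := by simp

/-- The sign involution of `T^c(W)`. -/
def tensSgn (𝒲 : ℤ → Submodule A W) [DirectSum.Decomposition 𝒲] :
    TensorAlgebra A W →ₐ[A] TensorAlgebra A W :=
  TensorAlgebra.lift A (TensorAlgebra.ι A ∘ₗ sgn 𝒲)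

end Tensor

/-! ### The coalgebra `C(V) ⊗ T^c(W)` -/

section Coalg

variable {A : Type*} [CommRing A]
variable {V W : Type*} [AddCommGroup V] [Module A V] [AddCommGroup W] [Module A W]

/-- The underlying module of `C(V) ⊗ T^c(W)`. -/
abbrev OC (𝒱 : ℤ → Submodule A V) (_ : ℤ → Submodule A W) : Type _ :=
  Sym 𝒱 ⊗[A] TensorAlgebra A W

variable (𝒱 : ℤ → Submodule A V) (𝒲 : ℤ → Submodule A W)

/-- The element `c₁ ⋯ cₚ ⊗ (o₁ ⊗ ⋯ ⊗ o_q)`. -/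
def monom (c : List V) (o : List W) : OC 𝒱 𝒲 :=
  (c.map (symι 𝒱)).prod ⊗ₜ[A] (o.map (TensorAlgebra.ι A)).prod

/-- The elements of degree `d`. -/
def homDeg (d : ℤ) : Submodule A (OC 𝒱 𝒲) :=
  Submodule.span A {x | ∃ (c : List (Σ i, 𝒱 i)) (o : List (Σ i, 𝒲 i)),
    (c.map Sigma.fst).sum + (o.map Sigma.fst).sum = d ∧
      x = monom 𝒱 𝒲 (c.map fun v => (v.2 : V)) (o.map fun w => (w.2 : W))}

/-- The counit of `C(V) ⊗ T^c(W)`. -/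
def counit : OC 𝒱 𝒲 →ₗ[A] A :=
  TensorProduct.lid A A ∘ₗ
    TensorProduct.map (symCounit 𝒱).toLinearMap (TensorAlgebra.algebraMapInv).toLinearMap

/-- The projection `C(V) ⊗ T^c(W) → V`. -/
def projC : OC 𝒱 𝒲 →ₗ[A] V :=
  TensorProduct.rid A V ∘ₗ
    TensorProduct.map (symProj 𝒱) (TensorAlgebra.algebraMapInv).toLinearMap

/-- The projection `C(V) ⊗ T^c(W) → W`. -/
def projO : OC 𝒱 𝒲 →ₗ[A] W :=
  TensorProduct.lid A W ∘ₗ TensorProduct.map (symCounit 𝒱).toLinearMap TensorAlgebra.ιInv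

variable [Algebra ℚ A] [DirectSum.Decomposition 𝒱] [DirectSum.Decomposition 𝒲]

/-- The sign involution `x ↦ (-1)^{|x|} x` of `C(V) ⊗ T^c(W)`. -/
def ocSgn : OC 𝒱 𝒲 →ₗ[A] OC 𝒱 𝒲 :=
  TensorProduct.map (symSgn 𝒱).toLinearMap (tensSgn 𝒲).toLinearMap

/-- The coproduct of the graded tensor product of coalgebras `C(V) ⊗ T^c(W)`: apply both coproducts
and interchange the two middle factors with the Koszul sign. -/
def comul : OC 𝒱 𝒲 →ₗ[A] OC 𝒱 𝒲 ⊗[A] OC 𝒱 𝒲 :=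
  (TensorProduct.assoc A (Sym 𝒱) (TensorAlgebra A W) (Sym 𝒱 ⊗[A] TensorAlgebra A W)).symm ∘ₗ
  LinearMap.lTensor (Sym 𝒱)
    ((TensorProduct.assoc A (TensorAlgebra A W) (Sym 𝒱) (TensorAlgebra A W)).toLinearMap ∘ₗ
      LinearMap.rTensor (TensorAlgebra A W)
        (braid (symSgn 𝒱).toLinearMap (tensSgn 𝒲).toLinearMap) ∘ₗ
      (TensorProduct.assoc A (Sym 𝒱) (TensorAlgebra A W) (TensorAlgebra A W)).symm.toLinearMap) ∘ₗ
  (TensorProduct.assoc A (Sym 𝒱) (Sym 𝒱) (TensorAlgebra A W ⊗[A] TensorAlgebra A W)).toLinearMap ∘ₗ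
  TensorProduct.map (symComul 𝒱) tensComul

end Coalg

/-! ### Components of maps, coalgebra maps, weak OCHAs -/

section OCHA

variable {A : Type*} [CommRing A]
variable {V W : Type*} [AddCommGroup V] [Module A V] [AddCommGroup W] [Module A W]
variable {V' W' : Type*} [AddCommGroup V'] [Module A V'] [AddCommGroup W'] [Module A W']
variable {𝒱 : ℤ → Submodule A V} {𝒲 : ℤ → Submodule A W}
variable {𝒱' : ℤ → Submodule A V'} {𝒲' : ℤ → Submodule A W'}

/-- The closed component `G_p(c₁, …, cₚ) ∈ V` of a map `G : C(V') ⊗ T^c(W') → C(V) ⊗ T^c(W)`, a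
graded symmetric multilinear function of the list `c`. -/
def closedPart (G : OC 𝒱' 𝒲' →ₗ[A] OC 𝒱 𝒲) (c : List V') : V :=
  projC 𝒱 𝒲 (G (monom 𝒱' 𝒲' c []))

/-- The open component `G_{p,q}(c₁, …, cₚ; o₁, …, o_q) ∈ W`, a multilinear function of the lists
`c` and `o`, graded symmetric in `c`. -/
def openPart (G : OC 𝒱' 𝒲' →ₗ[A] OC 𝒱 𝒲) (c : List V') (o : List W') : W :=
  projO 𝒱 𝒲 (G (monom 𝒱' 𝒲' c o))

/-- `G` is built from a family `G_p(c₁, …, cₚ)`, `G_{p,q}(c₁, …, cₚ; o₁, …, o_q)`: its component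
with values in `V` takes closed inputs only. -/
def ClosedOnly (G : OC 𝒱' 𝒲' →ₗ[A] OC 𝒱 𝒲) : Prop :=
  ∀ (c : List V') (o : List W'), o ≠ [] → projC 𝒱 𝒲 (G (monom 𝒱' 𝒲' c o)) = 0

/-- `G` is homogeneous of degree `r`. -/
def HasDegree (r : ℤ) (G : OC 𝒱' 𝒲' →ₗ[A] OC 𝒱 𝒲) : Prop :=
  ∀ d, ∀ x ∈ homDeg 𝒱' 𝒲' d, G x ∈ homDeg 𝒱 𝒲 (d + r)

/-- The linear part `G_1 + G_{0,1} : V' ⊕ W' → V ⊕ W`. -/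
def linearPart (G : OC 𝒱' 𝒲' →ₗ[A] OC 𝒱 𝒲) (h : V' × W') : V × W :=
  (closedPart G [h.1], openPart G [] [h.2])

variable [Algebra ℚ A] [DirectSum.Decomposition 𝒱] [DirectSum.Decomposition 𝒲]
  [DirectSum.Decomposition 𝒱'] [DirectSum.Decomposition 𝒲']

/-- Coalgebra maps `C(V') ⊗ T^c(W') → C(V) ⊗ T^c(W)` given by a collection of degree zero maps
`f_k : V'^{⊗ k} → V` and `f_{k,l} : V'^{⊗ k} ⊗ W'^{⊗ l} → W`. -/
structure CoalgMap (𝒱' : ℤ → Submodule A V') (𝒲' : ℤ → Submodule A W')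
    (𝒱 : ℤ → Submodule A V) (𝒲 : ℤ → Submodule A W)
    [DirectSum.Decomposition 𝒱'] [DirectSum.Decomposition 𝒲']
    [DirectSum.Decomposition 𝒱] [DirectSum.Decomposition 𝒲] where
  /-- the underlying linear map -/
  toLin : OC 𝒱' 𝒲' →ₗ[A] OC 𝒱 𝒲
  degree : HasDegree 0 toLin
  counit_comp : counit 𝒱 𝒲 ∘ₗ toLin = counit 𝒱' 𝒲'
  comul_comp : comul 𝒱 𝒲 ∘ₗ toLin = TensorProduct.map toLin toLin ∘ₗ comul 𝒱' 𝒲'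
  closedOnly : ClosedOnly toLin

variable (𝒱 𝒲) in
/-- A weak OCHA structure on `V ⊕ W` is a degree one codifferential `𝔩 + 𝔫` of `C(V) ⊗ T^c(W)`
that lifts a collection of maps `l_k : V^{⊗ k} → V` and `n_{p,q} : V^{⊗ p} ⊗ W^{⊗ q} → W`. -/
structure WeakOCHA where
  /-- the coderivation `𝔩 + 𝔫` -/
  D : OC 𝒱 𝒲 →ₗ[A] OC 𝒱 𝒲
  degree : HasDegree 1 D
  /-- `Δ D = (D ⊗ 1 + 1 ⊗ D) Δ`, where `(1 ⊗ D)(x ⊗ y) = (-1)^{|x|} x ⊗ D y` -/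
  comul_comp : comul 𝒱 𝒲 ∘ₗ D =
    (TensorProduct.map D LinearMap.id + TensorProduct.map (ocSgn 𝒱 𝒲) D) ∘ₗ comul 𝒱 𝒲
  closedOnly : ClosedOnly D
  sq_zero : D ∘ₗ D = 0

/-- The operation `l_k(c₁, …, c_k)`. -/
def WeakOCHA.l (S : WeakOCHA 𝒱 𝒲) (c : List V) : V := closedPart S.D c

/-- The operation `n_{p,q}(c₁, …, cₚ; o₁, …, o_q)`. -/
def WeakOCHA.n (S : WeakOCHA 𝒱 𝒲) (c : List V) (o : List W) : W := openPart S.D c o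

variable (𝒱 𝒲) in
/-- An OCHA is a weak OCHA with `l_0 = 0` and `n_{0,0} = 0`. -/
structure OCHA extends WeakOCHA 𝒱 𝒲 where
  l_nil : toWeakOCHA.l [] = 0
  n_nil : toWeakOCHA.n [] [] = 0

/-- `f : (V' ⊕ W', S') → (V ⊕ W, S)` is a weak OCHA-morphism. -/
def IsWeakMorphism (f : CoalgMap 𝒱' 𝒲' 𝒱 𝒲) (S' : WeakOCHA 𝒱' 𝒲') (S : WeakOCHA 𝒱 𝒲) : Prop :=
  f.toLin ∘ₗ S'.D = S.D ∘ₗ f.toLin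

/-- A weak OCHA-isomorphism is a weak OCHA-morphism with bijective linear part. -/
def IsWeakIso (f : CoalgMap 𝒱' 𝒲' 𝒱 𝒲) (S' : WeakOCHA 𝒱' 𝒲') (S : WeakOCHA 𝒱 𝒲) : Prop :=
  IsWeakMorphism f S' S ∧ Function.Bijective (linearPart f.toLin)

/-- `f` is given by `f_0 = cbar`, `f_{0,0} = obar`, `f_1 = 1`, `f_{0,1} = 1`, and all other
multilinear maps zero. -/
structure IsShift (f : CoalgMap 𝒱 𝒲 𝒱 𝒲) (cbar : V) (obar : W) : Prop where
  closed_zero : closedPart f.toLin [] = cbar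
  closed_one : ∀ c, closedPart f.toLin [c] = c
  closed_high : ∀ c : List V, 2 ≤ c.length → closedPart f.toLin c = 0
  open_zero : openPart f.toLin [] [] = obar
  open_one : ∀ o, openPart f.toLin [] [o] = o
  open_high : ∀ (c : List V) (o : List W), (c ≠ [] ∨ 2 ≤ o.length) → openPart f.toLin c o = 0

end OCHA

/-- The sequence `(ō^{⊗ m₀}, o₁, ō^{⊗ m₁}, …, ō^{⊗ m_{q-1}}, o_q, ō^{⊗ m_q})`. -/
def weave {W : Type*} (obar : W) {q : ℕ} (m : Fin (q + 1) → ℕ) (o : Fin q → W) : List W :=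
  List.replicate (m 0) obar ++
    (List.ofFn fun j : Fin q => o j :: List.replicate (m j.succ) obar).flatten

end

end OpenClosed

/-! A cofree-type coalgebra is controlled by its projections to the cogenerators, and here this is
made effective. Let `pr n m` be the projection to monomials with `n` closed and `m` open letters. It
is built from the coproduct by splitting off one letter at a time: a closed letter can be split off
a word with `n + 1` closed letters in `n + 1` ways, so one divides by `n + 1` (this uses rational
scalars), while the last open letter can be split off in one way only. If `G` is comultiplicative,
`pr n m ∘ G` is therefore computed recursively from the components of `G`. Hence a coalgebra map is
determined by its components (`CoalgMap.ext_proj`), and the size of its outputs can be bounded from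
the size of its components.

Inversion. The image of `1` is group-like, so its part of type `(n, m)` is `f_0 ^ n / n!` times
`f_{0,0} ^ m`. Only finitely many types occur in it, so both constants are nilpotent in the
symmetric and the tensor algebra, and the translation by their negatives is a bijective coalgebra
map. Composing with it reduces to `f_0 = 0` and `f_{0,0} = 0`. Then let `H` be the algebra map
induced by the linear part of `f`. With respect to the weight `2 p + q` of a monomial with `p`
closed and `q` open letters, `f` and `H` agree up to lower weight. The number of letters would not
do, because `f_{1,0}` turns a closed letter into an open one. So `H⁻¹ ∘ f` is locally unipotent and
is inverted by finite geometric series (`CoalgMap.bijective_of_zero`). Being polynomials in `H⁻¹ ∘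
f` on each element, these series also preserve degrees and the span of monomials with an open
letter; this gives the inverse degree zero and the required shape of its components. Conjugating the
codifferential is then formal (`WeakOCHA.transport`).

Translation. The coalgebra map with the prescribed constants is explicit: multiplication by the
exponential of the closed constant, tensored with the insertion of the geometric series of the open
constant into every gap of a word. Both series are group-like, which makes this a coalgebra map.
Expanding it on a monomial and projecting `f D' = D f` to the cogenerators gives the formulas
(`WeakOCHA.shift_formula`); the counit kills `D'`, so the constants of `f` do not contribute on the
left. -/

namespace OpenClosed

set_option linter.unusedSectionVars false

noncomputable section

/-! ### Induction and extensionality principles; the projections to letters. -/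

section Basics

variable {A : Type*} [CommRing A] {V W : Type*} [AddCommGroup V] [Module A V]
  [AddCommGroup W] [Module A W] (𝒱 : ℤ → Submodule A V) (𝒲 : ℤ → Submodule A W)

theorem mem_of_homogeneous_mem [DirectSum.Decomposition 𝒱] {P : Submodule A V}
    (h : ∀ i, ∀ v ∈ 𝒱 i, v ∈ P) (v : V) : v ∈ P := by
  induction v using DirectSum.Decomposition.inductionOn 𝒱 with
  | zero => exact P.zero_mem
  | homogeneous x => exact h _ _ x.2
  | add x y hx hy => exact P.add_mem hx hy

theorem linearMap_ext_homogeneous [DirectSum.Decomposition 𝒱] {M : Type*} [AddCommMonoid M]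
    [Module A M] {f g : V →ₗ[A] M} (h : ∀ i, ∀ v ∈ 𝒱 i, f v = g v) : f = g :=
  LinearMap.ext fun v => mem_of_homogeneous_mem (P := LinearMap.eqLocus f g) 𝒱 h v

/-- The elements whose left multiplication preserves `P` form a subalgebra. It contains all letters,
hence everything, and one applies it to `1 ∈ P`. -/
theorem sym_induction [DirectSum.Decomposition 𝒱] {P : Submodule A (Sym 𝒱)} (h1 : 1 ∈ P)
    (hV : ∀ i, ∀ v ∈ 𝒱 i, ∀ x ∈ P, symι 𝒱 v * x ∈ P) (x : Sym 𝒱) : x ∈ P := by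
  have key : ∀ t : TensorAlgebra A V, ∀ y ∈ P, symMk 𝒱 t * y ∈ P := by
    intro t
    induction t using TensorAlgebra.induction with
    | algebraMap r =>
      intro y hy
      rw [AlgHom.commutes, ← Algebra.smul_def]
      exact P.smul_mem _ hy
    | ι v =>
      intro y hy
      exact mem_of_homogeneous_mem 𝒱
        (P := P.comap (LinearMap.mulRight A y ∘ₗ symι 𝒱)) (fun i v hv => hV i v hv y hy) v
    | mul a b ha hb =>
      intro y hy
      rw [map_mul, mul_assoc]
      exact ha _ (hb _ hy)
    | add a b ha hb =>
      intro y hy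
      rw [map_add, add_mul]
      exact P.add_mem (ha _ hy) (hb _ hy)
  obtain ⟨t, rfl⟩ := RingQuot.mkAlgHom_surjective A (SymRel 𝒱) x
  have h := key t 1 h1
  rwa [mul_one] at h

variable {𝒱} in
theorem sym_hom_ext [DirectSum.Decomposition 𝒱] {M : Type*} [AddCommMonoid M]
    [Module A M] {f g : Sym 𝒱 →ₗ[A] M} (h1 : f 1 = g 1)
    (h : ∀ i, ∀ v ∈ 𝒱 i, ∀ x, f x = g x → f (symι 𝒱 v * x) = g (symι 𝒱 v * x)) : f = g :=
  LinearMap.ext fun x => sym_induction (P := LinearMap.eqLocus f g) 𝒱 h1 h x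

theorem tens_induction {P : Submodule A (TensorAlgebra A W)} (h1 : 1 ∈ P)
    (hW : ∀ w, ∀ x ∈ P, TensorAlgebra.ι A w * x ∈ P) (x : TensorAlgebra A W) : x ∈ P := by
  have key : ∀ t : TensorAlgebra A W, ∀ y ∈ P, t * y ∈ P := by
    intro t
    induction t using TensorAlgebra.induction with
    | algebraMap r =>
      intro y hy
      rw [← Algebra.smul_def]
      exact P.smul_mem _ hy
    | ι w => exact hW w
    | mul a b ha hb =>
      intro y hy
      rw [mul_assoc]
      exact ha _ (hb _ hy)
    | add a b ha hb =>
      intro y hy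
      rw [add_mul]
      exact P.add_mem (ha _ hy) (hb _ hy)
  simpa using key x 1 h1

theorem tens_hom_ext {M : Type*} [AddCommMonoid M] [Module A M] {f g : TensorAlgebra A W →ₗ[A] M}
    (h1 : f 1 = g 1)
    (h : ∀ w x, f x = g x → f (TensorAlgebra.ι A w * x) = g (TensorAlgebra.ι A w * x)) : f = g :=
  LinearMap.ext fun x => tens_induction (P := LinearMap.eqLocus f g) h1 h x

/-- The inclusion of `V` into `C(V) ⊗ T^c(W)`. -/
def inC : V →ₗ[A] OC 𝒱 𝒲 := (TensorProduct.mk A _ _).flip 1 ∘ₗ symι 𝒱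

/-- The inclusion of `W` into `C(V) ⊗ T^c(W)`. -/
def inO : W →ₗ[A] OC 𝒱 𝒲 := TensorProduct.mk A _ _ 1 ∘ₗ TensorAlgebra.ι A

theorem inC_apply (v : V) : inC 𝒱 𝒲 v = symι 𝒱 v ⊗ₜ 1 := rfl

theorem inO_apply (w : W) : inO 𝒱 𝒲 w = 1 ⊗ₜ TensorAlgebra.ι A w := rfl

@[simp] theorem inC_mul_tmul (v : V) (x : Sym 𝒱) (y : TensorAlgebra A W) :
    inC 𝒱 𝒲 v * x ⊗ₜ[A] y = (symι 𝒱 v * x) ⊗ₜ y := by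
  simp [inC_apply]

@[simp] theorem inO_mul_tmul (w : W) (x : Sym 𝒱) (y : TensorAlgebra A W) :
    inO 𝒱 𝒲 w * x ⊗ₜ[A] y = x ⊗ₜ (TensorAlgebra.ι A w * y) := by
  simp [inO_apply]

theorem oc_induction [DirectSum.Decomposition 𝒱] [DirectSum.Decomposition 𝒲]
    {P : Submodule A (OC 𝒱 𝒲)} (h1 : 1 ∈ P)
    (hV : ∀ i, ∀ v ∈ 𝒱 i, ∀ x ∈ P, inC 𝒱 𝒲 v * x ∈ P)
    (hW : ∀ i, ∀ w ∈ 𝒲 i, ∀ x ∈ P, inO 𝒱 𝒲 w * x ∈ P) (x : OC 𝒱 𝒲) : x ∈ P := by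
  have hy : ∀ y : TensorAlgebra A W, (1 : Sym 𝒱) ⊗ₜ[A] y ∈ P := fun y =>
    tens_induction (P := P.comap (TensorProduct.mk A _ _ (1 : Sym 𝒱))) h1
      (fun w x hx => mem_of_homogeneous_mem 𝒲
        (P := P.comap (TensorProduct.mk A _ _ (1 : Sym 𝒱) ∘ₗ LinearMap.mulRight A x ∘ₗ
          TensorAlgebra.ι A)) (fun i w hw => by simpa using hW i w hw _ hx) w) y
  induction x using TensorProduct.induction_on with
  | zero => exact P.zero_mem
  | add a b ha hb => exact P.add_mem ha hb
  | tmul x y =>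
    exact sym_induction 𝒱 (P := P.comap ((TensorProduct.mk A _ _).flip y)) (hy y)
      (fun i v hv x hx => by simpa using hV i v hv _ hx) x

@[simp] theorem monom_nil : monom 𝒱 𝒲 [] [] = 1 := rfl

theorem monom_cons_left (v : V) (c : List V) (o : List W) :
    monom 𝒱 𝒲 (v :: c) o = inC 𝒱 𝒲 v * monom 𝒱 𝒲 c o := by
  simp [monom]

theorem monom_cons_right (w : W) (c : List V) (o : List W) :
    monom 𝒱 𝒲 c (w :: o) = inO 𝒱 𝒲 w * monom 𝒱 𝒲 c o := by
  simp [monom]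

theorem mul_mem_span {R : Type*} [Ring R] [Algebra A R] {s : Set R} {P : Submodule A R} {z : R}
    (h : ∀ x ∈ s, z * x ∈ P) {x : R} (hx : x ∈ Submodule.span A s) : z * x ∈ P :=
  (Submodule.span_le (p := P.comap (LinearMap.mulLeft A z))).2 h hx

variable {𝒱 𝒲}

theorem one_mem_homDeg : (1 : OC 𝒱 𝒲) ∈ homDeg 𝒱 𝒲 0 :=
  Submodule.subset_span ⟨[], [], by simp⟩

theorem inC_mul_mem_homDeg {i d : ℤ} {v : V} (hv : v ∈ 𝒱 i) {x : OC 𝒱 𝒲}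
    (hx : x ∈ homDeg 𝒱 𝒲 d) : inC 𝒱 𝒲 v * x ∈ homDeg 𝒱 𝒲 (i + d) := by
  refine mul_mem_span ?_ hx
  rintro _ ⟨c, o, rfl, rfl⟩
  exact Submodule.subset_span
    ⟨⟨i, v, hv⟩ :: c, o, by simp [add_assoc], by simp [monom_cons_left]⟩

theorem inO_mul_mem_homDeg {i d : ℤ} {w : W} (hw : w ∈ 𝒲 i) {x : OC 𝒱 𝒲}
    (hx : x ∈ homDeg 𝒱 𝒲 d) : inO 𝒱 𝒲 w * x ∈ homDeg 𝒱 𝒲 (i + d) := by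
  refine mul_mem_span ?_ hx
  rintro _ ⟨c, o, rfl, rfl⟩
  exact Submodule.subset_span
    ⟨c, ⟨i, w, hw⟩ :: o, by simp [add_left_comm], by simp [monom_cons_right]⟩

variable (𝒱 𝒲) in
-- Left multiplication by a homogeneous letter shifts the degree, so the sum of the graded pieces
-- contains `1` and is stable under letters. This is what reduces identities of linear maps to
-- homogeneous elements and to monomials below.
theorem iSup_homDeg [DirectSum.Decomposition 𝒱] [DirectSum.Decomposition 𝒲] :
    ⨆ d, homDeg 𝒱 𝒲 d = ⊤ := by
  have hm : ∀ (z : OC 𝒱 𝒲) (e : ℤ), (∀ d, ∀ x ∈ homDeg 𝒱 𝒲 d, z * x ∈ homDeg 𝒱 𝒲 (e + d)) →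
      ∀ x ∈ ⨆ d, homDeg 𝒱 𝒲 d, z * x ∈ ⨆ d, homDeg 𝒱 𝒲 d := by
    intro z e hz x hx
    have : (⨆ d, homDeg 𝒱 𝒲 d) ≤ (⨆ d, homDeg 𝒱 𝒲 d).comap (LinearMap.mulLeft A z) :=
      iSup_le fun d x hx => Submodule.mem_iSup_of_mem (e + d) (hz d x hx)
    exact this hx
  exact eq_top_iff.2 fun x _ => oc_induction 𝒱 𝒲 (Submodule.mem_iSup_of_mem 0 one_mem_homDeg)
    (fun i v hv => hm _ i fun d x hx => inC_mul_mem_homDeg hv hx)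
    (fun i w hw => hm _ i fun d x hx => inO_mul_mem_homDeg hw hx) x

theorem oc_hom_ext_homogeneous [DirectSum.Decomposition 𝒱] [DirectSum.Decomposition 𝒲]
    {M : Type*} [AddCommMonoid M] [Module A M] {f g : OC 𝒱 𝒲 →ₗ[A] M}
    (h : ∀ d, ∀ x ∈ homDeg 𝒱 𝒲 d, f x = g x) : f = g := by
  have : (⨆ d, homDeg 𝒱 𝒲 d) ≤ LinearMap.eqLocus f g := iSup_le fun d x hx => h d x hx
  rw [iSup_homDeg] at this
  exact LinearMap.ext fun x => this (Submodule.mem_top (x := x))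

theorem monom_span [DirectSum.Decomposition 𝒱] [DirectSum.Decomposition 𝒲]
    {P : Submodule A (OC 𝒱 𝒲)} (h : ∀ c o, monom 𝒱 𝒲 c o ∈ P) (x : OC 𝒱 𝒲) : x ∈ P := by
  have : (⨆ d, homDeg 𝒱 𝒲 d) ≤ P := iSup_le fun d => Submodule.span_le.2 <| by
    rintro _ ⟨c, o, -, rfl⟩
    exact h _ _
  rw [iSup_homDeg] at this
  exact this (Submodule.mem_top (x := x))

theorem oc_hom_ext [DirectSum.Decomposition 𝒱] [DirectSum.Decomposition 𝒲]
    {M : Type*} [AddCommMonoid M] [Module A M] {f g : OC 𝒱 𝒲 →ₗ[A] M}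
    (h : ∀ c o, f (monom 𝒱 𝒲 c o) = g (monom 𝒱 𝒲 c o)) : f = g :=
  LinearMap.ext fun x => monom_span (P := LinearMap.eqLocus f g) h x

variable (𝒱)

@[simp] theorem symCounit_symι_mul (v : V) (x : Sym 𝒱) : symCounit 𝒱 (symι 𝒱 v * x) = 0 := by
  simp [symCounit]

@[simp] theorem symProj_one : symProj 𝒱 1 = 0 := by
  -- The trivial square-zero extension needs a right action; it must be the one chosen in `symProj`.
  let : Module Aᵐᵒᵖ V := Module.compHom _ ((RingHom.id A).fromOpposite mul_comm)
  have : IsCentralScalar A V := ⟨fun _ _ => rfl⟩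
  simp [symProj]

/-- `symProj` is the second coordinate of an algebra map to the trivial square-zero extension whose
first coordinate is the counit; multiplying by a square-zero element retains only that first
coordinate. -/
theorem symProj_symι_mul [DirectSum.Decomposition 𝒱] (v : V) (x : Sym 𝒱) :
    symProj 𝒱 (symι 𝒱 v * x) = symCounit 𝒱 x • v := by
  let : Module Aᵐᵒᵖ V := Module.compHom _ ((RingHom.id A).fromOpposite mul_comm)
  have : IsCentralScalar A V := ⟨fun _ _ => rfl⟩
  have h : (TrivSqZeroExt.fstHom A A V).toLinearMap ∘ₗ
      (symLift 𝒱 (TrivSqZeroExt.inrHom A V) (by simp)).toLinearMap = (symCounit 𝒱).toLinearMap :=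
    sym_hom_ext (by simp) fun i v _ x _ => by simp
  have hx : (symLift 𝒱 (TrivSqZeroExt.inrHom A V) (by simp) x).fst = symCounit 𝒱 x :=
    LinearMap.congr_fun h x
  simp [symProj, hx]

@[simp] theorem algebraMapInv_ι_mul (w : W) (x : TensorAlgebra A W) :
    TensorAlgebra.algebraMapInv (TensorAlgebra.ι A w * x) = 0 := by
  simp [TensorAlgebra.algebraMapInv]

@[simp] theorem ιInv_one : TensorAlgebra.ιInv (1 : TensorAlgebra A W) = 0 := by
  let : Module Aᵐᵒᵖ W := Module.compHom _ ((RingHom.id A).fromOpposite mul_comm)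
  have : IsCentralScalar A W := ⟨fun _ _ => rfl⟩
  simp [TensorAlgebra.ιInv]

theorem ιInv_ι_mul (w : W) (x : TensorAlgebra A W) :
    TensorAlgebra.ιInv (TensorAlgebra.ι A w * x) = TensorAlgebra.algebraMapInv x • w := by
  let : Module Aᵐᵒᵖ W := Module.compHom _ ((RingHom.id A).fromOpposite mul_comm)
  have : IsCentralScalar A W := ⟨fun _ _ => rfl⟩
  have h : (TrivSqZeroExt.fstHom A A W).comp TensorAlgebra.toTrivSqZeroExt =
      TensorAlgebra.algebraMapInv := by
    ext; simp [TensorAlgebra.algebraMapInv]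
  have hx : (TensorAlgebra.toTrivSqZeroExt x).fst = TensorAlgebra.algebraMapInv x :=
    DFunLike.congr_fun h x
  simp [TensorAlgebra.ιInv, hx]

end Basics

/-! ### Letter-by-letter recursions for projections, signs and coproducts. -/

section Comul

variable {A : Type*} [CommRing A] {V W : Type*} [AddCommGroup V] [Module A V]
  [AddCommGroup W] [Module A W] {𝒱 : ℤ → Submodule A V} {𝒲 : ℤ → Submodule A W}

@[simp] theorem counit_tmul (x : Sym 𝒱) (y : TensorAlgebra A W) :
    counit 𝒱 𝒲 (x ⊗ₜ y) = symCounit 𝒱 x * TensorAlgebra.algebraMapInv y := by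
  simp [counit]

@[simp] theorem projC_tmul (x : Sym 𝒱) (y : TensorAlgebra A W) :
    projC 𝒱 𝒲 (x ⊗ₜ y) = TensorAlgebra.algebraMapInv y • symProj 𝒱 x := by
  simp [projC]

@[simp] theorem projO_tmul (x : Sym 𝒱) (y : TensorAlgebra A W) :
    projO 𝒱 𝒲 (x ⊗ₜ y) = symCounit 𝒱 x • TensorAlgebra.ιInv y := by
  simp [projO]

variable [DirectSum.Decomposition 𝒱] [DirectSum.Decomposition 𝒲]

theorem symProj_symι (v : V) : symProj 𝒱 (symι 𝒱 v) = v := by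
  simpa using symProj_symι_mul 𝒱 v 1

theorem projC_monom (c : List V) (o : List W) :
    projC 𝒱 𝒲 (monom 𝒱 𝒲 c o) = match c, o with
      | [v], [] => v
      | _, _ => 0 := by
  rcases c with _ | ⟨v, _ | ⟨v', c⟩⟩ <;> rcases o with _ | ⟨w, o⟩ <;>
    simp [monom, symProj_symι_mul, symProj_symι]

theorem projO_monom (c : List V) (o : List W) :
    projO 𝒱 𝒲 (monom 𝒱 𝒲 c o) = match c, o with
      | [], [w] => w
      | _, _ => 0 := by
  rcases c with _ | ⟨v, c⟩ <;> rcases o with _ | ⟨w, _ | ⟨w', o⟩⟩ <;>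
    simp [monom, ιInv_ι_mul, TensorAlgebra.ι_leftInverse _]

theorem projC_monom_of_length_ne {c : List V} {o : List W} (h : ¬ (c.length = 1 ∧ o.length = 0)) :
    projC 𝒱 𝒲 (monom 𝒱 𝒲 c o) = 0 := by
  rcases c with _ | ⟨v, _ | ⟨v', c⟩⟩ <;> rcases o with _ | ⟨w, o⟩ <;> simp [projC_monom, -monom_nil] at h ⊢

theorem projO_monom_of_length_ne {c : List V} {o : List W} (h : ¬ (c.length = 0 ∧ o.length = 1)) :
    projO 𝒱 𝒲 (monom 𝒱 𝒲 c o) = 0 := by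
  rcases c with _ | ⟨v, c⟩ <;> rcases o with _ | ⟨w, _ | ⟨w', o⟩⟩ <;> simp [projO_monom, -monom_nil] at h ⊢

@[simp] theorem symSgn_symι (v : V) : symSgn 𝒱 (symι 𝒱 v) = symι 𝒱 (sgn 𝒱 v) := by
  simp [symSgn]

@[simp] theorem tensSgn_ι (w : W) :
    tensSgn 𝒲 (TensorAlgebra.ι A w) = TensorAlgebra.ι A (sgn 𝒲 w) := by
  simp [tensSgn]

@[simp] theorem symCounit_symSgn (x : Sym 𝒱) : symCounit 𝒱 (symSgn 𝒱 x) = symCounit 𝒱 x :=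
  LinearMap.congr_fun (f := (symCounit 𝒱).toLinearMap ∘ₗ (symSgn 𝒱).toLinearMap)
    (g := (symCounit 𝒱).toLinearMap) (sym_hom_ext (by simp) fun i v _ x _ => by simp) x

@[simp] theorem algebraMapInv_tensSgn (x : TensorAlgebra A W) :
    TensorAlgebra.algebraMapInv (tensSgn 𝒲 x) = TensorAlgebra.algebraMapInv x :=
  LinearMap.congr_fun (f := TensorAlgebra.algebraMapInv.toLinearMap ∘ₗ (tensSgn 𝒲).toLinearMap)
    (g := TensorAlgebra.algebraMapInv.toLinearMap)
    (tens_hom_ext (by simp) fun v x _ => by simp) x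

theorem symProj_symSgn (x : Sym 𝒱) : symProj 𝒱 (symSgn 𝒱 x) = sgn 𝒱 (symProj 𝒱 x) :=
  LinearMap.congr_fun (f := symProj 𝒱 ∘ₗ (symSgn 𝒱).toLinearMap)
    (g := sgn 𝒱 ∘ₗ symProj 𝒱)
    (sym_hom_ext (by simp) fun i v _ x _ => by simp [symProj_symι_mul]) x

theorem symSgn_prod (c : List V) :
    symSgn 𝒱 (c.map (symι 𝒱)).prod = ((c.map (sgn 𝒱)).map (symι 𝒱)).prod := by
  simp [map_list_prod, Function.comp_def]

theorem tensSgn_prod (o : List W) :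
    tensSgn 𝒲 (o.map (TensorAlgebra.ι A)).prod =
      ((o.map (sgn 𝒲)).map (TensorAlgebra.ι A)).prod := by
  simp [map_list_prod, Function.comp_def]


variable [Algebra ℚ A]

variable (𝒱) in
/-- The even part of `v`. -/
def evenPart : V →ₗ[A] V := half A • (LinearMap.id + sgn 𝒱)

variable (𝒱) in
/-- The odd part of `v`. -/
def oddPart : V →ₗ[A] V := half A • (LinearMap.id - sgn 𝒱)

theorem evenPart_add_oddPart (v : V) : evenPart 𝒱 v + oddPart 𝒱 v = v := by
  simp only [evenPart, oddPart, LinearMap.smul_apply, LinearMap.add_apply, LinearMap.sub_apply,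
    LinearMap.id_apply, ← smul_add, add_add_sub_cancel]
  rw [smul_add, ← add_smul, half_add_half, one_smul]

theorem symMulPrim_tmul (v : V) (y z : Sym 𝒱) :
    symMulPrim 𝒱 v (y ⊗ₜ z) = (symι 𝒱 v * y) ⊗ₜ z + y ⊗ₜ (symι 𝒱 (evenPart 𝒱 v) * z)
      + symSgn 𝒱 y ⊗ₜ (symι 𝒱 (oddPart 𝒱 v) * z) := by
  simp only [symMulPrim, evenPart, oddPart, LinearMap.add_apply, LinearMap.comp_apply,
    LinearMap.smul_apply, LinearMap.rTensor_tmul, LinearMap.mulRight_apply,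
    Module.End.mul_apply, AlgHom.toLinearMap_apply]
  rfl

theorem evenPart_of_mem {i : ℤ} {v : V} (hv : v ∈ 𝒱 i) (hi : Even i) : evenPart 𝒱 v = v := by
  simp [evenPart, sgn_of_mem 𝒱 hv, ksign_even hi, ← add_smul, half_add_half]

theorem oddPart_of_mem {i : ℤ} {v : V} (hv : v ∈ 𝒱 i) (hi : Even i) : oddPart 𝒱 v = 0 := by
  simp [oddPart, sgn_of_mem 𝒱 hv, ksign_even hi]

theorem evenPart_of_mem_odd {i : ℤ} {v : V} (hv : v ∈ 𝒱 i) (hi : Odd i) : evenPart 𝒱 v = 0 := by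
  simp [evenPart, sgn_of_mem 𝒱 hv, ksign_odd hi]

theorem oddPart_of_mem_odd {i : ℤ} {v : V} (hv : v ∈ 𝒱 i) (hi : Odd i) : oddPart 𝒱 v = v := by
  simp [oddPart, sgn_of_mem 𝒱 hv, ksign_odd hi, ← add_smul, half_add_half]

/-- Graded commutativity without homogeneity assumptions: an even `v` passes `p` freely, an odd `v`
at the price of the sign involution on `p`. -/
theorem symι_mul_symι (p v : V) :
    symι 𝒱 p * symι 𝒱 (evenPart 𝒱 v) + symι 𝒱 (sgn 𝒱 p) * symι 𝒱 (oddPart 𝒱 v) =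
      symι 𝒱 v * symι 𝒱 p := by
  let L : V →ₗ[A] V →ₗ[A] Sym 𝒱 :=
    (LinearMap.mul A (Sym 𝒱)).compl₁₂ (symι 𝒱) (symι 𝒱 ∘ₗ evenPart 𝒱)
      + (LinearMap.mul A (Sym 𝒱)).compl₁₂ (symι 𝒱 ∘ₗ sgn 𝒱) (symι 𝒱 ∘ₗ oddPart 𝒱)
  let R : V →ₗ[A] V →ₗ[A] Sym 𝒱 := ((LinearMap.mul A (Sym 𝒱)).compl₁₂ (symι 𝒱) (symι 𝒱)).flip
  have h : L = R := by
    refine linearMap_ext_homogeneous 𝒱 fun i p hp => linearMap_ext_homogeneous 𝒱 fun j v hv => ?_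
    have hc := symι_mul 𝒱 hv hp
    rcases Int.even_or_odd j with hj | hj
    · rw [ksign_even (hj.mul_right i)] at hc
      simp [L, R, hc, evenPart_of_mem hv hj, oddPart_of_mem hv hj]
    · rcases Int.even_or_odd i with hi | hi
      · rw [ksign_even (hi.mul_left j)] at hc
        simp [L, R, hc, evenPart_of_mem_odd hv hj, oddPart_of_mem_odd hv hj, sgn_of_mem 𝒱 hp,
          ksign_even hi]
      · rw [ksign_odd (hj.mul hi)] at hc
        simp [L, R, hc, evenPart_of_mem_odd hv hj, oddPart_of_mem_odd hv hj, sgn_of_mem 𝒱 hp,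
          ksign_odd hi]
  exact LinearMap.congr_fun (LinearMap.congr_fun h p) v

@[simp] theorem symComul_one : symComul 𝒱 1 = 1 ⊗ₜ 1 := by
  simp [symComul]

@[simp] theorem symComul_symι_mul (v : V) (x : Sym 𝒱) :
    symComul 𝒱 (symι 𝒱 v * x) = symMulPrim 𝒱 v (symComul 𝒱 x) := by
  simp [symComul]


omit [Algebra ℚ A]

theorem tensCons_apply (w : W) (t : TensorAlgebra A W ⊗[A] TensorAlgebra A W)
    (x : TensorAlgebra A W) :
    tensCons w (t, x) = ((LinearMap.mulLeft A (TensorAlgebra.ι A w)).rTensor _ t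
      + 1 ⊗ₜ (TensorAlgebra.ι A w * x), TensorAlgebra.ι A w * x) := rfl

@[simp] theorem tensComul_one : tensComul (1 : TensorAlgebra A W) = 1 ⊗ₜ 1 := by
  simp [tensComul]

@[simp] theorem tensComul_ι_mul (w : W) (x : TensorAlgebra A W) :
    tensComul (TensorAlgebra.ι A w * x) =
      (LinearMap.mulLeft A (TensorAlgebra.ι A w)).rTensor _ (tensComul x)
        + 1 ⊗ₜ (TensorAlgebra.ι A w * x) := by
  -- The second coordinate only records left multiplication, so starting from `(1 ⊗ 1, 1)` the word
  -- itself is carried along with its coproduct.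
  have h : ∀ x : TensorAlgebra A W, ∀ z,
      (TensorAlgebra.lift A (tensCons (A := A) (W := W)) x z).2 = x * z.2 := by
    intro x
    induction x using TensorAlgebra.induction with
    | algebraMap r => intro z; simp [Algebra.smul_def]
    | ι w => intro z; simp [tensCons]
    | mul a b ha hb => intro z; simp [ha, hb, mul_assoc]
    | add a b ha hb => intro z; simp [ha, hb, add_mul]
  have hx : TensorAlgebra.lift A (tensCons (A := A) (W := W)) x (1 ⊗ₜ 1, 1) = (tensComul x, x) :=
    Prod.ext rfl (by rw [h, mul_one])
  have := congrArg Prod.fst (tensCons_apply w (tensComul x) x)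
  rw [← hx] at this
  simpa [tensComul] using this

end Comul

/-! ### Counit laws, and recovering a word from its split-off letters. -/

section Swap

variable {A : Type*} [CommRing A] [Algebra ℚ A] {V W : Type*} [AddCommGroup V] [Module A V]
  [AddCommGroup W] [Module A W] {𝒱 : ℤ → Submodule A V} {𝒲 : ℤ → Submodule A W}
  [DirectSum.Decomposition 𝒱] [DirectSum.Decomposition 𝒲]

variable (𝒱 𝒲) in
/-- The graded interchange of the two middle factors. -/
def midSwap : (Sym 𝒱 ⊗[A] Sym 𝒱) ⊗[A] (TensorAlgebra A W ⊗[A] TensorAlgebra A W) →ₗ[A]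
    OC 𝒱 𝒲 ⊗[A] OC 𝒱 𝒲 :=
  (TensorProduct.assoc A (Sym 𝒱) (TensorAlgebra A W) (Sym 𝒱 ⊗[A] TensorAlgebra A W)).symm ∘ₗ
  LinearMap.lTensor (Sym 𝒱)
    ((TensorProduct.assoc A (TensorAlgebra A W) (Sym 𝒱) (TensorAlgebra A W)).toLinearMap ∘ₗ
      LinearMap.rTensor (TensorAlgebra A W)
        (braid (symSgn 𝒱).toLinearMap (tensSgn 𝒲).toLinearMap) ∘ₗ
      (TensorProduct.assoc A (Sym 𝒱) (TensorAlgebra A W) (TensorAlgebra A W)).symm.toLinearMap) ∘ₗ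
  (TensorProduct.assoc A (Sym 𝒱) (Sym 𝒱) (TensorAlgebra A W ⊗[A] TensorAlgebra A W)).toLinearMap

theorem comul_tmul (x : Sym 𝒱) (y : TensorAlgebra A W) :
    comul 𝒱 𝒲 (x ⊗ₜ y) = midSwap 𝒱 𝒲 (symComul 𝒱 x ⊗ₜ tensComul y) := rfl

theorem midSwap_tmul (a b : Sym 𝒱) (p q : TensorAlgebra A W) :
    midSwap 𝒱 𝒲 ((a ⊗ₜ b) ⊗ₜ (p ⊗ₜ q)) =
      half A • ((a ⊗ₜ p) ⊗ₜ (b ⊗ₜ q) + (a ⊗ₜ p) ⊗ₜ (symSgn 𝒱 b ⊗ₜ q)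
        + (a ⊗ₜ tensSgn 𝒲 p) ⊗ₜ (b ⊗ₜ q) - (a ⊗ₜ tensSgn 𝒲 p) ⊗ₜ (symSgn 𝒱 b ⊗ₜ q)) := by
  simp [midSwap, braid, TensorProduct.tmul_add, TensorProduct.add_tmul, TensorProduct.tmul_sub,
    TensorProduct.sub_tmul]

/-- Projecting the first factor of the coproduct to `C(V)`. -/
theorem rTensor_comul {X : Type*} [AddCommGroup X] [Module A X] (α : Sym 𝒱 →ₗ[A] X)
    (x : Sym 𝒱) (y : TensorAlgebra A W) :
    (TensorProduct.rid A X ∘ₗ TensorProduct.map α TensorAlgebra.algebraMapInv.toLinearMap).rTensor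
      (OC 𝒱 𝒲) (comul 𝒱 𝒲 (x ⊗ₜ y)) =
    TensorProduct.assoc A X (Sym 𝒱) (TensorAlgebra A W)
      (α.rTensor _ (symComul 𝒱 x) ⊗ₜ (TensorProduct.lid A _
        (TensorAlgebra.algebraMapInv.toLinearMap.rTensor _ (tensComul y)))) := by
  rw [comul_tmul]
  induction symComul 𝒱 x using TensorProduct.induction_on with
  | zero => simp
  | add a b ha hb => simp only [TensorProduct.add_tmul, map_add, ha, hb]
  | tmul a b =>
    induction tensComul y using TensorProduct.induction_on with
    | zero => simp
    | add c d hc hd => simp only [TensorProduct.tmul_add, map_add, hc, hd]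
    | tmul p q =>
      rw [midSwap_tmul]
      simp only [map_smul, map_add, map_sub, LinearMap.rTensor_tmul, LinearMap.comp_apply,
        TensorProduct.map_tmul, AlgHom.toLinearMap_apply, LinearEquiv.coe_coe,
        TensorProduct.rid_tmul, TensorProduct.lid_tmul, algebraMapInv_tensSgn,
        TensorProduct.tmul_smul, TensorProduct.assoc_tmul, ← TensorProduct.smul_tmul']
      -- The counit does not see the sign involution, so two of the four terms of the interchange
      -- cancel and the other two add up to twice the half.
      rw [add_right_comm, add_sub_cancel_right, smul_add, ← add_smul, half_add_half, one_smul]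

/-- Projecting the second factor of the coproduct to `T^c(W)`. -/
theorem lTensor_comul {X : Type*} [AddCommGroup X] [Module A X] (β : TensorAlgebra A W →ₗ[A] X)
    (x : Sym 𝒱) (y : TensorAlgebra A W) :
    (TensorProduct.lid A X ∘ₗ TensorProduct.map (symCounit 𝒱).toLinearMap β).lTensor
      (OC 𝒱 𝒲) (comul 𝒱 𝒲 (x ⊗ₜ y)) =
    (TensorProduct.assoc A (Sym 𝒱) (TensorAlgebra A W) X).symm
      ((TensorProduct.rid A _ ((symCounit 𝒱).toLinearMap.lTensor _ (symComul 𝒱 x))) ⊗ₜ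
        β.lTensor _ (tensComul y)) := by
  rw [comul_tmul]
  induction symComul 𝒱 x using TensorProduct.induction_on with
  | zero => simp
  | add a b ha hb => simp only [TensorProduct.add_tmul, map_add, ha, hb]
  | tmul a b =>
    induction tensComul y using TensorProduct.induction_on with
    | zero => simp
    | add c d hc hd => simp only [TensorProduct.tmul_add, map_add, hc, hd]
    | tmul p q =>
      rw [midSwap_tmul]
      simp only [map_smul, map_add, map_sub, LinearMap.lTensor_tmul, LinearMap.comp_apply,
        TensorProduct.map_tmul, AlgHom.toLinearMap_apply, LinearEquiv.coe_coe,
        TensorProduct.rid_tmul, TensorProduct.lid_tmul, symCounit_symSgn,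
        TensorProduct.tmul_smul, TensorProduct.assoc_symm_tmul, ← TensorProduct.smul_tmul']
      rw [add_sub_cancel_right, smul_add, ← add_smul, half_add_half, one_smul]

/-- A letter in the left factor is killed by the counit; in the right factor its even and odd parts
recombine. -/
theorem symComul_counit_left (x : Sym 𝒱) :
    (symCounit 𝒱).toLinearMap.rTensor _ (symComul 𝒱 x) = 1 ⊗ₜ x := by
  refine LinearMap.congr_fun (f := (symCounit 𝒱).toLinearMap.rTensor _ ∘ₗ symComul 𝒱)
    (g := TensorProduct.mk A A (Sym 𝒱) 1) (sym_hom_ext (by simp) fun i v _ x hx => ?_) x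
  have h : (symCounit 𝒱).toLinearMap.rTensor _ ∘ₗ symMulPrim 𝒱 v =
      (LinearMap.mulLeft A (symι 𝒱 v)).lTensor _ ∘ₗ (symCounit 𝒱).toLinearMap.rTensor _ :=
    TensorProduct.ext' fun y z => by
      simp only [LinearMap.comp_apply, symMulPrim_tmul, map_add, LinearMap.rTensor_tmul,
        AlgHom.toLinearMap_apply, symCounit_symι_mul, symCounit_symSgn, TensorProduct.zero_tmul,
        zero_add, LinearMap.lTensor_tmul, LinearMap.mulLeft_apply]
      rw [← TensorProduct.tmul_add, ← add_mul, ← map_add, evenPart_add_oddPart]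
  have := LinearMap.congr_fun h (symComul 𝒱 x)
  simp only [LinearMap.comp_apply] at hx this
  simp [this, hx]

theorem symComul_counit_right (x : Sym 𝒱) :
    (symCounit 𝒱).toLinearMap.lTensor _ (symComul 𝒱 x) = x ⊗ₜ 1 := by
  refine LinearMap.congr_fun (f := (symCounit 𝒱).toLinearMap.lTensor _ ∘ₗ symComul 𝒱)
    (g := (TensorProduct.mk A (Sym 𝒱) A).flip 1) (sym_hom_ext (by simp) fun i v _ x hx => ?_) x
  have h : (symCounit 𝒱).toLinearMap.lTensor _ ∘ₗ symMulPrim 𝒱 v =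
      (LinearMap.mulLeft A (symι 𝒱 v)).rTensor _ ∘ₗ (symCounit 𝒱).toLinearMap.lTensor _ :=
    TensorProduct.ext' fun y z => by simp [symMulPrim_tmul]
  have := LinearMap.congr_fun h (symComul 𝒱 x)
  simp only [LinearMap.comp_apply] at hx this
  simp [this, hx]

theorem tensComul_counit_left (x : TensorAlgebra A W) :
    TensorAlgebra.algebraMapInv.toLinearMap.rTensor _ (tensComul x) = 1 ⊗ₜ x := by
  refine LinearMap.congr_fun (f := TensorAlgebra.algebraMapInv.toLinearMap.rTensor _ ∘ₗ tensComul)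
    (g := TensorProduct.mk A A _ 1) (tens_hom_ext (by simp) fun w x hx => ?_) x
  have h : TensorAlgebra.algebraMapInv.toLinearMap.rTensor _ ∘ₗ
      (LinearMap.mulLeft A (TensorAlgebra.ι A w)).rTensor (TensorAlgebra A W) = 0 :=
    TensorProduct.ext' fun y z => by simp
  have := LinearMap.congr_fun h (tensComul x)
  simp only [LinearMap.comp_apply] at this
  simp [this]

theorem lTensor_tensComul_ι_mul {X : Type*} [AddCommGroup X] [Module A X]
    (β : TensorAlgebra A W →ₗ[A] X) (w : W) (x : TensorAlgebra A W) :
    β.lTensor _ (tensComul (TensorAlgebra.ι A w * x)) =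
      (LinearMap.mulLeft A (TensorAlgebra.ι A w)).rTensor _ (β.lTensor _ (tensComul x))
        + 1 ⊗ₜ β (TensorAlgebra.ι A w * x) := by
  have h : β.lTensor _ ∘ₗ (LinearMap.mulLeft A (TensorAlgebra.ι A w)).rTensor _ =
      (LinearMap.mulLeft A (TensorAlgebra.ι A w)).rTensor _ ∘ₗ β.lTensor (TensorAlgebra A W) :=
    TensorProduct.ext' fun y z => by simp
  have := LinearMap.congr_fun h (tensComul x)
  simp only [LinearMap.comp_apply] at this
  simp [this]

theorem tensComul_counit_right (x : TensorAlgebra A W) :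
    TensorAlgebra.algebraMapInv.toLinearMap.lTensor _ (tensComul x) = x ⊗ₜ 1 := by
  refine LinearMap.congr_fun (f := TensorAlgebra.algebraMapInv.toLinearMap.lTensor _ ∘ₗ tensComul)
    (g := (TensorProduct.mk A _ A).flip 1) (tens_hom_ext (by simp) fun w x hx => ?_) x
  simp only [LinearMap.comp_apply] at hx ⊢
  rw [lTensor_tensComul_ι_mul, hx]
  simp

theorem counit_rTensor_comul (x : OC 𝒱 𝒲) :
    (counit 𝒱 𝒲).rTensor _ (comul 𝒱 𝒲 x) = 1 ⊗ₜ x := by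
  refine LinearMap.congr_fun (f := (counit 𝒱 𝒲).rTensor _ ∘ₗ comul 𝒱 𝒲)
    (g := TensorProduct.mk A A _ 1) (TensorProduct.ext' fun x y => ?_) x
  have h := rTensor_comul (𝒲 := 𝒲) (symCounit 𝒱).toLinearMap x y
  simp only [symComul_counit_left, tensComul_counit_left, TensorProduct.lid_tmul, one_smul,
    TensorProduct.assoc_tmul] at h
  simpa [counit, TensorProduct.lid_eq_rid] using h

theorem counit_lTensor_comul (x : OC 𝒱 𝒲) :
    (counit 𝒱 𝒲).lTensor _ (comul 𝒱 𝒲 x) = x ⊗ₜ 1 := by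
  refine LinearMap.congr_fun (f := (counit 𝒱 𝒲).lTensor _ ∘ₗ comul 𝒱 𝒲)
    (g := (TensorProduct.mk A _ A).flip 1) (TensorProduct.ext' fun x y => ?_) x
  have h := lTensor_comul (𝒱 := 𝒱) (𝒲 := 𝒲) (TensorAlgebra.algebraMapInv.toLinearMap) x y
  simp only [symComul_counit_right, tensComul_counit_right, TensorProduct.rid_tmul, one_smul,
    TensorProduct.assoc_symm_tmul] at h
  simpa [counit] using h

variable (𝒱 𝒲) in
/-- The product `V ⊗ (C(V) ⊗ T^c(W)) → C(V) ⊗ T^c(W)`. -/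
def mulC : V ⊗[A] OC 𝒱 𝒲 →ₗ[A] OC 𝒱 𝒲 :=
  TensorProduct.lift (LinearMap.mul A (OC 𝒱 𝒲) ∘ₗ inC 𝒱 𝒲)

variable (𝒱 𝒲) in
/-- The product `(C(V) ⊗ T^c(W)) ⊗ W → C(V) ⊗ T^c(W)`. -/
def mulO : OC 𝒱 𝒲 ⊗[A] W →ₗ[A] OC 𝒱 𝒲 :=
  TensorProduct.lift ((LinearMap.mul A (OC 𝒱 𝒲)).compl₂ (inO 𝒱 𝒲))

@[simp] theorem mulC_tmul (v : V) (x : OC 𝒱 𝒲) : mulC 𝒱 𝒲 (v ⊗ₜ x) = inC 𝒱 𝒲 v * x := rfl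

@[simp] theorem mulO_tmul (w : W) (x : OC 𝒱 𝒲) : mulO 𝒱 𝒲 (x ⊗ₜ w) = x * inO 𝒱 𝒲 w := rfl

variable (𝒱) in
/-- The operator multiplying `c₁ ⋯ cₙ` by `n`. -/
def symEuler : Sym 𝒱 →ₗ[A] Sym 𝒱 :=
  TensorProduct.lift (LinearMap.mul A (Sym 𝒱) ∘ₗ symι 𝒱) ∘ₗ (symProj 𝒱).rTensor _ ∘ₗ symComul 𝒱

/-- In the coproduct of `v x` the letter `v` is either the one split off, leaving the counit law for
`x`, or it stays on the right behind the split-off letter. In the second case `symι_mul_symι` moves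
it to the front. -/
theorem symEuler_symι_mul (v : V) (x : Sym 𝒱) :
    symEuler 𝒱 (symι 𝒱 v * x) = symι 𝒱 v * x + symι 𝒱 v * symEuler 𝒱 x := by
  have h : TensorProduct.lift (LinearMap.mul A (Sym 𝒱) ∘ₗ symι 𝒱) ∘ₗ (symProj 𝒱).rTensor _ ∘ₗ
      symMulPrim 𝒱 v = LinearMap.mulLeft A (symι 𝒱 v) ∘ₗ
        ((TensorProduct.lid A _).toLinearMap ∘ₗ (symCounit 𝒱).toLinearMap.rTensor _ +
          TensorProduct.lift (LinearMap.mul A (Sym 𝒱) ∘ₗ symι 𝒱) ∘ₗ (symProj 𝒱).rTensor _) :=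
    TensorProduct.ext' fun y z => by
      have := symι_mul_symι (𝒱 := 𝒱) (symProj 𝒱 y) v
      simp [symMulPrim_tmul, symProj_symι_mul, symProj_symSgn, mul_add, ← mul_assoc, ← this,
        add_mul, add_assoc]
  have := LinearMap.congr_fun h (symComul 𝒱 x)
  simp only [LinearMap.comp_apply, LinearMap.add_apply, symComul_counit_left] at this
  simp [symEuler, this, mul_add]

theorem symEuler_prod (c : List V) :
    symEuler 𝒱 (c.map (symι 𝒱)).prod = (c.length : A) • (c.map (symι 𝒱)).prod := by
  induction c with
  | nil => simp [symEuler]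
  | cons v c ih => simp [symEuler_symι_mul, ih, add_smul, add_comm]

/-- The counit forbids open letters in the left factor, so the open word is untouched and the Euler
operator acts on the closed one. -/
theorem mulC_projC_comul (c : List V) (o : List W) :
    mulC 𝒱 𝒲 ((projC 𝒱 𝒲).rTensor _ (comul 𝒱 𝒲 (monom 𝒱 𝒲 c o))) =
      (c.length : A) • monom 𝒱 𝒲 c o := by
  have h := rTensor_comul (𝒲 := 𝒲) (symProj 𝒱) (c.map (symι 𝒱)).prod (o.map (TensorAlgebra.ι A)).prod
  rw [tensComul_counit_left] at h
  simp only [projC, monom]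
  rw [h, TensorProduct.lid_tmul, one_smul, TensorProduct.smul_tmul', ← symEuler_prod, symEuler]
  simp only [LinearMap.comp_apply]
  induction (symProj 𝒱).rTensor _ (symComul 𝒱 (c.map (symι 𝒱)).prod)
    using TensorProduct.induction_on with
  | zero => simp
  | add a b ha hb => simp only [TensorProduct.add_tmul, map_add, ha, hb]
  | tmul a b => simp

/-- Deconcatenation singles out the last open letter in exactly one way, so, unlike in the closed
case, no multiplicity appears. -/
theorem mulO_projO_comul (c : List V) (o : List W) (ho : o ≠ []) :
    mulO 𝒱 𝒲 ((projO 𝒱 𝒲).lTensor _ (comul 𝒱 𝒲 (monom 𝒱 𝒲 c o))) = monom 𝒱 𝒲 c o := by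
  have h := lTensor_comul (𝒱 := 𝒱) (𝒲 := 𝒲) (TensorAlgebra.ιInv) (c.map (symι 𝒱)).prod
    (o.map (TensorAlgebra.ι A)).prod
  rw [symComul_counit_right] at h
  -- Splitting off the last letter and multiplying it back loses only the constant term, which
  -- vanishes for a nonempty word.
  have hT : ∀ x : TensorAlgebra A W, TensorProduct.lift ((LinearMap.mul A (TensorAlgebra A W)).compl₂
      (TensorAlgebra.ι A)) (TensorAlgebra.ιInv.lTensor _ (tensComul x)) +
        algebraMap A _ (TensorAlgebra.algebraMapInv x) = x := by
    intro x
    refine LinearMap.congr_fun (f := TensorProduct.lift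
      ((LinearMap.mul A (TensorAlgebra A W)).compl₂ (TensorAlgebra.ι A)) ∘ₗ
        TensorAlgebra.ιInv.lTensor _ ∘ₗ tensComul +
          Algebra.linearMap A _ ∘ₗ TensorAlgebra.algebraMapInv.toLinearMap)
      (g := LinearMap.id) (tens_hom_ext (by simp) fun w x hx => ?_) x
    have hw : TensorProduct.lift ((LinearMap.mul A (TensorAlgebra A W)).compl₂
        (TensorAlgebra.ι A)) ∘ₗ (LinearMap.mulLeft A (TensorAlgebra.ι A w)).rTensor _ =
        LinearMap.mulLeft A (TensorAlgebra.ι A w) ∘ₗ TensorProduct.lift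
          ((LinearMap.mul A (TensorAlgebra A W)).compl₂ (TensorAlgebra.ι A)) :=
      TensorProduct.ext' fun y z => by simp [mul_assoc]
    have := LinearMap.congr_fun hw (TensorAlgebra.ιInv.lTensor _ (tensComul x))
    simp only [LinearMap.comp_apply, LinearMap.add_apply, LinearMap.id_apply] at hx this ⊢
    rw [lTensor_tensComul_ι_mul, map_add, this]
    refine Eq.trans ?_ (congrArg (TensorAlgebra.ι A w * ·) hx)
    simp [ιInv_ι_mul, mul_add, Algebra.algebraMap_eq_smul_one]
  have ho' : TensorAlgebra.algebraMapInv (o.map (TensorAlgebra.ι A)).prod = 0 := by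
    obtain ⟨w, o, rfl⟩ := List.exists_cons_of_ne_nil ho
    simp
  have hT' := hT (o.map (TensorAlgebra.ι A)).prod
  rw [ho', map_zero, add_zero] at hT'
  simp only [projO, monom]
  rw [h, TensorProduct.rid_tmul, one_smul]
  nth_rw 2 [← hT']
  induction TensorAlgebra.ιInv.lTensor _ (tensComul (o.map (TensorAlgebra.ι A)).prod)
    using TensorProduct.induction_on with
  | zero => simp
  | add a b ha hb => simp only [TensorProduct.tmul_add, map_add, ha, hb]
  | tmul a b => simp [inO_apply]

end Swap

/-! ### Projections to monomials of a given type. -/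

section Types

variable {A : Type*} [CommRing A] [Algebra ℚ A] {V W : Type*} [AddCommGroup V] [Module A V]
  [AddCommGroup W] [Module A W] {𝒱 : ℤ → Submodule A V} {𝒲 : ℤ → Submodule A W}
  [DirectSum.Decomposition 𝒱] [DirectSum.Decomposition 𝒲]

theorem map_mem_of_mem_span {M N : Type*} [AddCommGroup M] [Module A M] [AddCommGroup N]
    [Module A N] (f : M →ₗ[A] N) {s : Set M} {P : Submodule A N} (h : ∀ x ∈ s, f x ∈ P) {x : M}
    (hx : x ∈ Submodule.span A s) : f x ∈ P :=
  (Submodule.span_le (p := P.comap f)).2 h hx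

theorem symComul_prod_mem (c : List V) :
    symComul 𝒱 (c.map (symι 𝒱)).prod ∈ Submodule.span A
      {z | ∃ c₁ c₂ : List V, c₁.length + c₂.length = c.length ∧
        z = (c₁.map (symι 𝒱)).prod ⊗ₜ[A] (c₂.map (symι 𝒱)).prod} := by
  induction c with
  | nil => exact Submodule.subset_span ⟨[], [], by simp⟩
  | cons v c ih =>
    rw [List.map_cons, List.prod_cons, symComul_symι_mul]
    refine map_mem_of_mem_span (symMulPrim 𝒱 v) ?_ ih
    rintro _ ⟨c₁, c₂, h, rfl⟩
    rw [symMulPrim_tmul]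
    refine Submodule.add_mem _ (Submodule.add_mem _ (Submodule.subset_span ⟨v :: c₁, c₂, ?_, ?_⟩)
      (Submodule.subset_span ⟨c₁, evenPart 𝒱 v :: c₂, ?_, ?_⟩))
      (Submodule.subset_span ⟨c₁.map (sgn 𝒱), oddPart 𝒱 v :: c₂, ?_, ?_⟩)
    all_goals simp [symSgn_prod]
    all_goals omega

theorem tensComul_prod_mem (o : List W) :
    tensComul (o.map (TensorAlgebra.ι A)).prod ∈ Submodule.span A
      {z | ∃ o₁ o₂ : List W, o₁.length + o₂.length = o.length ∧
        z = (o₁.map (TensorAlgebra.ι A)).prod ⊗ₜ[A] (o₂.map (TensorAlgebra.ι A)).prod} := by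
  induction o with
  | nil => exact Submodule.subset_span ⟨[], [], by simp⟩
  | cons w o ih =>
    rw [List.map_cons, List.prod_cons, tensComul_ι_mul]
    refine Submodule.add_mem _ ?_ (Submodule.subset_span ⟨[], w :: o, by simp, by simp⟩)
    refine map_mem_of_mem_span
      ((LinearMap.mulLeft A (TensorAlgebra.ι A w)).rTensor (TensorAlgebra A W)) ?_ ih
    rintro _ ⟨o₁, o₂, h, rfl⟩
    refine Submodule.subset_span ⟨w :: o₁, o₂, ?_, ?_⟩
    · simp; omega
    · simp

/-- The coproduct respects the number of closed and of open letters. -/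
theorem comul_monom_mem (c : List V) (o : List W) :
    comul 𝒱 𝒲 (monom 𝒱 𝒲 c o) ∈ Submodule.span A
      {z | ∃ (c₁ c₂ : List V) (o₁ o₂ : List W), c₁.length + c₂.length = c.length ∧
        o₁.length + o₂.length = o.length ∧ z = monom 𝒱 𝒲 c₁ o₁ ⊗ₜ[A] monom 𝒱 𝒲 c₂ o₂} := by
  have h := Submodule.apply_mem_map₂ ((TensorProduct.mk A _ _).compr₂ (midSwap 𝒱 𝒲))
    (symComul_prod_mem (𝒱 := 𝒱) c) (tensComul_prod_mem (A := A) o)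
  rw [Submodule.map₂_span_span] at h
  refine Submodule.span_le.2 ?_ h
  rintro _ ⟨_, ⟨c₁, c₂, hc, rfl⟩, _, ⟨o₁, o₂, ho, rfl⟩, rfl⟩
  simp only [LinearMap.compr₂_apply, TensorProduct.mk_apply, midSwap_tmul, symSgn_prod,
    tensSgn_prod, SetLike.mem_coe]
  refine Submodule.smul_mem _ _ (Submodule.sub_mem _ (Submodule.add_mem _ (Submodule.add_mem _
    (Submodule.subset_span ⟨_, _, _, _, ?_, ?_, rfl⟩)
    (Submodule.subset_span ⟨_, _, _, _, ?_, ?_, rfl⟩))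
    (Submodule.subset_span ⟨_, _, _, _, ?_, ?_, rfl⟩))
    (Submodule.subset_span ⟨_, _, _, _, ?_, ?_, rfl⟩))
  all_goals simpa

/-- Makes induction on the number of letters possible: after a coproduct only pairs of monomials
with complementary numbers of letters have to be tested. -/
theorem map_comul_monom_eq {M : Type*} [AddCommGroup M] [Module A M]
    {f g : OC 𝒱 𝒲 ⊗[A] OC 𝒱 𝒲 →ₗ[A] M} (c : List V) (o : List W)
    (h : ∀ (c₁ c₂ : List V) (o₁ o₂ : List W), c₁.length + c₂.length = c.length →
      o₁.length + o₂.length = o.length →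
      f (monom 𝒱 𝒲 c₁ o₁ ⊗ₜ[A] monom 𝒱 𝒲 c₂ o₂) = g (monom 𝒱 𝒲 c₁ o₁ ⊗ₜ[A] monom 𝒱 𝒲 c₂ o₂)) :
    f (comul 𝒱 𝒲 (monom 𝒱 𝒲 c o)) = g (comul 𝒱 𝒲 (monom 𝒱 𝒲 c o)) := by
  refine (Submodule.span_le (p := LinearMap.eqLocus f g)).2 ?_ (comul_monom_mem c o)
  rintro _ ⟨c₁, c₂, o₁, o₂, hc, ho, rfl⟩
  exact h c₁ c₂ o₁ o₂ hc ho

theorem map_comul_monom_eq_zero {M : Type*} [AddCommGroup M] [Module A M]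
    {f : OC 𝒱 𝒲 ⊗[A] OC 𝒱 𝒲 →ₗ[A] M} (c : List V) (o : List W)
    (h : ∀ (c₁ c₂ : List V) (o₁ o₂ : List W), c₁.length + c₂.length = c.length →
      o₁.length + o₂.length = o.length →
      f (monom 𝒱 𝒲 c₁ o₁ ⊗ₜ[A] monom 𝒱 𝒲 c₂ o₂) = 0) :
    f (comul 𝒱 𝒲 (monom 𝒱 𝒲 c o)) = 0 :=
  map_comul_monom_eq (g := 0) c o h

theorem counit_monom (c : List V) (o : List W) :
    counit 𝒱 𝒲 (monom 𝒱 𝒲 c o) = if c.length = 0 ∧ o.length = 0 then 1 else 0 := by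
  rcases c with _ | ⟨v, c⟩ <;> rcases o with _ | ⟨w, o⟩ <;> simp [monom]

variable (𝒱 𝒲) in
/-- The projection of `C(V) ⊗ T^c(W)` to the span of the monomials with `n` closed letters and no
open letter. -/
def closedPr : ℕ → OC 𝒱 𝒲 →ₗ[A] OC 𝒱 𝒲
  | 0 => Algebra.linearMap A _ ∘ₗ counit 𝒱 𝒲
  | n + 1 => algebraMap ℚ A ((n : ℚ) + 1)⁻¹ •
      (mulC 𝒱 𝒲 ∘ₗ TensorProduct.map (projC 𝒱 𝒲) (closedPr n) ∘ₗ comul 𝒱 𝒲)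

variable (𝒱 𝒲) in
/-- The projection of `C(V) ⊗ T^c(W)` to the span of the monomials with `n` closed letters and `m`
open letters. -/
def pr (n : ℕ) : ℕ → OC 𝒱 𝒲 →ₗ[A] OC 𝒱 𝒲
  | 0 => closedPr 𝒱 𝒲 n
  | m + 1 => mulO 𝒱 𝒲 ∘ₗ TensorProduct.map (pr n m) (projO 𝒱 𝒲) ∘ₗ comul 𝒱 𝒲

theorem closedPr_monom (n : ℕ) (c : List V) (o : List W) :
    closedPr 𝒱 𝒲 n (monom 𝒱 𝒲 c o) =
      if c.length = n ∧ o.length = 0 then monom 𝒱 𝒲 c o else 0 := by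
  induction n generalizing c o with
  | zero =>
    simp only [closedPr, LinearMap.comp_apply, counit_monom]
    split_ifs with h
    · obtain ⟨rfl, rfl⟩ : c = [] ∧ o = [] := by simpa using h
      simp [Algebra.TensorProduct.one_def]
    · simp
  | succ n ih =>
    simp only [closedPr, LinearMap.smul_apply, LinearMap.comp_apply]
    split_ifs with h
    -- Where the first factor survives it is a single closed letter, so the second factor already
    -- has type `(n, 0)` and `closedPr n` fixes it.
    · have : TensorProduct.map (projC 𝒱 𝒲) (closedPr 𝒱 𝒲 n) (comul 𝒱 𝒲 (monom 𝒱 𝒲 c o)) =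
          (projC 𝒱 𝒲).rTensor _ (comul 𝒱 𝒲 (monom 𝒱 𝒲 c o)) := by
        refine map_comul_monom_eq c o fun c₁ c₂ o₁ o₂ hc ho => ?_
        rw [TensorProduct.map_tmul, LinearMap.rTensor_tmul]
        by_cases h₁ : c₁.length = 1 ∧ o₁.length = 0
        · rw [ih, if_pos (by omega)]
        · rw [projC_monom_of_length_ne h₁, TensorProduct.zero_tmul, TensorProduct.zero_tmul]
      rw [this, mulC_projC_comul, h.1, smul_smul]
      have : algebraMap ℚ A ((n : ℚ) + 1)⁻¹ * ((n + 1 : ℕ) : A) = 1 := by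
        rw [← map_natCast (algebraMap ℚ A), ← map_mul, Nat.cast_succ, inv_mul_cancel₀ (by positivity),
          map_one]
      rw [this, one_smul]
    · have : TensorProduct.map (projC 𝒱 𝒲) (closedPr 𝒱 𝒲 n) (comul 𝒱 𝒲 (monom 𝒱 𝒲 c o)) = 0 := by
        refine map_comul_monom_eq_zero c o fun c₁ c₂ o₁ o₂ hc ho => ?_
        rw [TensorProduct.map_tmul]
        by_cases h₁ : c₁.length = 1 ∧ o₁.length = 0
        · rw [ih, if_neg (by omega), TensorProduct.tmul_zero]
        · rw [projC_monom_of_length_ne h₁, TensorProduct.zero_tmul]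
      rw [this, map_zero, smul_zero]

theorem pr_monom (n m : ℕ) (c : List V) (o : List W) :
    pr 𝒱 𝒲 n m (monom 𝒱 𝒲 c o) =
      if c.length = n ∧ o.length = m then monom 𝒱 𝒲 c o else 0 := by
  induction m generalizing c o with
  | zero => exact closedPr_monom n c o
  | succ m ih =>
    simp only [pr, LinearMap.comp_apply]
    split_ifs with h
    · have : TensorProduct.map (pr 𝒱 𝒲 n m) (projO 𝒱 𝒲) (comul 𝒱 𝒲 (monom 𝒱 𝒲 c o)) =
          (projO 𝒱 𝒲).lTensor _ (comul 𝒱 𝒲 (monom 𝒱 𝒲 c o)) := by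
        refine map_comul_monom_eq c o fun c₁ c₂ o₁ o₂ hc ho => ?_
        rw [TensorProduct.map_tmul, LinearMap.lTensor_tmul]
        by_cases h₁ : c₂.length = 0 ∧ o₂.length = 1
        · rw [ih, if_pos (by omega)]
        · rw [projO_monom_of_length_ne h₁, TensorProduct.tmul_zero, TensorProduct.tmul_zero]
      rw [this, mulO_projO_comul c o (by rintro rfl; simp at h)]
    · have : TensorProduct.map (pr 𝒱 𝒲 n m) (projO 𝒱 𝒲) (comul 𝒱 𝒲 (monom 𝒱 𝒲 c o)) = 0 := by
        refine map_comul_monom_eq_zero c o fun c₁ c₂ o₁ o₂ hc ho => ?_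
        rw [TensorProduct.map_tmul]
        by_cases h₁ : c₂.length = 0 ∧ o₂.length = 1
        · rw [ih, if_neg (by omega), TensorProduct.zero_tmul]
        · rw [projO_monom_of_length_ne h₁, TensorProduct.tmul_zero]
      rw [this, map_zero]

theorem exists_sum_pr (x : OC 𝒱 𝒲) : ∃ N, (∀ n m, N ≤ n + m → pr 𝒱 𝒲 n m x = 0) ∧
    ∑ p ∈ Finset.range N ×ˢ Finset.range N, pr 𝒱 𝒲 p.1 p.2 x = x := by
  -- Requiring the property for every bound from some `N` on, rather than for one bound, makes it
  -- stable under sums.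
  let P : Submodule A (OC 𝒱 𝒲) :=
    { carrier := {x | ∃ N, ∀ M, N ≤ M → (∀ n m, M ≤ n + m → pr 𝒱 𝒲 n m x = 0) ∧
        ∑ p ∈ Finset.range M ×ˢ Finset.range M, pr 𝒱 𝒲 p.1 p.2 x = x}
      zero_mem' := ⟨0, by simp⟩
      add_mem' := by
        rintro x y ⟨N, hN⟩ ⟨N', hN'⟩
        refine ⟨max N N', fun M hM => ⟨fun n m h => ?_, ?_⟩⟩
        · rw [map_add, (hN M (by omega)).1 n m h, (hN' M (by omega)).1 n m h, add_zero]
        · simp only [map_add, Finset.sum_add_distrib]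
          rw [(hN M (by omega)).2, (hN' M (by omega)).2]
      smul_mem' := by
        rintro a x ⟨N, hN⟩
        refine ⟨N, fun M hM => ⟨fun n m h => ?_, ?_⟩⟩
        · rw [map_smul, (hN M hM).1 n m h, smul_zero]
        · simp only [map_smul, ← Finset.smul_sum]
          rw [(hN M hM).2] }
  obtain ⟨N, hN⟩ := monom_span (P := P) (fun c o => by
    refine ⟨c.length + o.length + 1, fun M hM => ⟨fun n m h => ?_, ?_⟩⟩
    · rw [pr_monom, if_neg (by omega)]
    · rw [Finset.sum_eq_single (c.length, o.length)]
      · simp [pr_monom]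
      · rintro ⟨n, m⟩ _ hne
        rw [pr_monom, if_neg (by rintro ⟨rfl, rfl⟩; exact hne rfl)]
      · intro h
        simp only [Finset.mem_product, Finset.mem_range] at h
        omega) x
  exact ⟨N, hN N le_rfl⟩

theorem eq_of_pr_eq {x y : OC 𝒱 𝒲} (h : ∀ n m, pr 𝒱 𝒲 n m x = pr 𝒱 𝒲 n m y) : x = y := by
  obtain ⟨N, -, hN⟩ := exists_sum_pr (x - y)
  rw [← sub_eq_zero, ← hN]
  exact Finset.sum_eq_zero fun p _ => by rw [map_sub, h, sub_self]

/-- `P` contains `x` if it contains all monomials of those types that occur in `x`. -/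
theorem mem_of_pr {P : Submodule A (OC 𝒱 𝒲)} {x : OC 𝒱 𝒲}
    (h : ∀ n m, pr 𝒱 𝒲 n m x = 0 ∨
      ∀ (c : List V) (o : List W), c.length = n → o.length = m → monom 𝒱 𝒲 c o ∈ P) : x ∈ P := by
  obtain ⟨N, -, hN⟩ := exists_sum_pr x
  rw [← hN]
  refine P.sum_mem fun p _ => ?_
  rcases h p.1 p.2 with h | h
  · rw [h]
    exact P.zero_mem
  · refine monom_span (P := P.comap (pr 𝒱 𝒲 p.1 p.2)) (fun c o => ?_) x
    rw [Submodule.mem_comap, pr_monom]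
    split_ifs with hc
    · exact h c o hc.1 hc.2
    · exact P.zero_mem

end Types

/-! ### Coalgebra maps and coderivations through their components. -/

section Maps

variable {A : Type*} [CommRing A] [Algebra ℚ A]
variable {V W : Type*} [AddCommGroup V] [Module A V] [AddCommGroup W] [Module A W]
variable {V' W' : Type*} [AddCommGroup V'] [Module A V'] [AddCommGroup W'] [Module A W']
variable {𝒱 : ℤ → Submodule A V} {𝒲 : ℤ → Submodule A W}
variable {𝒱' : ℤ → Submodule A V'} {𝒲' : ℤ → Submodule A W'}
variable [DirectSum.Decomposition 𝒱] [DirectSum.Decomposition 𝒲]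
  [DirectSum.Decomposition 𝒱'] [DirectSum.Decomposition 𝒲']

/-- Comultiplicativity turns the recursion for the projections into one for the projections of `G`,
with the components of `G` as the only input. -/
theorem closedPr_succ_comp {G : OC 𝒱' 𝒲' →ₗ[A] OC 𝒱 𝒲}
    (hG : comul 𝒱 𝒲 ∘ₗ G = TensorProduct.map G G ∘ₗ comul 𝒱' 𝒲') (n : ℕ) :
    closedPr 𝒱 𝒲 (n + 1) ∘ₗ G = algebraMap ℚ A ((n : ℚ) + 1)⁻¹ •
      (mulC 𝒱 𝒲 ∘ₗ TensorProduct.map (projC 𝒱 𝒲 ∘ₗ G) (closedPr 𝒱 𝒲 n ∘ₗ G) ∘ₗ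
        comul 𝒱' 𝒲') := by
  rw [closedPr, LinearMap.smul_comp, LinearMap.comp_assoc, LinearMap.comp_assoc, hG,
    TensorProduct.map_comp, LinearMap.comp_assoc]

theorem pr_succ_comp {G : OC 𝒱' 𝒲' →ₗ[A] OC 𝒱 𝒲}
    (hG : comul 𝒱 𝒲 ∘ₗ G = TensorProduct.map G G ∘ₗ comul 𝒱' 𝒲') (n m : ℕ) :
    pr 𝒱 𝒲 n (m + 1) ∘ₗ G =
      mulO 𝒱 𝒲 ∘ₗ TensorProduct.map (pr 𝒱 𝒲 n m ∘ₗ G) (projO 𝒱 𝒲 ∘ₗ G) ∘ₗ comul 𝒱' 𝒲' := by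
  rw [pr, LinearMap.comp_assoc, LinearMap.comp_assoc, hG, TensorProduct.map_comp,
    LinearMap.comp_assoc]

/-- A coalgebra map is determined by its components. -/
theorem CoalgMap.ext_proj {f g : CoalgMap 𝒱' 𝒲' 𝒱 𝒲}
    (hC : projC 𝒱 𝒲 ∘ₗ f.toLin = projC 𝒱 𝒲 ∘ₗ g.toLin)
    (hO : projO 𝒱 𝒲 ∘ₗ f.toLin = projO 𝒱 𝒲 ∘ₗ g.toLin) : f = g := by
  have h₁ : ∀ n, closedPr 𝒱 𝒲 n ∘ₗ f.toLin = closedPr 𝒱 𝒲 n ∘ₗ g.toLin := by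
    intro n
    induction n with
    | zero => simp only [closedPr, LinearMap.comp_assoc, f.counit_comp, g.counit_comp]
    | succ n ih => rw [closedPr_succ_comp f.comul_comp, closedPr_succ_comp g.comul_comp, ih, hC]
  have h₂ : ∀ n m, pr 𝒱 𝒲 n m ∘ₗ f.toLin = pr 𝒱 𝒲 n m ∘ₗ g.toLin := by
    intro n m
    induction m with
    | zero => exact h₁ n
    | succ m ih => rw [pr_succ_comp f.comul_comp, pr_succ_comp g.comul_comp, ih, hO]
  have : f.toLin = g.toLin :=
    LinearMap.ext fun x => eq_of_pr_eq fun n m => LinearMap.congr_fun (h₂ n m) x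
  cases f; cases g; congr

variable (𝒱 𝒲) in
/-- The span of the monomials with at least one open letter. -/
def openIdeal : Submodule A (OC 𝒱 𝒲) :=
  Submodule.span A {x | ∃ (c : List V) (o : List W), o ≠ [] ∧ x = monom 𝒱 𝒲 c o}

theorem mem_openIdeal_of_closedPr {x : OC 𝒱 𝒲} (h : ∀ n, closedPr 𝒱 𝒲 n x = 0) :
    x ∈ openIdeal 𝒱 𝒲 :=
  mem_of_pr fun n m => by
    rcases m with _ | m
    · exact Or.inl (h n)
    · exact Or.inr fun c o _ ho =>
        Submodule.subset_span ⟨c, o, by rintro rfl; simp at ho, rfl⟩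

theorem ClosedOnly.projC_eq_zero {G : OC 𝒱' 𝒲' →ₗ[A] OC 𝒱 𝒲} (hG : ClosedOnly G)
    {x : OC 𝒱' 𝒲'} (hx : x ∈ openIdeal 𝒱' 𝒲') : projC 𝒱 𝒲 (G x) = 0 := by
  refine (Submodule.span_le (p := LinearMap.ker (projC 𝒱 𝒲 ∘ₗ G))).2 ?_ hx
  rintro _ ⟨c, o, ho, rfl⟩
  exact hG c o ho

/-- Stability of `openIdeal` is the form of `ClosedOnly` that visibly passes to compositions. For
coalgebra maps and coderivations it is equivalent to it, by `CoalgMap.map_openIdeal` and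
`coder_map_openIdeal`. -/
theorem closedOnly_of_mapsTo {G : OC 𝒱' 𝒲' →ₗ[A] OC 𝒱 𝒲}
    (h : ∀ x ∈ openIdeal 𝒱' 𝒲', G x ∈ openIdeal 𝒱 𝒲) : ClosedOnly G := by
  intro c o ho
  refine ClosedOnly.projC_eq_zero (G := LinearMap.id) (fun c o ho => ?_)
    (h _ (Submodule.subset_span ⟨c, o, ho, rfl⟩))
  exact projC_monom_of_length_ne (by simp [ho])

/-- When a word with an open letter is split, the letter lies in one of the two factors. In the
first it kills the closed component; in the second the induction hypothesis applies. So no purely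
closed output appears. -/
theorem CoalgMap.map_openIdeal (f : CoalgMap 𝒱' 𝒲' 𝒱 𝒲) {x : OC 𝒱' 𝒲'}
    (hx : x ∈ openIdeal 𝒱' 𝒲') : f.toLin x ∈ openIdeal 𝒱 𝒲 := by
  refine mem_openIdeal_of_closedPr fun n => ?_
  have h : ∀ c o, o ≠ [] → (closedPr 𝒱 𝒲 n ∘ₗ f.toLin) (monom 𝒱' 𝒲' c o) = 0 := by
    induction n with
    | zero =>
      intro c o ho
      rw [closedPr, LinearMap.comp_assoc, f.counit_comp, LinearMap.comp_apply, counit_monom,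
        if_neg (by simp [ho]), map_zero]
    | succ n ih =>
      intro c o ho
      rw [closedPr_succ_comp f.comul_comp, LinearMap.smul_apply, LinearMap.comp_apply,
        LinearMap.comp_apply, map_comul_monom_eq_zero c o, map_zero, smul_zero]
      intro c₁ c₂ o₁ o₂ _ ho'
      rw [TensorProduct.map_tmul]
      by_cases h₁ : o₁ = []
      · rw [ih c₂ o₂ (by
          rintro rfl
          exact ho (List.length_eq_zero_iff.1 (by simpa [h₁] using ho'.symm))), TensorProduct.tmul_zero]
      · rw [LinearMap.comp_apply, f.closedOnly _ _ h₁, TensorProduct.zero_tmul]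
  refine (Submodule.span_le (p := LinearMap.ker (closedPr 𝒱 𝒲 n ∘ₗ f.toLin))).2 ?_ hx
  rintro _ ⟨c, o, ho, rfl⟩
  exact h c o ho

theorem ocSgn_monom (c : List V) (o : List W) :
    ocSgn 𝒱 𝒲 (monom 𝒱 𝒲 c o) = monom 𝒱 𝒲 (c.map (sgn 𝒱)) (o.map (sgn 𝒲)) := by
  simp only [ocSgn, monom, TensorProduct.map_tmul, AlgHom.toLinearMap_apply, symSgn_prod,
    tensSgn_prod]

theorem counit_comp_ocSgn : counit 𝒱 𝒲 ∘ₗ ocSgn 𝒱 𝒲 = counit 𝒱 𝒲 :=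
  oc_hom_ext fun c o => by rw [LinearMap.comp_apply, ocSgn_monom]; simp [counit_monom]

/-- A coderivation is killed by the counit. -/
theorem counit_comp_coder {D : OC 𝒱 𝒲 →ₗ[A] OC 𝒱 𝒲} (hD : comul 𝒱 𝒲 ∘ₗ D =
    (TensorProduct.map D LinearMap.id + TensorProduct.map (ocSgn 𝒱 𝒲) D) ∘ₗ comul 𝒱 𝒲) :
    counit 𝒱 𝒲 ∘ₗ D = 0 := by
  refine LinearMap.ext fun x => ?_
  -- Applying the counit on both sides of the co-Leibniz rule gives `ε D = ε D + ε D`, where `ε` is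
  -- the counit.
  have h := congrArg (TensorProduct.map (counit 𝒱 𝒲) (counit 𝒱 𝒲)) (LinearMap.congr_fun hD x)
  have e₁ : TensorProduct.map (counit 𝒱 𝒲) (counit 𝒱 𝒲) ∘ₗ TensorProduct.map D LinearMap.id =
      TensorProduct.map (counit 𝒱 𝒲 ∘ₗ D) LinearMap.id ∘ₗ (counit 𝒱 𝒲).lTensor _ := by
    rw [← TensorProduct.map_comp, LinearMap.lTensor, ← TensorProduct.map_comp]; rfl
  have e₂ : TensorProduct.map (counit 𝒱 𝒲) (counit 𝒱 𝒲) ∘ₗ TensorProduct.map (ocSgn 𝒱 𝒲) D =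
      TensorProduct.map LinearMap.id (counit 𝒱 𝒲 ∘ₗ D) ∘ₗ (counit 𝒱 𝒲).rTensor _ := by
    rw [← TensorProduct.map_comp, LinearMap.rTensor, ← TensorProduct.map_comp, counit_comp_ocSgn]
    rfl
  have e₃ : TensorProduct.map (counit 𝒱 𝒲) (counit 𝒱 𝒲) =
      (counit 𝒱 𝒲).lTensor _ ∘ₗ (counit 𝒱 𝒲).rTensor _ := by
    rw [LinearMap.lTensor_comp_rTensor]
  have h₁ := LinearMap.congr_fun e₁ (comul 𝒱 𝒲 x)
  have h₂ := LinearMap.congr_fun e₂ (comul 𝒱 𝒲 x)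
  simp only [LinearMap.comp_apply, LinearMap.add_apply, map_add] at h h₁ h₂
  rw [h₁, h₂, counit_rTensor_comul, counit_lTensor_comul, e₃, LinearMap.comp_apply,
    counit_rTensor_comul] at h
  have := congrArg (TensorProduct.lid A A) h
  simp only [LinearMap.lTensor_tmul, TensorProduct.lid_tmul, map_add,
    TensorProduct.map_tmul, LinearMap.comp_apply, LinearMap.id_apply, smul_eq_mul, mul_one] at this
  simpa using this

theorem coder_map_openIdeal {D : OC 𝒱 𝒲 →ₗ[A] OC 𝒱 𝒲} (hD : comul 𝒱 𝒲 ∘ₗ D =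
    (TensorProduct.map D LinearMap.id + TensorProduct.map (ocSgn 𝒱 𝒲) D) ∘ₗ comul 𝒱 𝒲)
    (hc : ClosedOnly D) {x : OC 𝒱 𝒲} (hx : x ∈ openIdeal 𝒱 𝒲) : D x ∈ openIdeal 𝒱 𝒲 := by
  refine mem_openIdeal_of_closedPr fun n => ?_
  have h : ∀ c o, o ≠ [] → closedPr 𝒱 𝒲 n (D (monom 𝒱 𝒲 c o)) = 0 := by
    induction n with
    | zero =>
      intro c o ho
      have := LinearMap.congr_fun (counit_comp_coder hD) (monom 𝒱 𝒲 c o)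
      simp only [LinearMap.comp_apply, LinearMap.zero_apply] at this
      rw [closedPr, LinearMap.comp_apply, this, map_zero]
    | succ n ih =>
      intro c o ho
      have := LinearMap.congr_fun hD (monom 𝒱 𝒲 c o)
      simp only [LinearMap.comp_apply] at this
      rw [closedPr, LinearMap.smul_apply, LinearMap.comp_apply, LinearMap.comp_apply, this,
        ← LinearMap.comp_apply (TensorProduct.map (projC 𝒱 𝒲) (closedPr 𝒱 𝒲 n)),
        map_comul_monom_eq_zero c o, map_zero, smul_zero]
      intro c₁ c₂ o₁ o₂ _ ho'
      rw [LinearMap.comp_apply, LinearMap.add_apply, map_add]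
      simp only [TensorProduct.map_tmul, LinearMap.id_apply]
      by_cases h₁ : o₁ = []
      · have h₂ : o₂ ≠ [] := by
          rintro rfl
          exact ho (List.length_eq_zero_iff.1 (by simpa [h₁] using ho'.symm))
        rw [ih c₂ o₂ h₂, closedPr_monom, if_neg (by simp [h₂]), TensorProduct.tmul_zero,
          TensorProduct.tmul_zero, add_zero]
      · rw [hc _ _ h₁, ocSgn_monom, projC_monom_of_length_ne (by simp [h₁]),
          TensorProduct.zero_tmul, TensorProduct.zero_tmul, add_zero]
  refine (Submodule.span_le (p := LinearMap.ker (closedPr 𝒱 𝒲 n ∘ₗ D))).2 ?_ hx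
  rintro _ ⟨c, o, ho, rfl⟩
  exact h c o ho

theorem counit_one : counit 𝒱 𝒲 1 = 1 := by
  rw [← monom_nil, counit_monom]; simp

theorem comul_one : comul 𝒱 𝒲 1 = 1 ⊗ₜ 1 := by
  rw [Algebra.TensorProduct.one_def, comul_tmul, symComul_one, tensComul_one, midSwap_tmul]
  simp only [map_one, add_sub_cancel_right]
  rw [smul_add, ← add_smul, half_add_half, one_smul]

/-- Since `1` is group-like, the recursion for `f 1` multiplies by `f_0 / (n + 1)` at each step and
produces the exponential series. -/
theorem CoalgMap.closedPr_map_one (f : CoalgMap 𝒱' 𝒲' 𝒱 𝒲) (n : ℕ) :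
    closedPr 𝒱 𝒲 n (f.toLin 1) =
      algebraMap ℚ A (n.factorial : ℚ)⁻¹ • inC 𝒱 𝒲 (projC 𝒱 𝒲 (f.toLin 1)) ^ n := by
  induction n with
  | zero =>
    have := LinearMap.congr_fun f.counit_comp 1
    simp only [LinearMap.comp_apply, counit_one] at this
    simp only [closedPr, LinearMap.comp_apply, this]
    simp [Algebra.TensorProduct.one_def]
  | succ n ih =>
    have := LinearMap.congr_fun (closedPr_succ_comp f.comul_comp n) 1
    simp only [LinearMap.comp_apply, LinearMap.smul_apply, comul_one, TensorProduct.map_tmul,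
      ih, mulC_tmul, mul_smul_comm, smul_smul, ← map_mul, ← pow_succ'] at this
    rw [this, Nat.factorial_succ, Nat.cast_mul, mul_inv, Nat.cast_succ]

theorem CoalgMap.pr_map_one (f : CoalgMap 𝒱' 𝒲' 𝒱 𝒲) (n m : ℕ) :
    pr 𝒱 𝒲 n m (f.toLin 1) = closedPr 𝒱 𝒲 n (f.toLin 1) *
      inO 𝒱 𝒲 (projO 𝒱 𝒲 (f.toLin 1)) ^ m := by
  induction m with
  | zero => simp [pr]
  | succ m ih =>
    have := LinearMap.congr_fun (pr_succ_comp f.comul_comp n m) 1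
    simp only [LinearMap.comp_apply, comul_one, TensorProduct.map_tmul, ih, mulO_tmul,
      mul_assoc, ← pow_succ] at this
    exact this

/-- The element `f 1` has only finitely many types, so a term of its exponential series vanishes;
the factorial is invertible. This is why no nilpotence assumption is needed to invert a coalgebra
map. -/
theorem CoalgMap.isNilpotent_closed (f : CoalgMap 𝒱' 𝒲' 𝒱 𝒲) :
    IsNilpotent (symι 𝒱 (closedPart f.toLin [])) := by
  obtain ⟨N, hN, -⟩ := exists_sum_pr (f.toLin 1)
  have h := (f.closedPr_map_one N).symm.trans (hN N 0 le_rfl)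
  refine ⟨N, ?_⟩
  have h' := congrArg (algebraMap ℚ A (N.factorial : ℚ) • ·) h
  simp only [smul_smul, ← map_mul, smul_zero] at h'
  rw [mul_inv_cancel₀ (by positivity), map_one, one_smul, inC_apply,
    Algebra.TensorProduct.tmul_pow, one_pow] at h'
  have := congrArg ((TensorProduct.rid A _).toLinearMap ∘ₗ
    TensorProduct.map LinearMap.id TensorAlgebra.algebraMapInv.toLinearMap) h'
  simpa [closedPart] using this

theorem CoalgMap.isNilpotent_open (f : CoalgMap 𝒱' 𝒲' 𝒱 𝒲) :
    IsNilpotent (TensorAlgebra.ι A (openPart f.toLin [] [])) := by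
  obtain ⟨N, hN, -⟩ := exists_sum_pr (f.toLin 1)
  have h := (f.pr_map_one 0 N).symm.trans (hN 0 N (by simp))
  refine ⟨N, ?_⟩
  rw [f.closedPr_map_one] at h
  simp only [Nat.factorial_zero, Nat.cast_one, inv_one, map_one, one_smul, pow_zero, one_mul,
    inO_apply, Algebra.TensorProduct.tmul_pow, one_pow] at h
  have := congrArg ((TensorProduct.lid A _).toLinearMap ∘ₗ
    TensorProduct.map (symCounit 𝒱).toLinearMap LinearMap.id) h
  simpa [openPart] using this

end Maps

/-! ### Exponential and geometric series of nilpotent elements. -/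

section Nilpotent

variable {A : Type*} [CommRing A] [Algebra ℚ A] {B C : Type*} [Ring B] [Algebra A B]
  [Ring C] [Algebra A C]

variable (A) in
/-- The exponential of a nilpotent element of an algebra over a `ℚ`-algebra `A`. -/
def nexp (a : B) : B :=
  letI : Module ℚ B := Module.compHom B (algebraMap ℚ A)
  IsNilpotent.exp a

theorem nexp_eq_sum {a : B} {N : ℕ} (h : a ^ N = 0) :
    nexp A a = ∑ k ∈ Finset.range N, algebraMap ℚ A (1 / (k.factorial : ℚ)) • a ^ k := by
  let : Module ℚ B := Module.compHom B (algebraMap ℚ A)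
  simp only [one_div]
  exact IsNilpotent.exp_eq_sum h

theorem nexp_zero : nexp A (0 : B) = 1 := by
  rw [nexp_eq_sum (pow_one 0)]
  simp

theorem nexp_add {a b : B} (h : Commute a b) (ha : IsNilpotent a) (hb : IsNilpotent b) :
    nexp A (a + b) = nexp A a * nexp A b := by
  let : Module ℚ B := Module.compHom B (algebraMap ℚ A)
  exact IsNilpotent.exp_add_of_commute h ha hb

theorem map_nexp (f : B →ₐ[A] C) {a : B} (ha : IsNilpotent a) : f (nexp A a) = nexp A (f a) := by
  obtain ⟨N, hN⟩ := ha
  rw [nexp_eq_sum hN, nexp_eq_sum (N := N) (by rw [← map_pow, hN, map_zero])]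
  simp

/-- The geometric series of a nilpotent element. -/
def geom (a : B) : B := ∑ k ∈ Finset.range (nilpotencyClass a), a ^ k

theorem geom_eq_sum {a : B} {N : ℕ} (h : a ^ N = 0) : geom a = ∑ k ∈ Finset.range N, a ^ k := by
  refine Finset.sum_subset (Finset.range_mono (Nat.sInf_le h)) fun k _ hk => ?_
  exact pow_eq_zero_of_le (by simpa using hk) (pow_nilpotencyClass ⟨N, h⟩)

theorem geom_mul_one_sub {a : B} (h : IsNilpotent a) : geom a * (1 - a) = 1 := by
  rw [geom, geom_sum_mul_neg, pow_nilpotencyClass h, sub_zero]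

theorem geom_eq_one_add {a : B} (h : IsNilpotent a) : geom a = 1 + a * geom a := by
  have : (1 - a) * geom a = 1 := by
    rw [geom, mul_neg_geom_sum, pow_nilpotencyClass h, sub_zero]
  rw [sub_mul, one_mul] at this
  rw [← this, sub_add_cancel]

end Nilpotent

/-! ### The translation coalgebra map. -/

section Shift

variable {A : Type*} [CommRing A] [Algebra ℚ A] {V W : Type*} [AddCommGroup V] [Module A V]
  [AddCommGroup W] [Module A W] {𝒱 : ℤ → Submodule A V} {𝒲 : ℤ → Submodule A W}
  [DirectSum.Decomposition 𝒱] [DirectSum.Decomposition 𝒲]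

theorem sgn_of_mem_zero {v : V} (hv : v ∈ 𝒱 0) : sgn 𝒱 v = v := by
  rw [sgn_of_mem 𝒱 hv, ksign_even Even.zero, one_smul]

variable (𝒱) in
/-- Multiplication by `exp c`. -/
def symShift (c : V) : Sym 𝒱 →ₗ[A] Sym 𝒱 := LinearMap.mulLeft A (nexp A (symι 𝒱 c))

theorem symShift_apply (c : V) (x : Sym 𝒱) : symShift 𝒱 c x = nexp A (symι 𝒱 c) * x := rfl

/-- As `c` has degree zero, adjoining it to a coproduct is left multiplication by `c ⊗ 1 + 1 ⊗ c` in
the ordinary tensor product algebra. The two summands commute and are nilpotent, so the exponential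
of their sum is the product of their exponentials. -/
theorem symComul_symShift {c : V} (hc : c ∈ 𝒱 0) (hn : IsNilpotent (symι 𝒱 c)) (x : Sym 𝒱) :
    symComul 𝒱 (symShift 𝒱 c x) =
      TensorProduct.map (symShift 𝒱 c) (symShift 𝒱 c) (symComul 𝒱 x) := by
  let iL : Sym 𝒱 →ₐ[A] Sym 𝒱 ⊗[A] Sym 𝒱 := Algebra.TensorProduct.includeLeft
  let iR : Sym 𝒱 →ₐ[A] Sym 𝒱 ⊗[A] Sym 𝒱 := Algebra.TensorProduct.includeRight
  have hcomm : Commute (iL (symι 𝒱 c)) (iR (symι 𝒱 c)) := by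
    simp [Commute, SemiconjBy, iL, iR]
  have h₁ : symMulPrim 𝒱 c = Algebra.lmul A _ (iL (symι 𝒱 c) + iR (symι 𝒱 c)) :=
    TensorProduct.ext' fun y z => by
      simp [symMulPrim_even 𝒱 hc Even.zero, iL, iR]
  have hnL : IsNilpotent (iL (symι 𝒱 c)) := hn.map iL
  have hnR : IsNilpotent (iR (symι 𝒱 c)) := hn.map iR
  have hz : ∀ z, (iL (nexp A (symι 𝒱 c)) * iR (nexp A (symι 𝒱 c))) * z =
      TensorProduct.map (symShift 𝒱 c) (symShift 𝒱 c) z := fun z => by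
    refine LinearMap.congr_fun (f := LinearMap.mulLeft A _) (TensorProduct.ext' fun y z => ?_) z
    simp [iL, iR, symShift_apply]
  rw [← hz, map_nexp _ hn, map_nexp _ hn, ← nexp_add hcomm hnL hnR]
  have h₂ := map_nexp (Algebra.lmul A (Sym 𝒱 ⊗[A] Sym 𝒱)) (hcomm.isNilpotent_add hnL hnR)
  rw [← h₁] at h₂
  simp only [symComul, LinearMap.coe_mk, AddHom.coe_mk, symShift_apply, map_mul,
    Module.End.mul_apply]
  rw [map_nexp _ hn, symLift_symι, ← h₂]
  rfl

theorem symSgn_symShift {c : V} (hc : c ∈ 𝒱 0) (hn : IsNilpotent (symι 𝒱 c)) (x : Sym 𝒱) :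
    symSgn 𝒱 (symShift 𝒱 c x) = symShift 𝒱 c (symSgn 𝒱 x) := by
  rw [symShift_apply, map_mul, map_nexp _ hn, symSgn_symι, sgn_of_mem_zero hc, symShift_apply]

theorem symCounit_symShift {c : V} (hn : IsNilpotent (symι 𝒱 c)) (x : Sym 𝒱) :
    symCounit 𝒱 (symShift 𝒱 c x) = symCounit 𝒱 x := by
  have : symCounit 𝒱 (symι 𝒱 c) = 0 := by simp [symCounit]
  rw [symShift_apply, map_mul, map_nexp _ hn, this, nexp_zero, one_mul]

theorem symProj_symShift {c : V} (hn : IsNilpotent (symι 𝒱 c)) (x : Sym 𝒱) :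
    symProj 𝒱 (symShift 𝒱 c x) = symProj 𝒱 x + symCounit 𝒱 x • c := by
  obtain ⟨N, hN⟩ := hn
  -- The larger exponent makes room for splitting off the terms of order zero and one; products of
  -- at least two letters project to zero.
  have hN' : symι 𝒱 c ^ (N + 2) = 0 := pow_eq_zero_of_le (by omega) hN
  rw [symShift_apply, nexp_eq_sum hN', Finset.sum_range_succ', Finset.sum_range_succ', add_mul,
    add_mul, map_add, map_add, Finset.sum_mul, map_sum, Finset.sum_eq_zero]
  · simp [symProj_symι_mul, add_comm]
  · intro k _
    rw [smul_mul_assoc, map_smul, pow_succ', pow_succ', mul_assoc, symProj_symι_mul, mul_assoc,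
      symCounit_symι_mul, zero_smul, smul_zero]

theorem symShift_symι_mul {c : V} (hc : c ∈ 𝒱 0) (hn : IsNilpotent (symι 𝒱 c)) (v : V)
    (x : Sym 𝒱) : symShift 𝒱 c (symι 𝒱 v * x) = symι 𝒱 v * symShift 𝒱 c x := by
  have h : Commute (symι 𝒱 c) (symι 𝒱 v) := by
    refine mem_of_homogeneous_mem 𝒱 (P := LinearMap.eqLocus
      (LinearMap.mulLeft A (symι 𝒱 c) ∘ₗ symι 𝒱) (LinearMap.mulRight A (symι 𝒱 c) ∘ₗ symι 𝒱))
      (fun i v hv => ?_) v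
    have := symι_mul 𝒱 hc hv
    rw [zero_mul, ksign_even Even.zero, one_smul] at this
    exact this
  obtain ⟨N, hN⟩ := hn
  have h' : Commute (nexp A (symι 𝒱 c)) (symι 𝒱 v) := by
    rw [nexp_eq_sum hN]
    exact Commute.sum_left _ _ _ fun k _ => (h.pow_left k).smul_left _
  rw [symShift_apply, symShift_apply, ← mul_assoc, h'.eq, mul_assoc]

variable (A) in
/-- The map inserting arbitrary powers of `o` at all places:
`o₁ ⊗ ⋯ ⊗ oₙ ↦ ∑ o^{⊗ m₀} ⊗ o₁ ⊗ o^{⊗ m₁} ⊗ ⋯ ⊗ oₙ ⊗ o^{⊗ mₙ}`. -/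
def tensShift (o : W) : TensorAlgebra A W →ₗ[A] TensorAlgebra A W :=
  LinearMap.mulRight A (geom (TensorAlgebra.ι A o)) ∘ₗ
    (TensorAlgebra.lift A (LinearMap.mulLeft A (geom (TensorAlgebra.ι A o)) ∘ₗ
      TensorAlgebra.ι A)).toLinearMap

@[simp] theorem tensShift_one (o : W) : tensShift A o 1 = geom (TensorAlgebra.ι A o) := by
  simp [tensShift]

@[simp] theorem tensShift_ι_mul (o w : W) (x : TensorAlgebra A W) :
    tensShift A o (TensorAlgebra.ι A w * x) =
      geom (TensorAlgebra.ι A o) * (TensorAlgebra.ι A w * tensShift A o x) := by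
  simp [tensShift, mul_assoc]

theorem tensComul_ι_mul' (w : W) (x : TensorAlgebra A W) :
    tensComul (TensorAlgebra.ι A w * x) =
      (TensorAlgebra.ι A w ⊗ₜ 1) * tensComul x + 1 ⊗ₜ (TensorAlgebra.ι A w * x) := by
  rw [tensComul_ι_mul]
  congr 1
  refine LinearMap.congr_fun (f := (LinearMap.mulLeft A (TensorAlgebra.ι A w)).rTensor _)
    (g := LinearMap.mulLeft A (TensorAlgebra.ι A w ⊗ₜ[A] (1 : TensorAlgebra A W)))
    (TensorProduct.ext' fun y z => ?_) _
  simp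

/-- With `E` the geometric series, `E y = y + o E y` gives a linear equation for the coproduct of `E
y` with coefficient `1 - o ⊗ 1`, which `E ⊗ 1` inverts. -/
theorem tensComul_geom_mul {o : W} (ho : IsNilpotent (TensorAlgebra.ι A o))
    (y : TensorAlgebra A W) :
    tensComul (geom (TensorAlgebra.ι A o) * y) = (geom (TensorAlgebra.ι A o) ⊗ₜ 1) *
      (tensComul y + 1 ⊗ₜ (TensorAlgebra.ι A o * (geom (TensorAlgebra.ι A o) * y))) := by
  set E := geom (TensorAlgebra.ι A o) with hE
  have h₁ : E * y = y + TensorAlgebra.ι A o * (E * y) := by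
    nth_rw 1 [hE, geom_eq_one_add ho]
    rw [add_mul, one_mul, mul_assoc]
  have h₂ := congrArg (tensComul (A := A)) h₁
  rw [map_add, tensComul_ι_mul'] at h₂
  have h₃ : (E ⊗ₜ[A] (1 : TensorAlgebra A W)) * (1 - TensorAlgebra.ι A o ⊗ₜ 1) = 1 := by
    rw [Algebra.TensorProduct.one_def, ← TensorProduct.sub_tmul,
      Algebra.TensorProduct.tmul_mul_tmul, geom_mul_one_sub ho, one_mul]
  have h₄ : (1 - TensorAlgebra.ι A o ⊗ₜ 1) * tensComul (E * y) =
      tensComul y + 1 ⊗ₜ (TensorAlgebra.ι A o * (E * y)) := by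
    rw [sub_mul, one_mul]
    nth_rw 1 [h₂]
    abel
  rw [← h₄, ← mul_assoc, h₃, one_mul]

/-- For the empty word this says that the geometric series `E` is group-like: `(E ⊗ 1)(1 ⊗ 1 + 1 ⊗ o
E) = E ⊗ E`. A further letter `w` contributes a leading `E w`; the cuts before `w` are gathered by
the same identity. -/
theorem tensComul_tensShift {o : W} (ho : IsNilpotent (TensorAlgebra.ι A o))
    (x : TensorAlgebra A W) :
    tensComul (tensShift A o x) =
      TensorProduct.map (tensShift A o) (tensShift A o) (tensComul x) := by
  set E := geom (TensorAlgebra.ι A o) with hE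
  have h : ∀ y, E * y = y + TensorAlgebra.ι A o * (E * y) := fun y => by
    nth_rw 1 [hE, geom_eq_one_add ho]
    rw [add_mul, one_mul, mul_assoc]
  refine LinearMap.congr_fun (f := tensComul ∘ₗ tensShift A o)
    (g := TensorProduct.map (tensShift A o) (tensShift A o) ∘ₗ tensComul)
    (tens_hom_ext ?_ fun w x hx => ?_) x
  · have := tensComul_geom_mul ho 1
    rw [mul_one] at this
    simp only [LinearMap.comp_apply, tensShift_one, tensComul_one, TensorProduct.map_tmul]
    rw [this, tensComul_one, ← TensorProduct.tmul_add, Algebra.TensorProduct.tmul_mul_tmul, mul_one, one_mul,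
      ← geom_eq_one_add ho]
  · have hw : TensorProduct.map (tensShift A o) (tensShift A o) ∘ₗ
        (LinearMap.mulLeft A (TensorAlgebra.ι A w)).rTensor _ =
        LinearMap.mulLeft A ((E * TensorAlgebra.ι A w) ⊗ₜ 1) ∘ₗ
          TensorProduct.map (tensShift A o) (tensShift A o) :=
      TensorProduct.ext' fun y z => by simp [mul_assoc, hE]
    have := LinearMap.congr_fun hw (tensComul x)
    simp only [LinearMap.comp_apply] at hx this ⊢
    rw [tensComul_ι_mul, map_add, this, tensShift_ι_mul, tensComul_geom_mul ho, tensComul_ι_mul',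
      hx, LinearMap.mulLeft_apply, TensorProduct.map_tmul, tensShift_one, tensShift_ι_mul,
      mul_add, mul_add, ← mul_assoc, Algebra.TensorProduct.tmul_mul_tmul, one_mul,
      Algebra.TensorProduct.tmul_mul_tmul, Algebra.TensorProduct.tmul_mul_tmul, one_mul, one_mul,
      mul_one, add_assoc, ← TensorProduct.tmul_add, ← hE, ← h]

theorem tensSgn_tensShift {o : W} (ho : o ∈ 𝒲 0) (x : TensorAlgebra A W) :
    tensSgn 𝒲 (tensShift A o x) = tensShift A o (tensSgn 𝒲 x) := by
  have hE : tensSgn 𝒲 (geom (TensorAlgebra.ι A o)) = geom (TensorAlgebra.ι A o) := by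
    simp [geom, sgn_of_mem_zero ho]
  refine LinearMap.congr_fun (f := (tensSgn 𝒲).toLinearMap ∘ₗ tensShift A o)
    (g := tensShift A o ∘ₗ (tensSgn 𝒲).toLinearMap) (tens_hom_ext ?_ fun w x hx => ?_) x
  · simp [hE]
  · simp only [LinearMap.comp_apply, AlgHom.toLinearMap_apply] at hx ⊢
    simp [hE, hx]

theorem algebraMapInv_geom {o : W} (ho : IsNilpotent (TensorAlgebra.ι A o)) :
    TensorAlgebra.algebraMapInv (geom (TensorAlgebra.ι A o)) = 1 := by
  rw [geom_eq_one_add ho, map_add, algebraMapInv_ι_mul, map_one, add_zero]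

theorem algebraMapInv_tensShift {o : W} (ho : IsNilpotent (TensorAlgebra.ι A o))
    (x : TensorAlgebra A W) :
    TensorAlgebra.algebraMapInv (tensShift A o x) = TensorAlgebra.algebraMapInv x :=
  LinearMap.congr_fun (f := TensorAlgebra.algebraMapInv.toLinearMap ∘ₗ tensShift A o)
    (g := TensorAlgebra.algebraMapInv.toLinearMap)
    (tens_hom_ext (by simp [algebraMapInv_geom ho]) fun w x hx => by simp) x

theorem ιInv_tensShift {o : W} (ho : IsNilpotent (TensorAlgebra.ι A o)) (x : TensorAlgebra A W) :
    TensorAlgebra.ιInv (tensShift A o x) =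
      TensorAlgebra.ιInv x + TensorAlgebra.algebraMapInv x • o := by
  have h : ∀ y, TensorAlgebra.ιInv (geom (TensorAlgebra.ι A o) * y) =
      TensorAlgebra.ιInv y + TensorAlgebra.algebraMapInv y • o := fun y => by
    rw [geom_eq_one_add ho, add_mul, one_mul, mul_assoc, map_add, ιInv_ι_mul, map_mul,
      algebraMapInv_geom ho, one_mul]
  refine LinearMap.congr_fun (f := TensorAlgebra.ιInv ∘ₗ tensShift A o)
    (g := TensorAlgebra.ιInv + LinearMap.toSpanSingleton A W o ∘ₗ
      TensorAlgebra.algebraMapInv.toLinearMap) (tens_hom_ext ?_ fun w x hx => ?_) x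
  · simpa using h 1
  · simp [h, ιInv_ι_mul, algebraMapInv_tensShift ho]

/-- The interchange depends on its arguments only through the sign involutions, so it is natural for
maps commuting with them. -/
theorem midSwap_map {α : Sym 𝒱 →ₗ[A] Sym 𝒱} {β : TensorAlgebra A W →ₗ[A] TensorAlgebra A W}
    (hα : ∀ x, symSgn 𝒱 (α x) = α (symSgn 𝒱 x)) (hβ : ∀ y, tensSgn 𝒲 (β y) = β (tensSgn 𝒲 y)) (z) :
    midSwap 𝒱 𝒲 (TensorProduct.map (TensorProduct.map α α) (TensorProduct.map β β) z) =
      TensorProduct.map (TensorProduct.map α β) (TensorProduct.map α β) (midSwap 𝒱 𝒲 z) := by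
  refine LinearMap.congr_fun (f := midSwap 𝒱 𝒲 ∘ₗ
      TensorProduct.map (TensorProduct.map α α) (TensorProduct.map β β))
    (g := TensorProduct.map (TensorProduct.map α β) (TensorProduct.map α β) ∘ₗ midSwap 𝒱 𝒲)
    (TensorProduct.ext (TensorProduct.ext' fun a b => TensorProduct.ext' fun p q => ?_)) z
  simp [midSwap_tmul, hα, hβ]

variable (𝒱 𝒲) in
/-- The linear map underlying the shift by `c` and `o`. -/
def shiftLin (c : V) (o : W) : OC 𝒱 𝒲 →ₗ[A] OC 𝒱 𝒲 :=
  TensorProduct.map (symShift 𝒱 c) (tensShift A o)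

theorem shiftLin_inC_mul {c : V} (hc : c ∈ 𝒱 0) (hn : IsNilpotent (symι 𝒱 c)) (o : W) (v : V)
    (x : OC 𝒱 𝒲) : shiftLin 𝒱 𝒲 c o (inC 𝒱 𝒲 v * x) = inC 𝒱 𝒲 v * shiftLin 𝒱 𝒲 c o x := by
  refine LinearMap.congr_fun (f := shiftLin 𝒱 𝒲 c o ∘ₗ LinearMap.mulLeft A (inC 𝒱 𝒲 v))
    (g := LinearMap.mulLeft A (inC 𝒱 𝒲 v) ∘ₗ shiftLin 𝒱 𝒲 c o)
    (TensorProduct.ext' fun y z => ?_) x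
  simp [shiftLin, symShift_symι_mul hc hn]

theorem shiftLin_inO_mul (c : V) (o : W) (w : W) (x : OC 𝒱 𝒲) :
    shiftLin 𝒱 𝒲 c o (inO 𝒱 𝒲 w * x) =
      (1 ⊗ₜ geom (TensorAlgebra.ι A o)) * (inO 𝒱 𝒲 w * shiftLin 𝒱 𝒲 c o x) := by
  refine LinearMap.congr_fun (f := shiftLin 𝒱 𝒲 c o ∘ₗ LinearMap.mulLeft A (inO 𝒱 𝒲 w))
    (g := LinearMap.mulLeft A ((1 : Sym 𝒱) ⊗ₜ[A] geom (TensorAlgebra.ι A o)) ∘ₗ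
      LinearMap.mulLeft A (inO 𝒱 𝒲 w) ∘ₗ shiftLin 𝒱 𝒲 c o)
    (TensorProduct.ext' fun y z => ?_) x
  simp [shiftLin]

theorem pow_mul_mem {B : Type*} [Ring B] [Algebra A B] {P : Submodule A B} {z : B}
    (h : ∀ x ∈ P, z * x ∈ P) (k : ℕ) {x : B} (hx : x ∈ P) : z ^ k * x ∈ P := by
  induction k with
  | zero => simpa using hx
  | succ k ih => simpa [pow_succ', mul_assoc] using h _ ih

theorem nexp_mul_mem_homDeg {c : V} (hc : c ∈ 𝒱 0) (hn : IsNilpotent (symι 𝒱 c)) {d : ℤ}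
    {x : OC 𝒱 𝒲} (hx : x ∈ homDeg 𝒱 𝒲 d) :
    (nexp A (symι 𝒱 c) ⊗ₜ 1 : OC 𝒱 𝒲) * x ∈ homDeg 𝒱 𝒲 d := by
  obtain ⟨N, hN⟩ := hn
  rw [nexp_eq_sum hN, TensorProduct.sum_tmul, Finset.sum_mul]
  refine Submodule.sum_mem _ fun k _ => ?_
  rw [← TensorProduct.smul_tmul', smul_mul_assoc]
  refine Submodule.smul_mem _ _ ?_
  have : (symι 𝒱 c ^ k) ⊗ₜ[A] (1 : TensorAlgebra A W) = inC 𝒱 𝒲 c ^ k := by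
    rw [inC_apply, Algebra.TensorProduct.tmul_pow, one_pow]
  rw [this]
  exact pow_mul_mem (fun y hy => by simpa using inC_mul_mem_homDeg hc hy) k hx

theorem geom_mul_mem_homDeg {o : W} (ho : o ∈ 𝒲 0) {d : ℤ}
    {x : OC 𝒱 𝒲} (hx : x ∈ homDeg 𝒱 𝒲 d) :
    (1 ⊗ₜ geom (TensorAlgebra.ι A o) : OC 𝒱 𝒲) * x ∈ homDeg 𝒱 𝒲 d := by
  rw [geom, TensorProduct.tmul_sum, Finset.sum_mul]
  refine Submodule.sum_mem _ fun k _ => ?_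
  have : (1 : Sym 𝒱) ⊗ₜ[A] (TensorAlgebra.ι A o ^ k) = inO 𝒱 𝒲 o ^ k := by
    rw [inO_apply, Algebra.TensorProduct.tmul_pow, one_pow]
  rw [this]
  exact pow_mul_mem (fun y hy => by simpa using inO_mul_mem_homDeg ho hy) k hx

theorem hasDegree_shiftLin {c : V} (hc : c ∈ 𝒱 0) (hn : IsNilpotent (symι 𝒱 c)) {o : W}
    (ho : o ∈ 𝒲 0) : HasDegree 0 (shiftLin 𝒱 𝒲 c o) := by
  intro d x hx
  rw [add_zero]
  refine map_mem_of_mem_span _ ?_ hx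
  clear hx x
  rintro _ ⟨cs, os, rfl, rfl⟩
  induction cs with
  | nil =>
    induction os with
    | nil =>
      have : shiftLin 𝒱 𝒲 c o 1 =
          (nexp A (symι 𝒱 c) ⊗ₜ 1) * ((1 ⊗ₜ geom (TensorAlgebra.ι A o)) * 1) := by
        simp [shiftLin, symShift_apply, Algebra.TensorProduct.one_def]
      simpa [this] using nexp_mul_mem_homDeg hc hn
        (geom_mul_mem_homDeg ho (one_mem_homDeg (𝒱 := 𝒱) (𝒲 := 𝒲)))
    | cons w os ih =>
      have := geom_mul_mem_homDeg ho (inO_mul_mem_homDeg w.2.2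
        ih)
      simpa [monom_cons_right, shiftLin_inO_mul] using this
  | cons v cs ih =>
    have := inC_mul_mem_homDeg v.2.2 ih
    simpa [monom_cons_left, shiftLin_inC_mul hc hn, add_assoc] using this

theorem counit_shiftLin {c : V} (hn : IsNilpotent (symι 𝒱 c)) {o : W}
    (hm : IsNilpotent (TensorAlgebra.ι A o)) :
    counit 𝒱 𝒲 ∘ₗ shiftLin 𝒱 𝒲 c o = counit 𝒱 𝒲 :=
  TensorProduct.ext' fun x y => by
    simp [shiftLin, symCounit_symShift hn, algebraMapInv_tensShift hm]

theorem projC_shiftLin {c : V} (hn : IsNilpotent (symι 𝒱 c)) {o : W}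
    (hm : IsNilpotent (TensorAlgebra.ι A o)) (x : OC 𝒱 𝒲) :
    projC 𝒱 𝒲 (shiftLin 𝒱 𝒲 c o x) = projC 𝒱 𝒲 x + counit 𝒱 𝒲 x • c := by
  refine LinearMap.congr_fun (f := projC 𝒱 𝒲 ∘ₗ shiftLin 𝒱 𝒲 c o)
    (g := projC 𝒱 𝒲 + LinearMap.toSpanSingleton A V c ∘ₗ counit 𝒱 𝒲)
    (TensorProduct.ext' fun x y => ?_) x
  simp [shiftLin, symProj_symShift hn, algebraMapInv_tensShift hm, smul_smul, mul_comm]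

theorem projO_shiftLin {c : V} (hn : IsNilpotent (symι 𝒱 c)) {o : W}
    (hm : IsNilpotent (TensorAlgebra.ι A o)) (x : OC 𝒱 𝒲) :
    projO 𝒱 𝒲 (shiftLin 𝒱 𝒲 c o x) = projO 𝒱 𝒲 x + counit 𝒱 𝒲 x • o := by
  refine LinearMap.congr_fun (f := projO 𝒱 𝒲 ∘ₗ shiftLin 𝒱 𝒲 c o)
    (g := projO 𝒱 𝒲 + LinearMap.toSpanSingleton A W o ∘ₗ counit 𝒱 𝒲)
    (TensorProduct.ext' fun x y => ?_) x
  simp [shiftLin, symCounit_symShift hn, ιInv_tensShift hm, smul_smul]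

variable (𝒱 𝒲) in
/-- The coalgebra map with components `f_0 = c`, `f_{0,0} = o`, `f_1 = 1`, `f_{0,1} = 1`. -/
def shift {c : V} (hc : c ∈ 𝒱 0) (hn : IsNilpotent (symι 𝒱 c)) {o : W} (ho : o ∈ 𝒲 0)
    (hm : IsNilpotent (TensorAlgebra.ι A o)) : CoalgMap 𝒱 𝒲 𝒱 𝒲 where
  toLin := shiftLin 𝒱 𝒲 c o
  degree := hasDegree_shiftLin hc hn ho
  counit_comp := counit_shiftLin hn hm
  comul_comp := TensorProduct.ext' fun x y => by
    simp only [LinearMap.comp_apply, shiftLin, TensorProduct.map_tmul, comul_tmul,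
      symComul_symShift hc hn, tensComul_tensShift hm]
    exact midSwap_map (symSgn_symShift hc hn) (tensSgn_tensShift ho)
      (symComul 𝒱 x ⊗ₜ tensComul y)
  closedOnly := fun cs os hos => by
    rw [projC_shiftLin hn hm, counit_monom, projC_monom_of_length_ne (by simp [hos]),
      if_neg (by simp [hos]), zero_smul, add_zero]

theorem isShift_shift {c : V} (hc : c ∈ 𝒱 0) (hn : IsNilpotent (symι 𝒱 c)) {o : W}
    (ho : o ∈ 𝒲 0) (hm : IsNilpotent (TensorAlgebra.ι A o)) :
    IsShift (shift 𝒱 𝒲 hc hn ho hm) c o := by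
  have hC : ∀ x, projC 𝒱 𝒲 ((shift 𝒱 𝒲 hc hn ho hm).toLin x) =
    projC 𝒱 𝒲 x + counit 𝒱 𝒲 x • c := projC_shiftLin hn hm
  have hO : ∀ x, projO 𝒱 𝒲 ((shift 𝒱 𝒲 hc hn ho hm).toLin x) =
    projO 𝒱 𝒲 x + counit 𝒱 𝒲 x • o := projO_shiftLin hn hm
  constructor
  · rw [closedPart, hC, projC_monom, counit_monom]; simp
  · intro v; rw [closedPart, hC, projC_monom, counit_monom]; simp
  · intro cs h
    rw [closedPart, hC, projC_monom_of_length_ne (by omega), counit_monom, if_neg (by omega),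
      zero_smul, add_zero]
  · rw [openPart, hO, projO_monom, counit_monom]; simp
  · intro v; rw [openPart, hO, projO_monom, counit_monom]; simp
  · intro cs os h
    have h' : cs.length ≠ 0 ∨ 2 ≤ os.length := h.imp_left (mt List.length_eq_zero_iff.1)
    rw [openPart, hO, projO_monom_of_length_ne (by omega), counit_monom, if_neg (by omega),
      zero_smul, add_zero]

theorem IsShift.unique {f g : CoalgMap 𝒱 𝒲 𝒱 𝒲} {c : V} {o : W} (hf : IsShift f c o)
    (hg : IsShift g c o) : f = g := by
  refine CoalgMap.ext_proj (oc_hom_ext fun cs os => ?_) (oc_hom_ext fun cs os => ?_)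
  · by_cases h : os = []
    · subst h
      change closedPart f.toLin cs = closedPart g.toLin cs
      rcases cs with _ | ⟨v, _ | ⟨v', cs⟩⟩
      · rw [hf.closed_zero, hg.closed_zero]
      · rw [hf.closed_one, hg.closed_one]
      · rw [hf.closed_high _ (by simp), hg.closed_high _ (by simp)]
    · exact (f.closedOnly cs os h).trans (g.closedOnly cs os h).symm
  · change openPart f.toLin cs os = openPart g.toLin cs os
    by_cases h : cs ≠ [] ∨ 2 ≤ os.length
    · rw [hf.open_high _ _ h, hg.open_high _ _ h]
    · push Not at h
      obtain ⟨rfl, h⟩ := h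
      rcases os with _ | ⟨w, _ | ⟨w', os⟩⟩
      · rw [hf.open_zero, hg.open_zero]
      · rw [hf.open_one, hg.open_one]
      · simp at h

end Shift

/-! ### Locally unipotent endomorphisms. -/

section Unipotent

variable {A : Type*} [CommRing A] {X : Type*} [AddCommGroup X] [Module A X]

theorem pow_apply_mem {N : Module.End A X} {P : Submodule A X} (hN : ∀ x ∈ P, N x ∈ P) (k : ℕ)
    {x : X} (hx : x ∈ P) : (N ^ k) x ∈ P := by
  induction k with
  | zero => simpa using hx
  | succ k ih =>
    rw [pow_succ', Module.End.mul_apply]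
    exact hN _ ih

/-- The preimage is a finite geometric series in `1 - M` applied to `x`. As a polynomial in `M` it
stays in every submodule that `M` preserves; this is how the inverse inherits properties of `M`. -/
theorem exists_mem_of_unipotent {M : Module.End A X} {x : X} {k : ℕ}
    (hx : ((M - 1) ^ k) x = 0) {P : Submodule A X} (hP : ∀ x ∈ P, M x ∈ P) (hxP : x ∈ P) :
    ∃ y ∈ P, M y = x := by
  refine ⟨(∑ i ∈ Finset.range k, (1 - M) ^ i) x, ?_, ?_⟩
  · rw [LinearMap.sum_apply]
    exact P.sum_mem fun i _ => pow_apply_mem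
      (fun x hx => by simpa using P.sub_mem hx (hP x hx)) i hxP
  · have h := mul_neg_geom_sum (1 - M) k
    rw [sub_sub_cancel] at h
    rw [← Module.End.mul_apply, h, ← neg_sub M 1, neg_pow]
    simp [hx]

theorem eq_zero_of_unipotent {M : Module.End A X} {x : X} {k : ℕ}
    (hx : ((M - 1) ^ k) x = 0) (h : M x = 0) : x = 0 := by
  have : ∀ k, ((M - 1) ^ k) x = (-1 : A) ^ k • x := by
    intro k
    induction k with
    | zero => simp
    | succ k ih =>
      rw [pow_succ', Module.End.mul_apply, ih, map_smul, LinearMap.sub_apply, h,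
        Module.End.one_apply, zero_sub, pow_succ', smul_neg, mul_smul, neg_smul, one_smul]
  rw [this] at hx
  have := congrArg ((-1 : A) ^ k • ·) hx
  simpa [smul_smul, ← mul_pow] using this

theorem bijective_of_unipotent {M : Module.End A X} (h : ∀ x : X, ∃ k : ℕ, ((M - 1) ^ k) x = 0) :
    Function.Bijective M := by
  refine ⟨(injective_iff_map_eq_zero M).2 fun x hx => ?_, fun x => ?_⟩
  · obtain ⟨k, hk⟩ := h x
    exact eq_zero_of_unipotent hk hx
  · obtain ⟨k, hk⟩ := h x
    obtain ⟨y, -, hy⟩ := exists_mem_of_unipotent hk (P := ⊤) (fun _ _ => trivial) trivial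
    exact ⟨y, hy⟩

theorem mem_of_unipotent {M : Module.End A X} (h : ∀ x : X, ∃ k : ℕ, ((M - 1) ^ k) x = 0)
    {P : Submodule A X} (hP : ∀ x ∈ P, M x ∈ P) {x : X} (hx : M x ∈ P) : x ∈ P := by
  obtain ⟨k, hk⟩ := h (M x)
  obtain ⟨y, hy, hyx⟩ := exists_mem_of_unipotent hk hP hx
  rwa [← (bijective_of_unipotent h).1 hyx]

end Unipotent

/-! ### Composition and inversion of coalgebra maps. -/

section Inverse

variable {A : Type*} [CommRing A] [Algebra ℚ A]
variable {V W : Type*} [AddCommGroup V] [Module A V] [AddCommGroup W] [Module A W]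
variable {V' W' : Type*} [AddCommGroup V'] [Module A V'] [AddCommGroup W'] [Module A W']
variable {V'' W'' : Type*} [AddCommGroup V''] [Module A V''] [AddCommGroup W''] [Module A W'']
variable {𝒱 : ℤ → Submodule A V} {𝒲 : ℤ → Submodule A W}
variable {𝒱' : ℤ → Submodule A V'} {𝒲' : ℤ → Submodule A W'}
variable {𝒱'' : ℤ → Submodule A V''} {𝒲'' : ℤ → Submodule A W''}
variable [DirectSum.Decomposition 𝒱] [DirectSum.Decomposition 𝒲]
  [DirectSum.Decomposition 𝒱'] [DirectSum.Decomposition 𝒲']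
  [DirectSum.Decomposition 𝒱''] [DirectSum.Decomposition 𝒲'']

variable (𝒱 𝒲) in
/-- The identity coalgebra map. -/
def CoalgMap.id : CoalgMap 𝒱 𝒲 𝒱 𝒲 where
  toLin := LinearMap.id
  degree := fun d x hx => by simpa using hx
  counit_comp := rfl
  comul_comp := by rw [TensorProduct.map_id]; rfl
  closedOnly := fun c o ho => projC_monom_of_length_ne (by simp [ho])

/-- The composition of coalgebra maps. -/
def CoalgMap.comp (f : CoalgMap 𝒱' 𝒲' 𝒱 𝒲) (g : CoalgMap 𝒱'' 𝒲'' 𝒱' 𝒲') :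
    CoalgMap 𝒱'' 𝒲'' 𝒱 𝒲 where
  toLin := f.toLin ∘ₗ g.toLin
  degree := fun d x hx => by
    have h := f.degree _ _ (g.degree _ _ hx)
    rwa [add_zero (d + 0)] at h
  counit_comp := by rw [← LinearMap.comp_assoc, f.counit_comp, g.counit_comp]
  comul_comp := by
    rw [← LinearMap.comp_assoc, f.comul_comp, LinearMap.comp_assoc, g.comul_comp,
      TensorProduct.map_comp, LinearMap.comp_assoc]
  closedOnly := closedOnly_of_mapsTo fun _ hx => f.map_openIdeal (g.map_openIdeal hx)

/-- A translation changes the components only by a constant times the counit, so the constants add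
up and the composite has the components of the identity. -/
theorem shift_comp_shift {c : V} (hc : c ∈ 𝒱 0) (hn : IsNilpotent (symι 𝒱 c)) {o : W}
    (ho : o ∈ 𝒲 0) (hm : IsNilpotent (TensorAlgebra.ι A o)) {c' : V} (hc' : c' ∈ 𝒱 0)
    (hn' : IsNilpotent (symι 𝒱 c')) {o' : W} (ho' : o' ∈ 𝒲 0)
    (hm' : IsNilpotent (TensorAlgebra.ι A o')) (hcc : c' + c = 0) (hoo : o' + o = 0) :
    shiftLin 𝒱 𝒲 c o ∘ₗ shiftLin 𝒱 𝒲 c' o' = LinearMap.id := by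
  have : (shift 𝒱 𝒲 hc hn ho hm).comp (shift 𝒱 𝒲 hc' hn' ho' hm') = CoalgMap.id 𝒱 𝒲 := by
    have hε := LinearMap.congr_fun (counit_shiftLin (𝒱 := 𝒱) (𝒲 := 𝒲) hn' hm')
    simp only [LinearMap.comp_apply] at hε
    refine CoalgMap.ext_proj (LinearMap.ext fun x => ?_) (LinearMap.ext fun x => ?_)
    · change projC 𝒱 𝒲 (shiftLin 𝒱 𝒲 c o (shiftLin 𝒱 𝒲 c' o' x)) = projC 𝒱 𝒲 x
      rw [projC_shiftLin hn hm, projC_shiftLin hn' hm', hε, add_assoc, ← smul_add, hcc, smul_zero,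
        add_zero]
    · change projO 𝒱 𝒲 (shiftLin 𝒱 𝒲 c o (shiftLin 𝒱 𝒲 c' o' x)) = projO 𝒱 𝒲 x
      rw [projO_shiftLin hn hm, projO_shiftLin hn' hm', hε, add_assoc, ← smul_add, hoo, smul_zero,
        add_zero]
  exact congrArg CoalgMap.toLin this

theorem bijective_shiftLin {c : V} (hc : c ∈ 𝒱 0) (hn : IsNilpotent (symι 𝒱 c)) {o : W}
    (ho : o ∈ 𝒲 0) (hm : IsNilpotent (TensorAlgebra.ι A o)) :
    Function.Bijective (shiftLin 𝒱 𝒲 c o) := by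
  have hc' : -c ∈ 𝒱 0 := neg_mem hc
  have ho' : -o ∈ 𝒲 0 := neg_mem ho
  have hn' : IsNilpotent (symι 𝒱 (-c)) := by rw [map_neg]; exact hn.neg
  have hm' : IsNilpotent (TensorAlgebra.ι A (-o)) := by rw [map_neg]; exact hm.neg
  exact Function.bijective_iff_has_inverse.2 ⟨shiftLin 𝒱 𝒲 (-c) (-o),
    fun x => LinearMap.congr_fun (shift_comp_shift hc' hn' ho' hm' hc hn ho hm
      (add_neg_cancel c) (add_neg_cancel o)) x,
    fun x => LinearMap.congr_fun (shift_comp_shift hc hn ho hm hc' hn' ho' hm'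
      (neg_add_cancel c) (neg_add_cancel o)) x⟩

theorem projC_mem_of_homDeg {d : ℤ} {x : OC 𝒱 𝒲} (hx : x ∈ homDeg 𝒱 𝒲 d) :
    projC 𝒱 𝒲 x ∈ 𝒱 d := by
  refine map_mem_of_mem_span _ ?_ hx
  rintro _ ⟨c, o, rfl, rfl⟩
  rcases c with _ | ⟨v, _ | ⟨v', c⟩⟩ <;> rcases o with _ | ⟨w, o⟩ <;>
    simp [projC_monom, -monom_nil]

theorem projO_mem_of_homDeg {d : ℤ} {x : OC 𝒱 𝒲} (hx : x ∈ homDeg 𝒱 𝒲 d) :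
    projO 𝒱 𝒲 x ∈ 𝒲 d := by
  refine map_mem_of_mem_span _ ?_ hx
  rintro _ ⟨c, o, rfl, rfl⟩
  rcases c with _ | ⟨v, c⟩ <;> rcases o with _ | ⟨w, _ | ⟨w', o⟩⟩ <;>
    simp [projO_monom, -monom_nil]

/-- The algebra map induced by graded maps `φ : V' → V` and `χ : W' → W`. -/
def ocMap (𝒱' : ℤ → Submodule A V') (𝒲' : ℤ → Submodule A W') (𝒱 : ℤ → Submodule A V)
    (𝒲 : ℤ → Submodule A W) (φ : V' →ₗ[A] V) (hφ : ∀ i, ∀ v ∈ 𝒱' i, φ v ∈ 𝒱 i) (χ : W' →ₗ[A] W) :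
    OC 𝒱' 𝒲' →ₐ[A] OC 𝒱 𝒲 :=
  Algebra.TensorProduct.map
    (symLift 𝒱' (symι 𝒱 ∘ₗ φ) fun hx hy => symι_mul 𝒱 (hφ _ _ hx) (hφ _ _ hy))
    (TensorAlgebra.lift A (TensorAlgebra.ι A ∘ₗ χ))

section

variable {φ : V' →ₗ[A] V} (hφ : ∀ i, ∀ v ∈ 𝒱' i, φ v ∈ 𝒱 i) {χ : W' →ₗ[A] W}

theorem ocMap_inC (v : V') : ocMap 𝒱' 𝒲' 𝒱 𝒲 φ hφ χ (inC 𝒱' 𝒲' v) = inC 𝒱 𝒲 (φ v) := by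
  rw [inC_apply, ocMap, Algebra.TensorProduct.map_tmul, map_one]
  exact congrArg (· ⊗ₜ[A] (1 : TensorAlgebra A W)) (symLift_symι 𝒱' (symι 𝒱 ∘ₗ φ)
    (fun hx hy => symι_mul 𝒱 (hφ _ _ hx) (hφ _ _ hy)) v)

theorem ocMap_inO (w : W') : ocMap 𝒱' 𝒲' 𝒱 𝒲 φ hφ χ (inO 𝒱' 𝒲' w) = inO 𝒱 𝒲 (χ w) := by
  simp [ocMap, inO_apply]

theorem ocMap_monom (c : List V') (o : List W') :
    ocMap 𝒱' 𝒲' 𝒱 𝒲 φ hφ χ (monom 𝒱' 𝒲' c o) = monom 𝒱 𝒲 (c.map φ) (o.map χ) := by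
  induction c with
  | nil =>
    induction o with
    | nil => simp
    | cons w o ih =>
      rw [monom_cons_right, map_mul, ocMap_inO, ih, List.map_cons, monom_cons_right]
  | cons v c ih => rw [monom_cons_left, map_mul, ocMap_inC, ih, List.map_cons, monom_cons_left]

theorem closedPr_ocMap (n : ℕ) (x : OC 𝒱' 𝒲') :
    closedPr 𝒱 𝒲 n (ocMap 𝒱' 𝒲' 𝒱 𝒲 φ hφ χ x) =
      ocMap 𝒱' 𝒲' 𝒱 𝒲 φ hφ χ (closedPr 𝒱' 𝒲' n x) := by
  refine LinearMap.congr_fun (f := closedPr 𝒱 𝒲 n ∘ₗ (ocMap 𝒱' 𝒲' 𝒱 𝒲 φ hφ χ).toLinearMap)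
    (g := (ocMap 𝒱' 𝒲' 𝒱 𝒲 φ hφ χ).toLinearMap ∘ₗ closedPr 𝒱' 𝒲' n)
    (oc_hom_ext fun c o => ?_) x
  simp only [LinearMap.comp_apply, AlgHom.toLinearMap_apply, ocMap_monom, closedPr_monom,
    List.length_map]
  split_ifs <;> simp [ocMap_monom]

theorem pr_ocMap (n m : ℕ) (x : OC 𝒱' 𝒲') :
    pr 𝒱 𝒲 n m (ocMap 𝒱' 𝒲' 𝒱 𝒲 φ hφ χ x) =
      ocMap 𝒱' 𝒲' 𝒱 𝒲 φ hφ χ (pr 𝒱' 𝒲' n m x) := by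
  refine LinearMap.congr_fun (f := pr 𝒱 𝒲 n m ∘ₗ (ocMap 𝒱' 𝒲' 𝒱 𝒲 φ hφ χ).toLinearMap)
    (g := (ocMap 𝒱' 𝒲' 𝒱 𝒲 φ hφ χ).toLinearMap ∘ₗ pr 𝒱' 𝒲' n m)
    (oc_hom_ext fun c o => ?_) x
  simp only [LinearMap.comp_apply, AlgHom.toLinearMap_apply, ocMap_monom, pr_monom,
    List.length_map]
  split_ifs <;> simp [ocMap_monom]

theorem projC_ocMap (x : OC 𝒱' 𝒲') :
    projC 𝒱 𝒲 (ocMap 𝒱' 𝒲' 𝒱 𝒲 φ hφ χ x) = φ (projC 𝒱' 𝒲' x) := by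
  refine LinearMap.congr_fun (f := projC 𝒱 𝒲 ∘ₗ (ocMap 𝒱' 𝒲' 𝒱 𝒲 φ hφ χ).toLinearMap)
    (g := φ ∘ₗ projC 𝒱' 𝒲') (oc_hom_ext fun c o => ?_) x
  simp only [LinearMap.comp_apply, AlgHom.toLinearMap_apply, ocMap_monom]
  rcases c with _ | ⟨v, _ | ⟨v', c⟩⟩ <;> rcases o with _ | ⟨w, o⟩ <;>
    simp [projC_monom, -monom_nil]

theorem projO_ocMap (x : OC 𝒱' 𝒲') :
    projO 𝒱 𝒲 (ocMap 𝒱' 𝒲' 𝒱 𝒲 φ hφ χ x) = χ (projO 𝒱' 𝒲' x) := by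
  refine LinearMap.congr_fun (f := projO 𝒱 𝒲 ∘ₗ (ocMap 𝒱' 𝒲' 𝒱 𝒲 φ hφ χ).toLinearMap)
    (g := χ ∘ₗ projO 𝒱' 𝒲') (oc_hom_ext fun c o => ?_) x
  simp only [LinearMap.comp_apply, AlgHom.toLinearMap_apply, ocMap_monom]
  rcases c with _ | ⟨v, c⟩ <;> rcases o with _ | ⟨w, _ | ⟨w', o⟩⟩ <;>
    simp [projO_monom, -monom_nil]

/-- The same recursion as for a coalgebra map, deduced from compatibility with the projections. For
the weight comparison this replaces a proof that `ocMap` is comultiplicative. -/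
theorem closedPr_succ_comp_ocMap (n : ℕ) :
    closedPr 𝒱 𝒲 (n + 1) ∘ₗ (ocMap 𝒱' 𝒲' 𝒱 𝒲 φ hφ χ).toLinearMap =
      algebraMap ℚ A ((n : ℚ) + 1)⁻¹ • (mulC 𝒱 𝒲 ∘ₗ
        TensorProduct.map (projC 𝒱 𝒲 ∘ₗ (ocMap 𝒱' 𝒲' 𝒱 𝒲 φ hφ χ).toLinearMap)
          (closedPr 𝒱 𝒲 n ∘ₗ (ocMap 𝒱' 𝒲' 𝒱 𝒲 φ hφ χ).toLinearMap) ∘ₗ comul 𝒱' 𝒲') := by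
  have h : (ocMap 𝒱' 𝒲' 𝒱 𝒲 φ hφ χ).toLinearMap ∘ₗ mulC 𝒱' 𝒲' ∘ₗ
      TensorProduct.map (projC 𝒱' 𝒲') (closedPr 𝒱' 𝒲' n) = mulC 𝒱 𝒲 ∘ₗ
        TensorProduct.map (projC 𝒱 𝒲 ∘ₗ (ocMap 𝒱' 𝒲' 𝒱 𝒲 φ hφ χ).toLinearMap)
          (closedPr 𝒱 𝒲 n ∘ₗ (ocMap 𝒱' 𝒲' 𝒱 𝒲 φ hφ χ).toLinearMap) :=
    TensorProduct.ext' fun x y => by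
      simp [-TensorProduct.map_tmul, TensorProduct.map_tmul, projC_ocMap, closedPr_ocMap, ocMap_inC]
  refine LinearMap.ext fun x => ?_
  have := LinearMap.congr_fun h (comul 𝒱' 𝒲' x)
  simp only [LinearMap.comp_apply, AlgHom.toLinearMap_apply] at this
  simp only [LinearMap.comp_apply, AlgHom.toLinearMap_apply, LinearMap.smul_apply, closedPr_ocMap,
    ← this]
  simp [closedPr]

theorem pr_succ_comp_ocMap (n m : ℕ) :
    pr 𝒱 𝒲 n (m + 1) ∘ₗ (ocMap 𝒱' 𝒲' 𝒱 𝒲 φ hφ χ).toLinearMap = mulO 𝒱 𝒲 ∘ₗ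
      TensorProduct.map (pr 𝒱 𝒲 n m ∘ₗ (ocMap 𝒱' 𝒲' 𝒱 𝒲 φ hφ χ).toLinearMap)
        (projO 𝒱 𝒲 ∘ₗ (ocMap 𝒱' 𝒲' 𝒱 𝒲 φ hφ χ).toLinearMap) ∘ₗ comul 𝒱' 𝒲' := by
  have h : (ocMap 𝒱' 𝒲' 𝒱 𝒲 φ hφ χ).toLinearMap ∘ₗ mulO 𝒱' 𝒲' ∘ₗ
      TensorProduct.map (pr 𝒱' 𝒲' n m) (projO 𝒱' 𝒲') = mulO 𝒱 𝒲 ∘ₗ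
        TensorProduct.map (pr 𝒱 𝒲 n m ∘ₗ (ocMap 𝒱' 𝒲' 𝒱 𝒲 φ hφ χ).toLinearMap)
          (projO 𝒱 𝒲 ∘ₗ (ocMap 𝒱' 𝒲' 𝒱 𝒲 φ hφ χ).toLinearMap) :=
    TensorProduct.ext' fun x y => by
      simp [projO_ocMap, pr_ocMap, ocMap_inO]
  refine LinearMap.ext fun x => ?_
  have := LinearMap.congr_fun h (comul 𝒱' 𝒲' x)
  simp only [LinearMap.comp_apply, AlgHom.toLinearMap_apply] at this
  simp only [LinearMap.comp_apply, AlgHom.toLinearMap_apply, pr_ocMap, ← this]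
  simp [pr]

end

/-- If the components of `G` start with the linear ones, then `G` does not increase the weight
`2 p + q` of monomials with `p` closed and `q` open letters. -/
theorem pr_eq_zero_of_weight {G : OC 𝒱' 𝒲' →ₗ[A] OC 𝒱 𝒲}
    (hc : ∀ n, closedPr 𝒱 𝒲 (n + 1) ∘ₗ G = algebraMap ℚ A ((n : ℚ) + 1)⁻¹ • (mulC 𝒱 𝒲 ∘ₗ
      TensorProduct.map (projC 𝒱 𝒲 ∘ₗ G) (closedPr 𝒱 𝒲 n ∘ₗ G) ∘ₗ comul 𝒱' 𝒲'))
    (ho : ∀ n m, pr 𝒱 𝒲 n (m + 1) ∘ₗ G =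
      mulO 𝒱 𝒲 ∘ₗ TensorProduct.map (pr 𝒱 𝒲 n m ∘ₗ G) (projO 𝒱 𝒲 ∘ₗ G) ∘ₗ comul 𝒱' 𝒲')
    (hC : ∀ (c : List V') (o : List W'), 2 * c.length + o.length < 2 →
      projC 𝒱 𝒲 (G (monom 𝒱' 𝒲' c o)) = 0)
    (hO : projO 𝒱 𝒲 (G (monom 𝒱' 𝒲' [] [])) = 0)
    (n m : ℕ) (c : List V') (o : List W') (h : 2 * c.length + o.length < 2 * n + m) :
    pr 𝒱 𝒲 n m (G (monom 𝒱' 𝒲' c o)) = 0 := by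
  induction m generalizing c o with
  | zero =>
    change closedPr 𝒱 𝒲 n (G (monom 𝒱' 𝒲' c o)) = 0
    induction n generalizing c o with
    | zero => omega
    | succ n ih =>
      rw [← LinearMap.comp_apply, hc, LinearMap.smul_apply, LinearMap.comp_apply,
        LinearMap.comp_apply, map_comul_monom_eq_zero c o, map_zero, smul_zero]
      intro c₁ c₂ o₁ o₂ hc' ho'
      rw [TensorProduct.map_tmul]
      -- A closed output letter uses up input of weight at least 2, so the remaining input is too
      -- light for `n` further letters.
      by_cases h₁ : 2 * c₁.length + o₁.length < 2
      · rw [LinearMap.comp_apply, hC _ _ h₁, TensorProduct.zero_tmul]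
      · rw [LinearMap.comp_apply (closedPr 𝒱 𝒲 n), ih _ _ (by omega), TensorProduct.tmul_zero]
  | succ m ih =>
    rw [← LinearMap.comp_apply, ho, LinearMap.comp_apply, LinearMap.comp_apply,
      map_comul_monom_eq_zero c o, map_zero]
    intro c₁ c₂ o₁ o₂ hc' ho'
    rw [TensorProduct.map_tmul]
    -- An open output letter uses up input of weight at least 1.
    by_cases h₁ : 2 * c₂.length + o₂.length = 0
    · obtain ⟨rfl, rfl⟩ : c₂ = [] ∧ o₂ = [] :=
        ⟨List.length_eq_zero_iff.1 (by omega), List.length_eq_zero_iff.1 (by omega)⟩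
      rw [LinearMap.comp_apply (projO 𝒱 𝒲), hO, TensorProduct.tmul_zero]
    · rw [LinearMap.comp_apply, ih _ _ (by omega), TensorProduct.zero_tmul]

/-- Maps with the same linear components agree up to terms of lower weight. -/
theorem pr_eq_of_weight {G H : OC 𝒱' 𝒲' →ₗ[A] OC 𝒱 𝒲}
    (hGc : ∀ n, closedPr 𝒱 𝒲 (n + 1) ∘ₗ G = algebraMap ℚ A ((n : ℚ) + 1)⁻¹ • (mulC 𝒱 𝒲 ∘ₗ
      TensorProduct.map (projC 𝒱 𝒲 ∘ₗ G) (closedPr 𝒱 𝒲 n ∘ₗ G) ∘ₗ comul 𝒱' 𝒲'))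
    (hGo : ∀ n m, pr 𝒱 𝒲 n (m + 1) ∘ₗ G =
      mulO 𝒱 𝒲 ∘ₗ TensorProduct.map (pr 𝒱 𝒲 n m ∘ₗ G) (projO 𝒱 𝒲 ∘ₗ G) ∘ₗ comul 𝒱' 𝒲')
    (hHc : ∀ n, closedPr 𝒱 𝒲 (n + 1) ∘ₗ H = algebraMap ℚ A ((n : ℚ) + 1)⁻¹ • (mulC 𝒱 𝒲 ∘ₗ
      TensorProduct.map (projC 𝒱 𝒲 ∘ₗ H) (closedPr 𝒱 𝒲 n ∘ₗ H) ∘ₗ comul 𝒱' 𝒲'))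
    (hHo : ∀ n m, pr 𝒱 𝒲 n (m + 1) ∘ₗ H =
      mulO 𝒱 𝒲 ∘ₗ TensorProduct.map (pr 𝒱 𝒲 n m ∘ₗ H) (projO 𝒱 𝒲 ∘ₗ H) ∘ₗ comul 𝒱' 𝒲')
    (hε : closedPr 𝒱 𝒲 0 ∘ₗ G = closedPr 𝒱 𝒲 0 ∘ₗ H)
    (hHC : ∀ (c : List V') (o : List W'), 2 * c.length + o.length < 2 →
      projC 𝒱 𝒲 (H (monom 𝒱' 𝒲' c o)) = 0)
    (hHO : projO 𝒱 𝒲 (H (monom 𝒱' 𝒲' [] [])) = 0)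
    (hC : ∀ (c : List V') (o : List W'), 2 * c.length + o.length ≤ 2 →
      projC 𝒱 𝒲 (G (monom 𝒱' 𝒲' c o)) = projC 𝒱 𝒲 (H (monom 𝒱' 𝒲' c o)))
    (hO : ∀ (c : List V') (o : List W'), 2 * c.length + o.length ≤ 1 →
      projO 𝒱 𝒲 (G (monom 𝒱' 𝒲' c o)) = projO 𝒱 𝒲 (H (monom 𝒱' 𝒲' c o)))
    (n m : ℕ) (c : List V') (o : List W') (h : 2 * c.length + o.length ≤ 2 * n + m) :
    pr 𝒱 𝒲 n m (G (monom 𝒱' 𝒲' c o)) = pr 𝒱 𝒲 n m (H (monom 𝒱' 𝒲' c o)) := by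
  have hGC : ∀ (c : List V') (o : List W'), 2 * c.length + o.length < 2 →
      projC 𝒱 𝒲 (G (monom 𝒱' 𝒲' c o)) = 0 := fun c o h => by
    rw [hC c o h.le, hHC c o h]
  have hGO : projO 𝒱 𝒲 (G (monom 𝒱' 𝒲' [] [])) = 0 := by rw [hO [] [] (by simp), hHO]
  have zG := pr_eq_zero_of_weight hGc hGo hGC hGO
  have zH := pr_eq_zero_of_weight hHc hHo hHC hHO
  induction m generalizing c o with
  | zero =>
    change closedPr 𝒱 𝒲 n (G (monom 𝒱' 𝒲' c o)) = closedPr 𝒱 𝒲 n (H (monom 𝒱' 𝒲' c o))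
    induction n generalizing c o with
    | zero => exact LinearMap.congr_fun hε _
    | succ n ih =>
      rw [← LinearMap.comp_apply, hGc, ← LinearMap.comp_apply, hHc, LinearMap.smul_apply,
        LinearMap.comp_apply, LinearMap.comp_apply, LinearMap.smul_apply, LinearMap.comp_apply,
        LinearMap.comp_apply]
      congr 2
      refine map_comul_monom_eq c o fun c₁ c₂ o₁ o₂ hc' ho' => ?_
      simp only [TensorProduct.map_tmul, LinearMap.comp_apply]
      -- Below weight 2 both closed components vanish; at weight 2 they agree and induction handles
      -- the rest; above it, the rest is too light for either map.
      rcases lt_trichotomy (2 * c₁.length + o₁.length) 2 with h₁ | h₁ | h₁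
      · rw [hGC _ _ h₁, hHC _ _ h₁, TensorProduct.zero_tmul, TensorProduct.zero_tmul]
      · rw [ih _ _ (by omega), hC _ _ h₁.le]
      · have e₁ := zG n 0 c₂ o₂ (by omega)
        have e₂ := zH n 0 c₂ o₂ (by omega)
        rw [pr] at e₁ e₂
        rw [e₁, e₂, TensorProduct.tmul_zero, TensorProduct.tmul_zero]
  | succ m ih =>
    rw [← LinearMap.comp_apply, hGo, ← LinearMap.comp_apply, hHo,
      LinearMap.comp_apply, LinearMap.comp_apply, LinearMap.comp_apply, LinearMap.comp_apply]
    congr 1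
    refine map_comul_monom_eq c o fun c₁ c₂ o₁ o₂ hc' ho' => ?_
    simp only [TensorProduct.map_tmul, LinearMap.comp_apply]
    rcases lt_trichotomy (2 * c₂.length + o₂.length) 1 with h₁ | h₁ | h₁
    · obtain ⟨rfl, rfl⟩ : c₂ = [] ∧ o₂ = [] :=
        ⟨List.length_eq_zero_iff.1 (by omega), List.length_eq_zero_iff.1 (by omega)⟩
      rw [hGO, hHO, TensorProduct.tmul_zero, TensorProduct.tmul_zero]
    · rw [ih _ _ (by omega), hO _ _ h₁.le]
    · rw [zG _ _ _ _ (by omega), zH _ _ _ _ (by omega), TensorProduct.zero_tmul,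
        TensorProduct.zero_tmul]

variable (𝒱 𝒲) in
/-- The span of the monomials of weight `2 p + q < w`. -/
def weightLT (w : ℕ) : Submodule A (OC 𝒱 𝒲) :=
  Submodule.span A {x | ∃ (c : List V) (o : List W), 2 * c.length + o.length < w ∧
    x = monom 𝒱 𝒲 c o}

theorem exists_mem_weightLT (x : OC 𝒱 𝒲) : ∃ w, x ∈ weightLT 𝒱 𝒲 w := by
  have hmono : Monotone (weightLT 𝒱 𝒲) := fun a b hab =>
    Submodule.span_mono fun _ ⟨c, o, h, e⟩ => ⟨c, o, h.trans_le hab, e⟩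
  have := monom_span (P := ⨆ w, weightLT 𝒱 𝒲 w) (fun c o => Submodule.mem_iSup_of_mem
    (2 * c.length + o.length + 1) (Submodule.subset_span ⟨c, o, by omega, rfl⟩)) x
  exact (Submodule.mem_iSup_of_directed _ hmono.directed_le).1 this

theorem weightLT_zero : weightLT 𝒱 𝒲 0 = ⊥ := by
  simp [weightLT]

/-- The linear components of a coalgebra map on `V'`. -/
def CoalgMap.linC (f : CoalgMap 𝒱' 𝒲' 𝒱 𝒲) : V' →ₗ[A] V :=
  projC 𝒱 𝒲 ∘ₗ f.toLin ∘ₗ inC 𝒱' 𝒲'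

/-- The linear components of a coalgebra map on `W'`. -/
def CoalgMap.linO (f : CoalgMap 𝒱' 𝒲' 𝒱 𝒲) : W' →ₗ[A] W :=
  projO 𝒱 𝒲 ∘ₗ f.toLin ∘ₗ inO 𝒱' 𝒲'

theorem CoalgMap.linC_apply (f : CoalgMap 𝒱' 𝒲' 𝒱 𝒲) (v : V') :
    f.linC v = closedPart f.toLin [v] := by
  simp [linC, closedPart, monom_cons_left]

theorem CoalgMap.linO_apply (f : CoalgMap 𝒱' 𝒲' 𝒱 𝒲) (w : W') :
    f.linO w = openPart f.toLin [] [w] := by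
  simp [linO, openPart, monom_cons_right]

theorem CoalgMap.linC_mem (f : CoalgMap 𝒱' 𝒲' 𝒱 𝒲) (i : ℤ) (v : V') (hv : v ∈ 𝒱' i) :
    f.linC v ∈ 𝒱 i := by
  have h := inC_mul_mem_homDeg hv (one_mem_homDeg (𝒱 := 𝒱') (𝒲 := 𝒲'))
  rw [mul_one, add_zero] at h
  have := projC_mem_of_homDeg (f.degree _ _ h)
  rwa [add_zero] at this

theorem CoalgMap.linO_mem (f : CoalgMap 𝒱' 𝒲' 𝒱 𝒲) (i : ℤ) (w : W') (hw : w ∈ 𝒲' i) :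
    f.linO w ∈ 𝒲 i := by
  have h := inO_mul_mem_homDeg hw (one_mem_homDeg (𝒱 := 𝒱') (𝒲 := 𝒲'))
  rw [mul_one, add_zero] at h
  have := projO_mem_of_homDeg (f.degree _ _ h)
  rwa [add_zero] at this

/-- A graded map commutes with taking homogeneous components. So `v`, being its own component, is
the image of the component of `φ.symm v`, and injectivity concludes. -/
theorem symm_mem_of_graded {φ : V' ≃ₗ[A] V} (hφ : ∀ i, ∀ v ∈ 𝒱' i, φ v ∈ 𝒱 i) (i : ℤ) (v : V)
    (hv : v ∈ 𝒱 i) : φ.symm v ∈ 𝒱' i := by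
  have h : ∀ u, (DirectSum.decompose 𝒱 (φ u) i : V) = φ (DirectSum.decompose 𝒱' u i) := by
    intro u
    induction u using DirectSum.Decomposition.inductionOn 𝒱' with
    | zero => simp
    | @homogeneous j u =>
      by_cases hj : j = i
      · subst hj
        rw [DirectSum.decompose_of_mem_same _ (hφ j u u.2), DirectSum.decompose_coe,
          DirectSum.of_eq_same]
      · rw [DirectSum.decompose_of_mem_ne _ (hφ j u u.2) hj, DirectSum.decompose_of_mem_ne _ u.2 hj,
          map_zero]
    | add a b ha hb => simp [ha, hb]
  have h' := h (φ.symm v)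
  rw [φ.apply_symm_apply, DirectSum.decompose_of_mem_same _ hv] at h'
  rw [h', φ.symm_apply_apply]
  exact SetLike.coe_mem _

theorem ocMap_mem_homDeg {φ : V' →ₗ[A] V} (hφ : ∀ i, ∀ v ∈ 𝒱' i, φ v ∈ 𝒱 i) {χ : W' →ₗ[A] W}
    (hχ : ∀ i, ∀ w ∈ 𝒲' i, χ w ∈ 𝒲 i) {d : ℤ} {x : OC 𝒱' 𝒲'} (hx : x ∈ homDeg 𝒱' 𝒲' d) :
    ocMap 𝒱' 𝒲' 𝒱 𝒲 φ hφ χ x ∈ homDeg 𝒱 𝒲 d := by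
  refine map_mem_of_mem_span (ocMap 𝒱' 𝒲' 𝒱 𝒲 φ hφ χ).toLinearMap ?_ hx
  rintro _ ⟨c, o, rfl, rfl⟩
  refine Submodule.subset_span ⟨c.map fun v => ⟨v.1, φ v.2, hφ _ _ v.2.2⟩,
    o.map fun w => ⟨w.1, χ w.2, hχ _ _ w.2.2⟩, ?_, ?_⟩
  · simp [Function.comp_def]
  · simp [ocMap_monom, Function.comp_def]

theorem ocMap_mem_openIdeal {φ : V' →ₗ[A] V} (hφ : ∀ i, ∀ v ∈ 𝒱' i, φ v ∈ 𝒱 i)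
    {χ : W' →ₗ[A] W} {x : OC 𝒱' 𝒲'} (hx : x ∈ openIdeal 𝒱' 𝒲') :
    ocMap 𝒱' 𝒲' 𝒱 𝒲 φ hφ χ x ∈ openIdeal 𝒱 𝒲 := by
  refine map_mem_of_mem_span (ocMap 𝒱' 𝒲' 𝒱 𝒲 φ hφ χ).toLinearMap ?_ hx
  rintro _ ⟨c, o, ho, rfl⟩
  exact Submodule.subset_span ⟨c.map φ, o.map χ, by simpa using ho, by simp [ocMap_monom]⟩

theorem ocMap_comp_ocMap_symm {φ : V' ≃ₗ[A] V} (hφ : ∀ i, ∀ v ∈ 𝒱' i, φ v ∈ 𝒱 i)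
    (hφ' : ∀ i, ∀ v ∈ 𝒱 i, φ.symm v ∈ 𝒱' i) (χ : W' ≃ₗ[A] W) (x : OC 𝒱 𝒲) :
    ocMap 𝒱' 𝒲' 𝒱 𝒲 (φ : V' →ₗ[A] V) hφ (χ : W' →ₗ[A] W)
      (ocMap 𝒱 𝒲 𝒱' 𝒲' (φ.symm : V →ₗ[A] V') hφ' (χ.symm : W →ₗ[A] W') x) = x := by
  refine LinearMap.congr_fun (f := (ocMap 𝒱' 𝒲' 𝒱 𝒲 (φ : V' →ₗ[A] V) hφ χ.toLinearMap).toLinearMap ∘ₗ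
    (ocMap 𝒱 𝒲 𝒱' 𝒲' (φ.symm : V →ₗ[A] V') hφ' χ.symm.toLinearMap).toLinearMap)
    (g := LinearMap.id) (oc_hom_ext fun c o => ?_) x
  simp [ocMap_monom, Function.comp_def]

/-- Inversion of coalgebra maps without constant components. -/
theorem CoalgMap.bijective_of_zero (f : CoalgMap 𝒱' 𝒲' 𝒱 𝒲)
    (hf : Function.Bijective (linearPart f.toLin)) (hc : closedPart f.toLin [] = 0)
    (ho : openPart f.toLin [] [] = 0) :
    Function.Bijective f.toLin ∧
      (∀ d x, f.toLin x ∈ homDeg 𝒱 𝒲 d → x ∈ homDeg 𝒱' 𝒲' d) ∧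
      ∀ x, f.toLin x ∈ openIdeal 𝒱 𝒲 → x ∈ openIdeal 𝒱' 𝒲' := by
  have hb : Function.Bijective f.linC ∧ Function.Bijective f.linO := by
    have e : linearPart f.toLin = Prod.map f.linC f.linO :=
      funext fun h => Prod.ext (f.linC_apply _).symm (f.linO_apply _).symm
    rwa [e, Prod.map_bijective] at hf
  let φ : V' ≃ₗ[A] V := LinearEquiv.ofBijective f.linC hb.1
  let χ : W' ≃ₗ[A] W := LinearEquiv.ofBijective f.linO hb.2
  have hφ : ∀ i, ∀ v ∈ 𝒱' i, φ v ∈ 𝒱 i := f.linC_mem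
  have hχ : ∀ i, ∀ w ∈ 𝒲' i, χ w ∈ 𝒲 i := f.linO_mem
  have hφ' := symm_mem_of_graded hφ
  have hχ' := symm_mem_of_graded hχ
  let H := ocMap 𝒱' 𝒲' 𝒱 𝒲 (φ : V' →ₗ[A] V) hφ (χ : W' →ₗ[A] W)
  let K := ocMap 𝒱 𝒲 𝒱' 𝒲' (φ.symm : V →ₗ[A] V') hφ' (χ.symm : W →ₗ[A] W')
  have hHK : ∀ x, H (K x) = x := ocMap_comp_ocMap_symm hφ hφ' χ
  have hKH : ∀ x, K (H x) = x := ocMap_comp_ocMap_symm hφ' hφ χ.symm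
  have hHC : ∀ x, projC 𝒱 𝒲 (H.toLinearMap x) = φ (projC 𝒱' 𝒲' x) := projC_ocMap hφ
  have hHO : ∀ x, projO 𝒱 𝒲 (H.toLinearMap x) = χ (projO 𝒱' 𝒲' x) := projO_ocMap hφ
  -- The closed components agree up to weight 2 and the open ones up to weight 1. Two open letters
  -- also have weight 2; there `closedOnly` forces the closed component to vanish.
  have key := pr_eq_of_weight (G := f.toLin) (H := H.toLinearMap)
    (closedPr_succ_comp f.comul_comp) (pr_succ_comp f.comul_comp)
    (closedPr_succ_comp_ocMap hφ) (pr_succ_comp_ocMap hφ)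
    (oc_hom_ext fun c o => by
      have h₁ : closedPr 𝒱 𝒲 0 (H (monom 𝒱' 𝒲' c o)) = H (closedPr 𝒱' 𝒲' 0 (monom 𝒱' 𝒲' c o)) :=
        closedPr_ocMap hφ 0 _
      have h₂ := LinearMap.congr_fun f.counit_comp (monom 𝒱' 𝒲' c o)
      rw [LinearMap.comp_apply] at h₂
      simp only [LinearMap.comp_apply, AlgHom.toLinearMap_apply, h₁]
      simp [closedPr, h₂, -Algebra.TensorProduct.algebraMap_apply])
    (fun c o h => by
      rw [hHC, projC_monom_of_length_ne (by omega), map_zero])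
    (by
      rw [hHO, projO_monom_of_length_ne (by simp), map_zero])
    (fun c o h => by
      rw [hHC]
      rcases o with _ | ⟨w, o⟩
      · rcases c with _ | ⟨v, _ | ⟨v', c⟩⟩
        · rw [projC_monom_of_length_ne (by simp), map_zero]; exact hc
        · rw [projC_monom]; exact (f.linC_apply v).symm
        · simp at h
      · rw [f.closedOnly _ _ (by simp), projC_monom_of_length_ne (by simp), map_zero])
    (fun c o h => by
      rw [hHO]
      rcases c with _ | ⟨v, c⟩
      · rcases o with _ | ⟨w, _ | ⟨w', o⟩⟩
        · rw [projO_monom_of_length_ne (by simp), map_zero]; exact ho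
        · rw [projO_monom]; exact (f.linO_apply w).symm
        · simp at h
      · simp at h; omega)
  -- As `K` inverts `H` and preserves types, `M` is the identity up to lower weight. Weights are
  -- natural numbers, so `M - 1` is locally nilpotent.
  let M : Module.End A (OC 𝒱' 𝒲') := K.toLinearMap ∘ₗ f.toLin
  have hM : ∀ w, ∀ x ∈ weightLT 𝒱' 𝒲' (w + 1), (M - 1) x ∈ weightLT 𝒱' 𝒲' w := by
    intro w x hx
    refine map_mem_of_mem_span _ ?_ hx
    rintro _ ⟨c, o, hw, rfl⟩
    have e : (M - 1) (monom 𝒱' 𝒲' c o) =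
        K (f.toLin (monom 𝒱' 𝒲' c o) - H (monom 𝒱' 𝒲' c o)) := by
      rw [map_sub, hKH]; rfl
    have h₁ : f.toLin (monom 𝒱' 𝒲' c o) - H (monom 𝒱' 𝒲' c o) ∈ weightLT 𝒱 𝒲 w := by
      refine mem_of_pr fun n m => ?_
      by_cases hnm : 2 * n + m < w
      · exact Or.inr fun c o hc ho => Submodule.subset_span ⟨c, o, by omega, rfl⟩
      · refine Or.inl ?_
        rw [map_sub, sub_eq_zero]
        exact key n m c o (by omega)
    rw [e]
    refine map_mem_of_mem_span K.toLinearMap ?_ h₁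
    rintro _ ⟨c, o, h, rfl⟩
    exact Submodule.subset_span ⟨c.map φ.symm, o.map χ.symm, by simpa using h,
      ocMap_monom (𝒲 := 𝒲') (𝒲' := 𝒲) hφ' c o⟩
  have hnil : ∀ x, ∃ k : ℕ, ((M - 1) ^ k) x = 0 := by
    intro x
    obtain ⟨w, hw⟩ := exists_mem_weightLT x
    refine ⟨w, ?_⟩
    induction w generalizing x with
    | zero => simpa [weightLT_zero] using hw
    | succ w ih =>
      rw [pow_succ, Module.End.mul_apply]
      exact ih _ (hM w x hw)
  have hMx : ∀ x, H (M x) = f.toLin x := fun x => hHK _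
  refine ⟨?_, fun d x hx => ?_, fun x hx => ?_⟩
  · have : Function.Bijective (H ∘ M) := by
      refine Function.Bijective.comp ?_ (bijective_of_unipotent hnil)
      exact Function.bijective_iff_has_inverse.2 ⟨K, hKH, hHK⟩
    rwa [show (H ∘ M : OC 𝒱' 𝒲' → OC 𝒱 𝒲) = f.toLin from funext hMx] at this
  · refine mem_of_unipotent hnil (fun y hy => ocMap_mem_homDeg hφ' hχ' ?_)
      (ocMap_mem_homDeg hφ' hχ' hx)
    simpa using f.degree _ _ hy
  · exact mem_of_unipotent hnil (fun y hy => ocMap_mem_openIdeal hφ' (f.map_openIdeal hy))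
      (ocMap_mem_openIdeal hφ' hx)

/-- Inversion of coalgebra maps with bijective linear part. -/
theorem CoalgMap.bijective (f : CoalgMap 𝒱' 𝒲' 𝒱 𝒲)
    (hf : Function.Bijective (linearPart f.toLin)) :
    Function.Bijective f.toLin ∧
      (∀ d x, f.toLin x ∈ homDeg 𝒱 𝒲 d → x ∈ homDeg 𝒱' 𝒲' d) ∧
      ∀ x, f.toLin x ∈ openIdeal 𝒱 𝒲 → x ∈ openIdeal 𝒱' 𝒲' := by
  have h₁ : f.toLin 1 ∈ homDeg 𝒱 𝒲 0 := by simpa using f.degree 0 1 one_mem_homDeg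
  have hc : -closedPart f.toLin [] ∈ 𝒱 0 := neg_mem (projC_mem_of_homDeg h₁)
  have ho : -openPart f.toLin [] [] ∈ 𝒲 0 := neg_mem (projO_mem_of_homDeg h₁)
  have hn : IsNilpotent (symι 𝒱 (-closedPart f.toLin [])) := by
    rw [map_neg]; exact f.isNilpotent_closed.neg
  have hm : IsNilpotent (TensorAlgebra.ι A (-openPart f.toLin [] [])) := by
    rw [map_neg]; exact f.isNilpotent_open.neg
  -- Translating by the negatives of the constants removes them and leaves the linear part
  -- unchanged.
  let τ := shift 𝒱 𝒲 hc hn ho hm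
  have hε : ∀ c o, counit 𝒱 𝒲 (f.toLin (monom 𝒱' 𝒲' c o)) = if c.length = 0 ∧ o.length = 0
      then 1 else 0 := fun c o => by
    rw [← counit_monom (𝒱 := 𝒱') (𝒲 := 𝒲'), ← f.counit_comp]; rfl
  have eC : ∀ c, closedPart (τ.comp f).toLin c = closedPart f.toLin c +
      (if c.length = 0 then (1 : A) else 0) • (-closedPart f.toLin []) := fun c => by
    refine (projC_shiftLin hn hm _).trans ?_
    rw [hε]; simp [closedPart]
  have eO : ∀ c o, openPart (τ.comp f).toLin c o = openPart f.toLin c o +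
      (if c.length = 0 ∧ o.length = 0 then (1 : A) else 0) • (-openPart f.toLin [] []) :=
    fun c o => by
      refine (projO_shiftLin hn hm _).trans ?_
      rw [hε]; rfl
  have hlin : linearPart (τ.comp f).toLin = linearPart f.toLin :=
    funext fun h => Prod.ext (by simp [linearPart, eC]) (by simp [linearPart, eO])
  obtain ⟨hb, hd, hi⟩ := (τ.comp f).bijective_of_zero (by rwa [hlin])
    (by simp [eC]) (by simp [eO])
  refine ⟨?_, fun d x hx => hd d x (by simpa using! τ.degree _ _ hx),
    fun x hx => hi x (τ.map_openIdeal hx)⟩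
  exact (Function.Bijective.of_comp_iff' (bijective_shiftLin hc hn ho hm) _).1 hb

end Inverse

/-! ### Inverse coalgebra maps and conjugation of codifferentials. -/

section Transport

variable {A : Type*} [CommRing A] [Algebra ℚ A]
variable {V W : Type*} [AddCommGroup V] [Module A V] [AddCommGroup W] [Module A W]
variable {V' W' : Type*} [AddCommGroup V'] [Module A V'] [AddCommGroup W'] [Module A W']
variable {𝒱 : ℤ → Submodule A V} {𝒲 : ℤ → Submodule A W}
variable {𝒱' : ℤ → Submodule A V'} {𝒲' : ℤ → Submodule A W'}
variable [DirectSum.Decomposition 𝒱] [DirectSum.Decomposition 𝒲]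
  [DirectSum.Decomposition 𝒱'] [DirectSum.Decomposition 𝒲']

/-- Counit and coproduct pass to the inverse formally. Degree and `ClosedOnly` need that `f`
reflects homogeneity and membership in `openIdeal`, which `CoalgMap.bijective` provides. -/
theorem CoalgMap.exists_inverse (f : CoalgMap 𝒱' 𝒲' 𝒱 𝒲)
    (hf : Function.Bijective (linearPart f.toLin)) : ∃ g : CoalgMap 𝒱 𝒲 𝒱' 𝒲',
      g.toLin ∘ₗ f.toLin = LinearMap.id ∧ f.toLin ∘ₗ g.toLin = LinearMap.id := by
  obtain ⟨hb, hd, hi⟩ := f.bijective hf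
  let e := LinearEquiv.ofBijective f.toLin hb
  have hfe : ∀ x, f.toLin (e.symm x) = x := e.apply_symm_apply
  have hef : ∀ x, e.symm (f.toLin x) = x := e.symm_apply_apply
  have hef' : e.symm.toLinearMap ∘ₗ f.toLin = LinearMap.id := LinearMap.ext hef
  have hfe' : f.toLin ∘ₗ e.symm.toLinearMap = LinearMap.id := LinearMap.ext hfe
  refine ⟨⟨e.symm.toLinearMap, fun d x hx => hd _ _ ?_, ?_, ?_, closedOnly_of_mapsTo
    fun x hx => hi _ ?_⟩, hef', hfe'⟩
  · simpa [hfe] using hx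
  · rw [← f.counit_comp, LinearMap.comp_assoc, hfe', LinearMap.comp_id]
  · have h₁ : TensorProduct.map e.symm.toLinearMap e.symm.toLinearMap ∘ₗ
        TensorProduct.map f.toLin f.toLin = LinearMap.id := by
      rw [← TensorProduct.map_comp, hef', TensorProduct.map_id]
    calc comul 𝒱' 𝒲' ∘ₗ e.symm.toLinearMap
        = (TensorProduct.map e.symm.toLinearMap e.symm.toLinearMap ∘ₗ
            TensorProduct.map f.toLin f.toLin) ∘ₗ comul 𝒱' 𝒲' ∘ₗ e.symm.toLinearMap := by
          rw [h₁, LinearMap.id_comp]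
      _ = TensorProduct.map e.symm.toLinearMap e.symm.toLinearMap ∘ₗ
            (TensorProduct.map f.toLin f.toLin ∘ₗ comul 𝒱' 𝒲') ∘ₗ e.symm.toLinearMap := by
          simp only [LinearMap.comp_assoc]
      _ = _ := by rw [← f.comul_comp, LinearMap.comp_assoc, hfe', LinearMap.comp_id]
  · simpa [hfe] using hx

theorem ksign_add (i j : ℤ) : ksign A (i + j) = ksign A i * ksign A j := by
  simp [ksign, Int.negOnePow_add]

theorem ocSgn_of_mem_homDeg {d : ℤ} {x : OC 𝒱 𝒲} (hx : x ∈ homDeg 𝒱 𝒲 d) :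
    ocSgn 𝒱 𝒲 x = ksign A d • x := by
  refine (Submodule.span_le
    (p := LinearMap.eqLocus (ocSgn 𝒱 𝒲) (ksign A d • LinearMap.id))).2 ?_ hx
  clear hx x
  rintro _ ⟨c, o, rfl, rfl⟩
  rw [SetLike.mem_coe, LinearMap.mem_eqLocus, ocSgn_monom, LinearMap.smul_apply]
  induction c with
  | nil =>
    induction o with
    | nil => simp [ksign_even]
    | cons w o ih =>
      simp only [List.map_cons, monom_cons_right, List.sum_cons, sgn_of_mem 𝒲 w.2.2, map_smul,
        smul_mul_assoc, List.map_nil, List.sum_nil, zero_add, LinearMap.id_apply] at ih ⊢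
      rw [ih, ksign_add, mul_smul, mul_smul_comm]
  | cons v c ih =>
    simp only [List.map_cons, monom_cons_left, List.sum_cons, sgn_of_mem 𝒱 v.2.2, map_smul,
      smul_mul_assoc, LinearMap.id_apply] at ih ⊢
    rw [ih]
    simp only [ksign_add, mul_smul, mul_smul_comm]

theorem ocSgn_comp {G : OC 𝒱' 𝒲' →ₗ[A] OC 𝒱 𝒲} (hG : HasDegree 0 G) :
    ocSgn 𝒱 𝒲 ∘ₗ G = G ∘ₗ ocSgn 𝒱' 𝒲' :=
  oc_hom_ext_homogeneous fun d x hx => by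
    have h := hG d x hx
    rw [add_zero] at h
    rw [LinearMap.comp_apply, LinearMap.comp_apply, ocSgn_of_mem_homDeg h,
      ocSgn_of_mem_homDeg hx, map_smul]

/-- The conjugate of a weak OCHA structure by an invertible coalgebra map. -/
def WeakOCHA.conj (S : WeakOCHA 𝒱 𝒲) (f : CoalgMap 𝒱' 𝒲' 𝒱 𝒲) (g : CoalgMap 𝒱 𝒲 𝒱' 𝒲')
    (hgf : g.toLin ∘ₗ f.toLin = LinearMap.id) (hfg : f.toLin ∘ₗ g.toLin = LinearMap.id) :
    WeakOCHA 𝒱' 𝒲' where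
  D := g.toLin ∘ₗ S.D ∘ₗ f.toLin
  degree := fun d x hx => by
    simpa using g.degree _ _ (S.degree _ _ (f.degree _ _ hx))
  comul_comp := by
    -- The only sign in the co-Leibniz rule is the involution beside `D`; it commutes with `f`
    -- because `f` has degree zero, and then `g` cancels `f`.
    have h : TensorProduct.map g.toLin g.toLin ∘ₗ
        (TensorProduct.map S.D LinearMap.id + TensorProduct.map (ocSgn 𝒱 𝒲) S.D) ∘ₗ
          TensorProduct.map f.toLin f.toLin =
        TensorProduct.map (g.toLin ∘ₗ S.D ∘ₗ f.toLin) LinearMap.id +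
          TensorProduct.map (ocSgn 𝒱' 𝒲') (g.toLin ∘ₗ S.D ∘ₗ f.toLin) := by
      refine TensorProduct.ext' fun x y => ?_
      have h₁ : ∀ x, g.toLin (f.toLin x) = x := LinearMap.congr_fun hgf
      have h₂ := LinearMap.congr_fun (ocSgn_comp f.degree) x
      simp only [LinearMap.comp_apply] at h₂
      simp [h₁, h₂]
    rw [← h, ← LinearMap.comp_assoc, g.comul_comp, LinearMap.comp_assoc, LinearMap.comp_assoc,
      LinearMap.comp_assoc, ← f.comul_comp]
    congr 1
    rw [← LinearMap.comp_assoc f.toLin S.D (comul 𝒱 𝒲), S.comul_comp, LinearMap.comp_assoc]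
  closedOnly := closedOnly_of_mapsTo fun _ hx =>
    g.map_openIdeal (coder_map_openIdeal S.comul_comp S.closedOnly (f.map_openIdeal hx))
  sq_zero := by
    refine LinearMap.ext fun x => ?_
    have h₁ : ∀ x, f.toLin (g.toLin x) = x := LinearMap.congr_fun hfg
    have h₂ : ∀ x, S.D (S.D x) = 0 := LinearMap.congr_fun S.sq_zero
    simp [h₁, h₂]

theorem WeakOCHA.ext_D {S T : WeakOCHA 𝒱 𝒲} (h : S.D = T.D) : S = T := by
  cases S; cases T; congr

/-- Transport of a weak OCHA structure along a coalgebra map with bijective linear part. -/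
theorem WeakOCHA.transport (S : WeakOCHA 𝒱 𝒲) (f : CoalgMap 𝒱' 𝒲' 𝒱 𝒲)
    (hf : Function.Bijective (linearPart f.toLin)) :
    ∃ g : CoalgMap 𝒱 𝒲 𝒱' 𝒲',
      g.toLin ∘ₗ f.toLin = LinearMap.id ∧ f.toLin ∘ₗ g.toLin = LinearMap.id ∧
      ∃ S' : WeakOCHA 𝒱' 𝒲', S'.D = g.toLin ∘ₗ S.D ∘ₗ f.toLin ∧ IsWeakIso f S' S ∧
        ∀ S'' : WeakOCHA 𝒱' 𝒲', IsWeakIso f S'' S → S'' = S' := by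
  obtain ⟨g, hgf, hfg⟩ := f.exists_inverse hf
  refine ⟨g, hgf, hfg, S.conj f g hgf hfg, rfl, ⟨?_, hf⟩, fun S'' h => WeakOCHA.ext_D ?_⟩
  · change f.toLin ∘ₗ g.toLin ∘ₗ S.D ∘ₗ f.toLin = S.D ∘ₗ f.toLin
    rw [← LinearMap.comp_assoc, hfg, LinearMap.id_comp]
  · change S''.D = g.toLin ∘ₗ S.D ∘ₗ f.toLin
    rw [← h.1, ← LinearMap.comp_assoc, hgf, LinearMap.id_comp]

end Transport

/-! ### The operations transported along a translation. -/

section ShiftFormula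

variable {A : Type*} [CommRing A]

theorem mul_mem_mul_smul_top {B : Type*} [Ring B] [Algebra A B] {I J : Ideal A} {x y : B}
    (hx : x ∈ I • (⊤ : Submodule A B)) (hy : y ∈ J • (⊤ : Submodule A B)) :
    x * y ∈ (I * J) • (⊤ : Submodule A B) := by
  refine Submodule.smul_induction_on hx (fun a ha b _ => ?_) fun a b ha hb => ?_
  · refine Submodule.smul_induction_on hy (fun r hr s _ => ?_) fun r s hr hs => ?_
    · rw [smul_mul_smul_comm]
      exact Submodule.smul_mem_smul (Ideal.mul_mem_mul ha hr) trivial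
    · rw [mul_add]
      exact add_mem hr hs
  · rw [add_mul]
    exact add_mem ha hb

/-- Powers of `f x` lie in powers of the ideal times the algebra. This provides the nilpotence on
which both series depend. -/
theorem isNilpotent_of_mem_smul {B : Type*} [Ring B] [Algebra A B] {M : Type*} [AddCommGroup M]
    [Module A M] {P : Submodule A M} {I : Ideal A} (hI : IsNilpotent I) {x : M} (hx : x ∈ I • P)
    (f : M →ₗ[A] B) : IsNilpotent (f x) := by
  have h : f x ∈ I • (⊤ : Submodule A B) := by
    have := Submodule.mem_map_of_mem (f := f) hx
    rw [Submodule.map_smul''] at this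
    exact Submodule.smul_mono le_rfl le_top this
  obtain ⟨N, hN⟩ := hI
  refine ⟨N, ?_⟩
  have hk : ∀ k, f x ^ k ∈ I ^ k • (⊤ : Submodule A B) := by
    intro k
    induction k with
    | zero => simp
    | succ k ih =>
      rw [pow_succ, pow_succ]
      exact mul_mem_mul_smul_top ih h
  have := hk N
  rw [hN] at this
  simpa using this

variable [Algebra ℚ A] {V W : Type*} [AddCommGroup V] [Module A V]
  [AddCommGroup W] [Module A W] {𝒱 : ℤ → Submodule A V} {𝒲 : ℤ → Submodule A W}
  [DirectSum.Decomposition 𝒱] [DirectSum.Decomposition 𝒲]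

theorem weave_zero (obar : W) (m : Fin 1 → ℕ) (o : Fin 0 → W) :
    weave obar m o = List.replicate (m 0) obar := by
  simp [weave]

theorem weave_succ (obar : W) {q : ℕ} (m : Fin (q + 2) → ℕ) (o : Fin (q + 1) → W) :
    weave obar m o = List.replicate (m 0) obar ++ o 0 :: weave obar (Fin.tail m) (Fin.tail o) := by
  simp [weave, List.ofFn_succ, Fin.tail]

theorem prod_weave_eq_zero {obar : W} {N : ℕ} (hN : TensorAlgebra.ι A obar ^ N = 0) {q : ℕ}
    {m : Fin (q + 1) → ℕ} (o : Fin q → W) {i : Fin (q + 1)} (hi : N ≤ m i) :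
    ((weave obar m o).map (TensorAlgebra.ι A)).prod = 0 := by
  induction q with
  | zero =>
    obtain rfl : i = 0 := by omega
    simp [weave_zero, pow_eq_zero_of_le hi hN]
  | succ q ih =>
    rw [weave_succ]
    cases i using Fin.cases with
    | zero => simp [pow_eq_zero_of_le hi hN]
    | succ i =>
      have := ih (m := Fin.tail m) (Fin.tail o) (i := i) hi
      simp [this]

theorem sum_piFinset_succ {M : Type*} [AddCommMonoid M] (s : Finset ℕ) (q : ℕ)
    (F : (Fin (q + 1) → ℕ) → M) :
    ∑ m ∈ Fintype.piFinset (fun _ : Fin (q + 1) => s), F m =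
      ∑ k ∈ s, ∑ m ∈ Fintype.piFinset (fun _ : Fin q => s), F (Fin.cons k m) := by
  rw [← Finset.sum_product']
  refine Finset.sum_nbij' (fun m => (m 0, Fin.tail m)) (fun p => Fin.cons p.1 p.2) ?_ ?_ ?_ ?_ ?_
  · intro m hm
    simp only [Fintype.mem_piFinset, Finset.mem_product, Fin.tail] at hm ⊢
    exact ⟨hm 0, fun i => hm i.succ⟩
  · rintro ⟨k, m⟩ hm
    simp only [Fintype.mem_piFinset, Finset.mem_product] at hm ⊢
    intro i
    cases i using Fin.cases with
    | zero => exact hm.1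
    | succ i => exact hm.2 i
  · intro m _
    exact Fin.cons_self_tail m
  · rintro ⟨k, m⟩ _
    simp
  · intro m _
    exact congrArg F (Fin.cons_self_tail m).symm

theorem tensShift_prod {obar : W} {N : ℕ} (hN : TensorAlgebra.ι A obar ^ N = 0) {q : ℕ}
    (o : Fin q → W) :
    tensShift A obar ((List.ofFn o).map (TensorAlgebra.ι A)).prod =
      ∑ m ∈ Fintype.piFinset (fun _ : Fin (q + 1) => Finset.range N),
        ((weave obar m o).map (TensorAlgebra.ι A)).prod := by
  induction q with
  | zero =>
    rw [sum_piFinset_succ]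
    simp [weave_zero, geom_eq_sum hN]
  | succ q ih =>
    rw [sum_piFinset_succ, List.ofFn_succ, List.map_cons, List.prod_cons, tensShift_ι_mul,
      geom_eq_sum hN, Finset.sum_mul]
    have := ih (Fin.tail o)
    refine Finset.sum_congr rfl fun k _ => ?_
    rw [show (fun i : Fin q => o i.succ) = Fin.tail o from rfl, this, Finset.mul_sum,
      Finset.mul_sum]
    refine Finset.sum_congr rfl fun m _ => ?_
    simp [weave_succ]

/-- The exponential contributes the closed insertions with their factorials, and each of the `q + 1`
gaps of the open word contributes a truncated geometric series. -/
theorem shiftLin_monom {cbar : V} {obar : W} {N : ℕ} (hc : symι 𝒱 cbar ^ N = 0)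
    (ho : TensorAlgebra.ι A obar ^ N = 0) (c : List V) {q : ℕ} (o : Fin q → W) :
    shiftLin 𝒱 𝒲 cbar obar (monom 𝒱 𝒲 c (List.ofFn o)) =
      ∑ x ∈ Finset.range N ×ˢ Fintype.piFinset (fun _ : Fin (q + 1) => Finset.range N),
        algebraMap ℚ A (1 / (x.1.factorial : ℚ)) •
          monom 𝒱 𝒲 (List.replicate x.1 cbar ++ c) (weave obar x.2 o) := by
  rw [Finset.sum_product, shiftLin, monom, TensorProduct.map_tmul, symShift_apply,
    nexp_eq_sum hc, tensShift_prod ho, Finset.sum_mul, TensorProduct.sum_tmul]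
  refine Finset.sum_congr rfl fun k _ => ?_
  rw [TensorProduct.tmul_sum]
  refine Finset.sum_congr rfl fun m _ => ?_
  simp [monom, TensorProduct.smul_tmul']

theorem monom_replicate_eq_zero {cbar : V} {N : ℕ} (hc : symι 𝒱 cbar ^ N = 0) {k : ℕ} (hk : N ≤ k)
    (c : List V) (o : List W) : monom 𝒱 𝒲 (List.replicate k cbar ++ c) o = 0 := by
  simp [monom, pow_eq_zero_of_le hk hc]

/-- The operations of a weak OCHA structure pulled back along a shift. -/
theorem WeakOCHA.shift_formula (S S' : WeakOCHA 𝒱 𝒲) {cbar : V} (hc : cbar ∈ 𝒱 0)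
    (hn : IsNilpotent (symι 𝒱 cbar)) {obar : W} (ho : obar ∈ 𝒲 0)
    (hm : IsNilpotent (TensorAlgebra.ι A obar))
    (h : IsWeakMorphism (shift 𝒱 𝒲 hc hn ho hm) S' S) :
    (∀ c : List V,
      (Function.support fun k : ℕ => S.l (List.replicate k cbar ++ c)).Finite ∧
      S'.l c = ∑ᶠ k : ℕ, algebraMap ℚ A (1 / (k.factorial : ℚ)) •
        S.l (List.replicate k cbar ++ c)) ∧
    ∀ (c : List V) (q : ℕ) (o : Fin q → W),
      (Function.support fun x : ℕ × (Fin (q + 1) → ℕ) =>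
        S.n (List.replicate x.1 cbar ++ c) (weave obar x.2 o)).Finite ∧
      S'.n c (List.ofFn o) = ∑ᶠ x : ℕ × (Fin (q + 1) → ℕ),
        algebraMap ℚ A (1 / (x.1.factorial : ℚ)) •
          S.n (List.replicate x.1 cbar ++ c) (weave obar x.2 o) := by
  have hD : ∀ x, shiftLin 𝒱 𝒲 cbar obar (S'.D x) = S.D (shiftLin 𝒱 𝒲 cbar obar x) :=
    LinearMap.congr_fun h
  have hε : ∀ x, counit 𝒱 𝒲 (S'.D x) = 0 := LinearMap.congr_fun (counit_comp_coder S'.comul_comp)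
  -- Projecting the morphism equation: the translation alters projections only by multiples of the
  -- counit, which vanishes on the image of the coderivation `S'.D`.
  have hC : ∀ x, projC 𝒱 𝒲 (S'.D x) = projC 𝒱 𝒲 (S.D (shiftLin 𝒱 𝒲 cbar obar x)) := fun x => by
    rw [← hD, projC_shiftLin hn hm, hε, zero_smul, add_zero]
  have hO : ∀ x, projO 𝒱 𝒲 (S'.D x) = projO 𝒱 𝒲 (S.D (shiftLin 𝒱 𝒲 cbar obar x)) := fun x => by
    rw [← hD, projO_shiftLin hn hm, hε, zero_smul, add_zero]
  obtain ⟨a, ha⟩ := hn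
  obtain ⟨b, hb⟩ := hm
  -- A common exponent for both constants, positive so that the term without insertions lies in the
  -- range of summation.
  obtain ⟨N, haN, hbN⟩ : ∃ N, symι 𝒱 cbar ^ (N + 1) = 0 ∧ TensorAlgebra.ι A obar ^ (N + 1) = 0 :=
    ⟨a + b, pow_eq_zero_of_le (by omega) ha, pow_eq_zero_of_le (by omega) hb⟩
  refine ⟨fun c => ?_, fun c q o => ?_⟩
  · have hs : (Function.support fun k : ℕ => S.l (List.replicate k cbar ++ c)) ⊆
        Finset.range (N + 1) := by
      intro k hk
      by_contra hk'
      refine hk ?_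
      change projC 𝒱 𝒲 (S.D (monom 𝒱 𝒲 _ _)) = 0
      rw [monom_replicate_eq_zero haN (by simpa using hk'), map_zero, map_zero]
    refine ⟨(Finset.finite_toSet _).subset hs, ?_⟩
    rw [finsum_eq_sum_of_support_subset _ (s := Finset.range (N + 1))
      fun k hk => hs fun h₀ => hk (by simp only [h₀, smul_zero])]
    change projC 𝒱 𝒲 (S'.D (monom 𝒱 𝒲 c [])) = _
    have e := shiftLin_monom (𝒲 := 𝒲) haN hbN c (Fin.elim0 : Fin 0 → W)
    rw [List.ofFn_zero, Finset.sum_product] at e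
    rw [hC, e, map_sum, map_sum]
    refine Finset.sum_congr rfl fun k _ => ?_
    -- Only the summand without inserted open letters survives, since the closed component of `S.D`
    -- takes no open input.
    rw [sum_piFinset_succ, map_sum, map_sum, Finset.sum_eq_single 0]
    · simp [weave_zero, l, closedPart]
    · intro m _ hm
      simp only [map_sum, map_smul]
      refine Finset.sum_eq_zero fun m' _ => ?_
      rw [S.closedOnly _ _ (by simp [weave_zero, hm]), smul_zero]
    · simp
  · have hs : (Function.support fun x : ℕ × (Fin (q + 1) → ℕ) =>
        S.n (List.replicate x.1 cbar ++ c) (weave obar x.2 o)) ⊆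
        (Finset.range (N + 1) ×ˢ
          Fintype.piFinset (fun _ : Fin (q + 1) => Finset.range (N + 1)) : Finset _) := by
      intro x hx
      by_contra hx'
      refine hx ?_
      change projO 𝒱 𝒲 (S.D (monom 𝒱 𝒲 _ _)) = 0
      suffices monom 𝒱 𝒲 (List.replicate x.1 cbar ++ c) (weave obar x.2 o) = 0 by
        rw [this, map_zero, map_zero]
      by_cases hk : N + 1 ≤ x.1
      · exact monom_replicate_eq_zero haN hk _ _
      · obtain ⟨i, hi⟩ : ∃ i, N + 1 ≤ x.2 i := by
          by_contra! hcon
          exact hx' (by simpa [Fintype.mem_piFinset] using ⟨Nat.lt_succ_iff.1 (not_le.1 hk), fun i => Nat.lt_succ_iff.1 (hcon i)⟩)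
        rw [monom, prod_weave_eq_zero hbN o hi, TensorProduct.tmul_zero]
    refine ⟨(Finset.finite_toSet _).subset hs, ?_⟩
    rw [finsum_eq_sum_of_support_subset _ (s := Finset.range (N + 1) ×ˢ
      Fintype.piFinset (fun _ : Fin (q + 1) => Finset.range (N + 1)))
      fun x hx => hs fun h₀ => hx (by simp only [h₀, smul_zero])]
    change projO 𝒱 𝒲 (S'.D (monom 𝒱 𝒲 c (List.ofFn o))) = _
    rw [hO, shiftLin_monom haN hbN, map_sum, map_sum]
    refine Finset.sum_congr rfl fun x _ => ?_
    rw [map_smul, map_smul]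
    rfl

end ShiftFormula

end

end OpenClosed

theorem lemma5p2 {A : Type*} [CommRing A] [Algebra ℚ A]
    {V W V' W' : Type*} [AddCommGroup V] [Module A V] [AddCommGroup W] [Module A W]
    [AddCommGroup V'] [Module A V'] [AddCommGroup W'] [Module A W']
    (𝒱 : ℤ → Submodule A V) [DirectSum.Decomposition 𝒱]
    (𝒲 : ℤ → Submodule A W) [DirectSum.Decomposition 𝒲]
    (𝒱' : ℤ → Submodule A V') [DirectSum.Decomposition 𝒱']
    (𝒲' : ℤ → Submodule A W') [DirectSum.Decomposition 𝒲']
    (S : OpenClosed.OCHA 𝒱 𝒲) :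
    (∀ f : OpenClosed.CoalgMap 𝒱' 𝒲' 𝒱 𝒲, Function.Bijective (OpenClosed.linearPart f.toLin) →
      ∃ g : OpenClosed.CoalgMap 𝒱 𝒲 𝒱' 𝒲',
        g.toLin ∘ₗ f.toLin = LinearMap.id ∧ f.toLin ∘ₗ g.toLin = LinearMap.id ∧
        ∃ S' : OpenClosed.WeakOCHA 𝒱' 𝒲',
          S'.D = g.toLin ∘ₗ S.D ∘ₗ f.toLin ∧
          OpenClosed.IsWeakIso f S' S.toWeakOCHA ∧
          ∀ S'' : OpenClosed.WeakOCHA 𝒱' 𝒲',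
            OpenClosed.IsWeakIso f S'' S.toWeakOCHA → S'' = S') ∧
    (∀ (m : Ideal A), IsNilpotent m →
      ∀ cbar ∈ m • 𝒱 0, ∀ obar ∈ m • 𝒲 0,
        (∃! f : OpenClosed.CoalgMap 𝒱 𝒲 𝒱 𝒲, OpenClosed.IsShift f cbar obar) ∧
        ∀ f : OpenClosed.CoalgMap 𝒱 𝒲 𝒱 𝒲, OpenClosed.IsShift f cbar obar →
          ∃ S' : OpenClosed.WeakOCHA 𝒱 𝒲, OpenClosed.IsWeakIso f S' S.toWeakOCHA ∧
            (∀ (p : ℕ) (c : Fin p → V),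
              (Function.support fun k : ℕ =>
                S.l (List.replicate k cbar ++ List.ofFn c)).Finite ∧
              S'.l (List.ofFn c) =
                ∑ᶠ k : ℕ, algebraMap ℚ A (1 / (k.factorial : ℚ)) •
                  S.l (List.replicate k cbar ++ List.ofFn c)) ∧
            (∀ (p q : ℕ) (c : Fin p → V) (o : Fin q → W),
              (Function.support fun x : ℕ × (Fin (q + 1) → ℕ) =>
                S.n (List.replicate x.1 cbar ++ List.ofFn c)
                  (OpenClosed.weave obar x.2 o)).Finite ∧
              S'.n (List.ofFn c) (List.ofFn o) =
                ∑ᶠ x : ℕ × (Fin (q + 1) → ℕ), algebraMap ℚ A (1 / (x.1.factorial : ℚ)) •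
                  S.n (List.replicate x.1 cbar ++ List.ofFn c)
                    (OpenClosed.weave obar x.2 o))) := by
  refine ⟨fun f hf => S.toWeakOCHA.transport f hf, fun m hm cbar hcbar obar hobar => ?_⟩
  have hc : cbar ∈ 𝒱 0 := Submodule.smul_le_right hcbar
  have ho : obar ∈ 𝒲 0 := Submodule.smul_le_right hobar
  have hn := OpenClosed.isNilpotent_of_mem_smul hm hcbar (OpenClosed.symι 𝒱)
  have hn' := OpenClosed.isNilpotent_of_mem_smul hm hobar (TensorAlgebra.ι A)
  have hs := OpenClosed.isShift_shift hc hn ho hn'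
  refine ⟨⟨_, hs, fun f hf => hf.unique hs⟩, fun f hf => ?_⟩
  -- By uniqueness `f` may be taken to be the explicit translation, whose expansion on monomials is
  -- known.
  obtain rfl := hf.unique hs
  have hlin : OpenClosed.linearPart (OpenClosed.shift 𝒱 𝒲 hc hn ho hn').toLin = id :=
    funext fun x => Prod.ext (hf.closed_one x.1) (hf.open_one x.2)
  obtain ⟨-, -, -, S', -, hiso, -⟩ := S.toWeakOCHA.transport
    (OpenClosed.shift 𝒱 𝒲 hc hn ho hn') (hlin ▸ Function.bijective_id)
  obtain ⟨hl, hn₂⟩ := S.toWeakOCHA.shift_formula S' hc hn ho hn' hiso.1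
  exact ⟨S', hiso, fun p c => hl (List.ofFn c), fun p q c o => hn₂ (List.ofFn c) q o⟩
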